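/- Consider one bosonic mode with annihilation operator $a$, number basis $|n\rangle$, quadratures $\hat r=(\hat x,\hat p)$, $\hat x=\frac{1}{\sqrt2}(a+a^\dagger)$, $\hat p=-\frac{i}{\sqrt2}(a-a^\dagger)$, displacement operators $D(z)=e^{za^\dagger-\bar z a}$ and coherent states $|z\rangle=D(z)|0\rangle$. For a state (density operator) $\rho$ let $\chi_\rho(z)=\mathrm{Tr}\,\rho D(z)$ be its characteristic function and $$W_\rho(\alpha)=\frac1{\pi^2}\int_{\mathbb C}\chi_\rho(z)\,e^{\bar z\alpha-z\bar\alpha}\,d^2z$$ its Wigner function; $\rho$ is Wigner positive if $W_\rho\ge 0$ everywhere and Wigner negative otherwise. The state $\rho$ is classical if it is a mixture $\int |z\rangle\langle z|\,d\mu(z)$ of coherent states, with $\mu$ a probability measure. The quadrature coherence scale $\mathcal C(\rho)$ is given by $$\mathcal C^2(\rho)=\frac{1}{2\,\mathrm{Tr}\rho^2}\sum_{j=1}^{2}\mathrm{Tr}\,[\rho,\hat r_j][\hat r_j,\rho].$$ Let $\rho^{\mathrm G}$ be a Gaussian state with displacement vector $d_i=\mathrm{Tr}(\hat r_i\rho^{\mathrm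 G})$ and covariance matrix $V_{ij}=\langle\{\hat r_i,\hat r_j\}\rangle-2\langle\hat r_i\rangle\langle\hat r_j\rangle$, that is, $$\chi_{\rho^{\mathrm G}}(z)=\exp\Big(-\tfrac12\xi^T\Omega V\Omega^T\xi-i\sqrt2\,(\Omega d)^T\xi\Big),\qquad \xi=(\mathrm{Re}\,z,\mathrm{Im}\,z)^T,\quad \Omega=\begin{pmatrix}0&1\\-1&0\end{pmatrix}.$$ Let $v_1\le v_2$ be the eigenvalues of $V$, and $e_1,e_2$ a corresponding orthonormal basis of eigenvectors in $\mathbb R^2$. Let $c\in\mathbb C$, $|c|=1$, $a(c)=\bar c\,a$, $a^\dagger(c)=c\,a^\dagger$, suppose that $a(c)\rho^{\mathrm G}a^\dagger(c)\neq0$, and let $$\rho^{\mathrm G}_-=\frac{a(c)\rho^{\mathrm G}a^\dagger(c)}{\mathrm{Tr}\big(a(c)\rho^{\mathrm G}a^\dagger(c)\big)}$$ be the photon-subtracted state. Then $\rho^{\mathrm G}_-$ is a state with integrable characteristic function, the commutators $[\rho^{\mathrm G},\hat r_j]$ are Hilbert--Schmidt (so that $\mathcal C^2(\rho^{\mathrm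 G})$ is finite), and: 1. If $v_1>1$, then $\rho^{\mathrm G}_-$ is classical, with $\rho^{\mathrm G}_-=\int P(z)|z\rangle\langle z|\,d^2z$ for a nonnegative integrable function $P$, and hence Wigner positive. 2. If $v_1<1$, then $\rho^{\mathrm G}_-$ is Wigner negative if and only if $\mathcal C^2(\rho^{\mathrm G})>1$. 3. If $v_1=1$, then $\rho^{\mathrm G}_-$ is Wigner negative if and only if $\mathcal C^2(\rho^{\mathrm G})>1+(d^Te_1)^2$. 4. In every case, if $\rho^{\mathrm G}_-$ is Wigner negative, then $\mathcal C^2(\rho^{\mathrm G})>1$, that is, $\rho^{\mathrm G}$ is strongly nonclassical. -/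

import Mathlib

open scoped Matrix ComplexOrder ComplexConjugate
open MeasureTheory

namespace OneMode

/-! One bosonic mode in the Fock representation.  An operator `A` is given by its matrix elements
`A m n = ⟨m|A|n⟩` in the orthonormal basis `|0⟩, |1⟩, |2⟩, …` of number states. -/

/-- Operator product, `⟨m|AB|n⟩ = ∑ₖ ⟨m|A|k⟩⟨k|B|n⟩`. -/
noncomputable def opMul (A B : Matrix ℕ ℕ ℂ) : Matrix ℕ ℕ ℂ :=
  fun m n => ∑' k, A m k * B k n

infixl:70 " ⊡ " => opMul

/-- Trace, `Tr A = ∑ₙ ⟨n|A|n⟩`. -/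
noncomputable def opTr (A : Matrix ℕ ℕ ℂ) : ℂ := ∑' n, A n n

/-- Powers of an operator. -/
noncomputable def opPow (A : Matrix ℕ ℕ ℂ) : ℕ → Matrix ℕ ℕ ℂ
  | 0 => 1
  | k + 1 => A ⊡ opPow A k

/-- Exponential of an operator, `⟨m|exp A|n⟩ = ∑ₖ ⟨m|Aᵏ|n⟩ / k!`. -/
noncomputable def opExp (A : Matrix ℕ ℕ ℂ) : Matrix ℕ ℕ ℂ :=
  fun m n => ∑' k : ℕ, opPow A k m n / (k.factorial : ℂ)

/-- Commutator `[A, B]`. -/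
noncomputable def comm (A B : Matrix ℕ ℕ ℂ) : Matrix ℕ ℕ ℂ := A ⊡ B - B ⊡ A

/-- The annihilation operator, `a|n⟩ = √n |n-1⟩`; the creation operator is its adjoint `annᴴ`. -/
noncomputable def ann : Matrix ℕ ℕ ℂ :=
  fun m n => if n = m + 1 then ((Real.sqrt n : ℝ) : ℂ) else 0

/-- `a(z) = z̄ a`. -/
noncomputable def lower (z : ℂ) : Matrix ℕ ℕ ℂ := conj z • ann

/-- `a†(z) = z a†`. -/
noncomputable def raise (z : ℂ) : Matrix ℕ ℕ ℂ := z • annᴴ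

/-- The quadratures `r̂ = (x̂, p̂)`, `x̂ = (a + a†)/√2`, `p̂ = -i(a - a†)/√2`. -/
noncomputable def quad : Fin 2 → Matrix ℕ ℕ ℂ :=
  ![((Real.sqrt 2 : ℝ) : ℂ)⁻¹ • (ann + annᴴ),
    (-Complex.I * ((Real.sqrt 2 : ℝ) : ℂ)⁻¹) • (ann - annᴴ)]

/-- The displacement operator `D(z) = exp(a†(z) - a(z))`. -/
noncomputable def displacement (z : ℂ) : Matrix ℕ ℕ ℂ := opExp (raise z - lower z)

/-- The components `⟨m|z⟩` of the coherent state `|z⟩ = D(z)|0⟩`. -/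
noncomputable def coherent (z : ℂ) (m : ℕ) : ℂ := displacement z m 0

/-- A quantum state (density operator): positive semidefinite with trace one. -/
def IsState (ρ : Matrix ℕ ℕ ℂ) : Prop := ρ.PosSemidef ∧ HasSum (fun n => ρ n n) 1

/-- The characteristic function `χ(z) = Tr ρ D(z)`. -/
noncomputable def charFn (ρ : Matrix ℕ ℕ ℂ) (z : ℂ) : ℂ := opTr (ρ ⊡ displacement z)

/-- The Wigner function `W(α) = π⁻² ∫ χ(z) exp(z̄ α - z ᾱ) d²z`. -/
noncomputable def wigner (ρ : Matrix ℕ ℕ ℂ) (α : ℂ) : ℂ :=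
  ((Real.pi ^ 2 : ℝ) : ℂ)⁻¹ * ∫ z : ℂ, charFn ρ z * Complex.exp (conj z * α - z * conj α)

/-- The Wigner function is everywhere (real and) nonnegative. -/
def WignerPositive (ρ : Matrix ℕ ℕ ℂ) : Prop := ∀ α : ℂ, 0 ≤ wigner ρ α

/-- A state that is not Wigner positive is called Wigner negative. -/
def WignerNegative (ρ : Matrix ℕ ℕ ℂ) : Prop := ¬ WignerPositive ρ

/-- `ρ = ∫ P(z) |z⟩⟨z| d²z` with a nonnegative integrable function `P`. -/
def HasPFunction (ρ : Matrix ℕ ℕ ℂ) (P : ℂ → ℝ) : Prop :=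
  (∀ z, 0 ≤ P z) ∧ Integrable P ∧
    ∀ m n, ρ m n = ∫ z : ℂ, (P z : ℂ) * (coherent z m * conj (coherent z n))

/-- (Optical) classicality: the state is a mixture of coherent states,
`ρ = ∫ |z⟩⟨z| dμ(z)` for a probability measure `μ`. -/
def IsClassical (ρ : Matrix ℕ ℕ ℂ) : Prop :=
  ∃ μ : Measure ℂ, IsProbabilityMeasure μ ∧
    ∀ m n, ρ m n = ∫ z : ℂ, coherent z m * conj (coherent z n) ∂μ

/-- The displacement vector `dᵢ = Tr(r̂ᵢ ρ)`. -/
noncomputable def dispVec (ρ : Matrix ℕ ℕ ℂ) : Fin 2 → ℝ :=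
  fun i => (opTr (quad i ⊡ ρ)).re

/-- The covariance matrix `Vᵢⱼ = ⟨{r̂ᵢ, r̂ⱼ}⟩ - 2⟨r̂ᵢ⟩⟨r̂ⱼ⟩`. -/
noncomputable def covMat (ρ : Matrix ℕ ℕ ℂ) : Matrix (Fin 2) (Fin 2) ℝ :=
  fun i j => (opTr ((quad i ⊡ quad j + quad j ⊡ quad i) ⊡ ρ)).re
    - 2 * dispVec ρ i * dispVec ρ j

/-- The symplectic form. -/
def symp : Matrix (Fin 2) (Fin 2) ℝ := !![0, 1; -1, 0]

/-- The Gaussian `exp(-½ ξᵀ Ω V Ωᵀ ξ - i√2 (Ω d)ᵀ ξ)`, where `ξ = (Re z, Im z)`. -/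
noncomputable def gaussianCharFn (V : Matrix (Fin 2) (Fin 2) ℝ) (d : Fin 2 → ℝ) (z : ℂ) : ℂ :=
  let ξ : Fin 2 → ℝ := ![z.re, z.im]
  Complex.exp (((-(1 / 2) * (ξ ⬝ᵥ (symp * V * sympᵀ) *ᵥ ξ) : ℝ) : ℂ)
    - Complex.I * ((Real.sqrt 2 * ((symp *ᵥ d) ⬝ᵥ ξ) : ℝ) : ℂ))

/-- A Gaussian state: the characteristic function is the Gaussian determined by the covariance
matrix and the displacement vector of the state. -/
def IsGaussianState (ρ : Matrix ℕ ℕ ℂ) : Prop :=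
  IsState ρ ∧ ∀ z, charFn ρ z = gaussianCharFn (covMat ρ) (dispVec ρ) z

/-- The photon-subtracted state `ρ₋ = a(c) ρ a†(c) / Tr(a(c) ρ a†(c))`. -/
noncomputable def photonSub (c : ℂ) (ρ : Matrix ℕ ℕ ℂ) : Matrix ℕ ℕ ℂ :=
  (opTr (lower c ⊡ ρ ⊡ raise c))⁻¹ • (lower c ⊡ ρ ⊡ raise c)

/-- The purity `Tr ρ²`. -/
noncomputable def purity (ρ : Matrix ℕ ℕ ℂ) : ℝ := (opTr (ρ ⊡ ρ)).re

/-- The squared quadrature coherence scale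
`C²(ρ) = (2 Tr ρ²)⁻¹ ∑ⱼ Tr [ρ, r̂ⱼ][r̂ⱼ, ρ]`. -/
noncomputable def qcsSq (ρ : Matrix ℕ ℕ ℂ) : ℝ :=
  (1 / (2 * purity ρ)) * ∑ j : Fin 2, (opTr (comm ρ (quad j) ⊡ comm (quad j) ρ)).re

/-- The commutators `[ρ, r̂ⱼ]` are Hilbert-Schmidt, so that the traces in `qcsSq` converge. -/
def HasQCS (ρ : Matrix ℕ ℕ ℂ) : Prop :=
  ∀ j : Fin 2, Summable fun mn : ℕ × ℕ => ‖comm ρ (quad j) mn.1 mn.2‖ ^ 2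

end OneMode

open OneMode

namespace OneMode

/-! Write `χ(z) = exp(-k|z|² - Re(l̄z²) + gz - ḡz̄)`. Here `k + |l| = v₂/2`, `k - |l| = v₁/2`, `l =
|l|ε²` with `ε` the eigenvector `e₁` read as a complex number, and `g = d̄/√2`. Such a Gaussian
solves two first-order linear equations in `∂_z` and `∂_z̄`. The inversion formula `∫ χ(z) D(z)† d²z
= const · ρ` (`weylInt_charFn`) turns multiplication by `z`, `z̄` into commutators with `a`, `a†`,
and derivatives into half anticommutators. The equations thus become two linear relations between
`aρ`, `ρa`, `a†ρ` and `ρa†` (`gaussRel_of_charFn`).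

The rest of the analysis of `ρ` is algebra with these relations. They form a recursion for the
number-basis entries: `ρ` is determined by its vacuum entry (`GaussRel.eq_smul`), positivity of the
first 2×2 block gives the uncertainty relation `v₁v₂ ≥ 1` (`GaussRel.relB_nonneg`), and the entries
decay geometrically (`GaussRel.geomBound`), so that traces converge absolutely and are cyclic.
Pairing the relations with `D(z)` gives the characteristic function of `aρa†`, a quadratic
polynomial times `χ` (`GaussRel.charFn_annL_creR`). Pairing them with `[ρ, a†]` gives `C² = k/(2(k²
- |l|²)) = (1/v₁ + 1/v₂)/2` (`GaussRel.qcsSq_eq`).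

By Fourier transform, the Wigner function of the subtracted state at `kμ - lμ̄ + ḡ` is a positive
multiple of `|(k - 1/2)μ - lμ̄ + ḡ|² + (1 - C²)/2` (`GaussRel.wigner_photonSub`). Negativity
therefore forces `C² > 1`. The real-linear map `μ ↦ (k - 1/2)μ - lμ̄` has determinant `(v₁ - 1)(v₂ -
1)/4`. If `v₁ < 1`, then `v₂ > 1`, the map is onto and the square can be made zero. If `v₁ = 1 <
v₂`, its range is the line orthogonal to `e₁`, and the least value of the square is `(dᵀe₁)²/2`. If
`v₁ = v₂ = 1`, then `C² = 1` and both sides of the equivalence fail. If `v₁ > 1`, a Gaussian mixture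
of coherent states satisfies the same ladder relations and so is proportional to `ρ`; since
`a|z⟩⟨z|a† = |z|²|z⟩⟨z|`, photon subtraction multiplies its density by `|z|²` and a constant. -/

/-! ### Ladder operators on matrices -/

/-- The complex number `√n`. -/
noncomputable def nsqrt (n : ℕ) : ℂ := ((Real.sqrt n : ℝ) : ℂ)

@[simp] lemma nsqrt_zero : nsqrt 0 = 0 := by simp [nsqrt]

@[simp] lemma nsqrt_one : nsqrt 1 = 1 := by simp [nsqrt]

lemma nsqrt_mul_self (n : ℕ) : nsqrt n * nsqrt n = n := by
  rw [nsqrt, ← Complex.ofReal_mul, Real.mul_self_sqrt (Nat.cast_nonneg n), Complex.ofReal_natCast]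

lemma nsqrt_succ_ne_zero (n : ℕ) : nsqrt (n + 1) ≠ 0 := by
  rw [nsqrt, Complex.ofReal_ne_zero]
  positivity

@[simp] lemma conj_nsqrt (n : ℕ) : conj (nsqrt n) = nsqrt n := Complex.conj_ofReal _

@[simp] lemma norm_nsqrt (n : ℕ) : ‖nsqrt n‖ = Real.sqrt n := by
  rw [nsqrt, Complex.norm_real, Real.norm_of_nonneg (Real.sqrt_nonneg _)]

/-- `X ↦ a X`. -/
noncomputable def annL (X : Matrix ℕ ℕ ℂ) : Matrix ℕ ℕ ℂ := fun m n => nsqrt (m + 1) * X (m + 1) n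

/-- `X ↦ a† X`. -/
noncomputable def creL (X : Matrix ℕ ℕ ℂ) : Matrix ℕ ℕ ℂ := fun m n => nsqrt m * X (m - 1) n

/-- `X ↦ X a`. -/
noncomputable def annR (X : Matrix ℕ ℕ ℂ) : Matrix ℕ ℕ ℂ := fun m n => nsqrt n * X m (n - 1)

/-- `X ↦ X a†`. -/
noncomputable def creR (X : Matrix ℕ ℕ ℂ) : Matrix ℕ ℕ ℂ := fun m n => nsqrt (n + 1) * X m (n + 1)

lemma ann_apply (m n : ℕ) : ann m n = if n = m + 1 then nsqrt n else 0 := rfl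

lemma ann_conjTranspose_apply (m n : ℕ) : annᴴ m n = if m = n + 1 then nsqrt m else 0 := by
  rw [Matrix.conjTranspose_apply, ann_apply]
  split_ifs <;> simp

lemma opMul_ladder_left (α β : ℂ) (X : Matrix ℕ ℕ ℂ) :
    (α • ann + β • annᴴ) ⊡ X = α • annL X + β • creL X := by
  ext m n
  simp only [opMul, Matrix.add_apply, Matrix.smul_apply, smul_eq_mul, ann_apply,
    ann_conjTranspose_apply, annL, creL]
  -- At `m = 0` the truncated index `m - 1 = 0` is harmless: its coefficient is `nsqrt 0 = 0`. The
  -- other shifts below rely on the same convention.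
  rw [tsum_eq_sum (s := {m + 1, m - 1})]
  · rw [Finset.sum_pair (by omega)]
    rcases m with _ | m
    · simp
    · simp [show ¬ m = m + 1 + 1 by omega]
      ring
  · intro k hk
    simp only [Finset.mem_insert, Finset.mem_singleton, not_or] at hk
    rw [if_neg hk.1]
    rcases m with _ | m
    · simp
    · rw [if_neg (by omega)]
      simp

lemma opMul_ladder_right (α β : ℂ) (X : Matrix ℕ ℕ ℂ) :
    X ⊡ (α • ann + β • annᴴ) = α • annR X + β • creR X := by
  ext m n
  simp only [opMul, Matrix.add_apply, Matrix.smul_apply, smul_eq_mul, ann_apply,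
    ann_conjTranspose_apply, annR, creR]
  rw [tsum_eq_sum (s := {n + 1, n - 1})]
  · rw [Finset.sum_pair (by omega)]
    rcases n with _ | n
    · simp
      ring
    · simp [show ¬ n = n + 1 + 1 by omega]
      ring
  · intro k hk
    simp only [Finset.mem_insert, Finset.mem_singleton, not_or] at hk
    rw [if_neg hk.1]
    rcases n with _ | n
    · simp
    · rw [if_neg (by omega)]
      simp

/-! ### Matrix elements of the displacement operators -/

/-- The matrix elements of `exp(-pq/2) exp(p a†) exp(-q a)`; for `q = p̄` this is the displacement
operator `D(p)`. -/
noncomputable def dispKer (p q : ℂ) : ℕ → ℕ → ℂ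
  | 0, 0 => Complex.exp (-(p * q) / 2)
  | m + 1, 0 => p * dispKer p q m 0 / nsqrt (m + 1)
  | m, n + 1 => (nsqrt m * dispKer p q (m - 1) n - q * dispKer p q m n) / nsqrt (n + 1)
termination_by m n => (n, m)

lemma dispKer_zero_zero (p q : ℂ) : dispKer p q 0 0 = Complex.exp (-(p * q) / 2) := by
  rw [dispKer]

lemma dispKer_creR (p q : ℂ) (m n : ℕ) : nsqrt (n + 1) * dispKer p q m (n + 1) =
    nsqrt m * dispKer p q (m - 1) n - q * dispKer p q m n := by
  rw [dispKer, mul_div_cancel₀ _ (nsqrt_succ_ne_zero n)]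

lemma dispKer_succ_zero (p q : ℂ) (m : ℕ) :
    nsqrt (m + 1) * dispKer p q (m + 1) 0 = p * dispKer p q m 0 := by
  rw [dispKer, mul_div_cancel₀ _ (nsqrt_succ_ne_zero m)]

/-- The recursion on columns encodes `Da† = (a† - q)D`; this is its companion `aD = D(a + p)`.
Induction on the column uses the hypothesis at the rows `m` and `m - 1`. -/
lemma dispKer_annL (p q : ℂ) (n : ℕ) : ∀ m, nsqrt (m + 1) * dispKer p q (m + 1) n =
    p * dispKer p q m n + nsqrt n * dispKer p q m (n - 1) := by
  induction n with
  | zero => intro m; simp [dispKer_succ_zero]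
  | succ n ih =>
    intro m
    refine mul_left_cancel₀ (nsqrt_succ_ne_zero n) ?_
    have h1 := dispKer_creR p q (m + 1) n
    have h2 := dispKer_creR p q m n
    have h3 := ih m
    have h4 := nsqrt_mul_self (n + 1)
    have h5 := nsqrt_mul_self (m + 1)
    simp only [Nat.add_sub_cancel] at *
    -- Eliminates the doubly shifted entry `(m - 1, n - 1)` between the hypothesis at row `m - 1`
    -- and the recursion for column `n`.
    have key : (m : ℂ) * dispKer p q m n - q * (nsqrt n * dispKer p q m (n - 1)) =
        p * (nsqrt m * dispKer p q (m - 1) n) + n * dispKer p q m n := by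
      have e2 : nsqrt n * (nsqrt m * dispKer p q (m - 1) (n - 1)
          - q * dispKer p q m (n - 1)) = n * dispKer p q m n := by
        rcases n with _ | n
        · simp
        · rw [← nsqrt_mul_self (n + 1), mul_assoc, dispKer_creR p q m n, Nat.add_sub_cancel]
      have e1 : (m : ℂ) * dispKer p q m n =
          nsqrt m * (p * dispKer p q (m - 1) n + nsqrt n * dispKer p q (m - 1) (n - 1)) := by
        rcases m with _ | m
        · simp
        · rw [Nat.add_sub_cancel, ← ih m, ← mul_assoc, nsqrt_mul_self]
      linear_combination e1 + e2
    push_cast at h4 h5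
    linear_combination nsqrt (m + 1) * h1 - p * h2 - q * h3 + key + dispKer p q m n * h5
      - dispKer p q m n * h4

/-- Differentiates `exp(-pq/2) exp(pa†) exp(-qa)` as a product. The parameter field is left general:
complex parameters serve the Taylor series of the exponential, real ones the Wirtinger derivatives.
-/
lemma hasDerivAt_dispKer {𝕜 : Type*} [NontriviallyNormedField 𝕜] [NormedAlgebra 𝕜 ℂ]
    {p q : 𝕜 → ℂ} {e f : ℂ} {t : 𝕜} (hp : HasDerivAt p e t) (hq : HasDerivAt q f t) (n : ℕ) :
    ∀ m, HasDerivAt (fun x => dispKer (p x) (q x) m n)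
      (e * (nsqrt m * dispKer (p t) (q t) (m - 1) n - q t / 2 * dispKer (p t) (q t) m n)
        - f * (nsqrt n * dispKer (p t) (q t) m (n - 1) + p t / 2 * dispKer (p t) (q t) m n)) t := by
  induction n with
  | zero =>
    intro m
    induction m with
    | zero =>
      simp only [dispKer_zero_zero]
      convert! ((hp.mul hq).neg.div_const 2).cexp using 1
      simp
      ring
    | succ m ih =>
      have h : (fun x => dispKer (p x) (q x) (m + 1) 0)
          = fun x => p x * dispKer (p x) (q x) m 0 / nsqrt (m + 1) := by
        funext x
        rw [dispKer]
      rw [h]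
      convert! (hp.mul ih).div_const (nsqrt (m + 1)) using 1
      rw [eq_div_iff (nsqrt_succ_ne_zero m)]
      have h1 := dispKer_succ_zero (p t) (q t) m
      have h2 := nsqrt_mul_self (m + 1)
      have h3 : p t * (nsqrt m * dispKer (p t) (q t) (m - 1) 0) = m * dispKer (p t) (q t) m 0 := by
        rcases m with _ | m
        · simp
        · rw [← nsqrt_mul_self (m + 1), mul_assoc, dispKer_succ_zero, Nat.add_sub_cancel]
          ring
      push_cast at h2
      simp only [Nat.add_sub_cancel, nsqrt_zero, zero_mul, zero_add] at *
      linear_combination (e * dispKer (p t) (q t) m 0) * h2 - (e * q t / 2 + f * p t / 2) * h1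
        - e * h3
  | succ n ih =>
    intro m
    have h : (fun x => dispKer (p x) (q x) m (n + 1)) = fun x =>
        (nsqrt m * dispKer (p x) (q x) (m - 1) n - q x * dispKer (p x) (q x) m n)
          / nsqrt (n + 1) := by
      funext x
      rw [dispKer]
    rw [h]
    convert! (((ih (m - 1)).const_mul (nsqrt m)).sub (hq.mul (ih m))).div_const
      (nsqrt (n + 1)) using 1
    rw [eq_div_iff (nsqrt_succ_ne_zero n)]
    have h1 := dispKer_creR (p t) (q t) m n
    have h2 := nsqrt_mul_self (n + 1)
    have h3 : nsqrt m * (nsqrt (n + 1) * dispKer (p t) (q t) (m - 1) (n + 1)) =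
        nsqrt m * (nsqrt (m - 1) * dispKer (p t) (q t) (m - 1 - 1) n
          - q t * dispKer (p t) (q t) (m - 1) n) := by
      rw [dispKer_creR]
    have h4 : nsqrt n * (nsqrt m * dispKer (p t) (q t) (m - 1) (n - 1)
          - q t * dispKer (p t) (q t) m (n - 1)) = n * dispKer (p t) (q t) m n := by
      rcases n with _ | n
      · simp
      · rw [← nsqrt_mul_self (n + 1), mul_assoc, dispKer_creR, Nat.add_sub_cancel]
    push_cast at h2
    simp only [Nat.add_sub_cancel] at *
    linear_combination e * h3 - (e * q t / 2 + f * p t / 2) * h1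
      - f * dispKer (p t) (q t) m n * h2 + f * h4

lemma dispKer_at_zero (m n : ℕ) : dispKer 0 0 m n = (1 : Matrix ℕ ℕ ℂ) m n := by
  induction n generalizing m with
  | zero =>
    rcases m with _ | m
    · simp [dispKer_zero_zero]
    · simp [dispKer]
  | succ n ih =>
    rw [dispKer, ih, ih]
    rcases m with _ | m
    · simp
    · rw [Nat.add_sub_cancel, zero_mul, sub_zero, Matrix.one_apply, Matrix.one_apply]
      by_cases h : m = n
      · subst h
        simp [nsqrt_succ_ne_zero]
      · simp [h]

lemma differentiable_dispKer_line (p q : ℂ) (m n : ℕ) :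
    Differentiable ℂ (fun t : ℂ => dispKer (t * p) (t * q) m n) := fun t =>
  (hasDerivAt_dispKer ((hasDerivAt_id t).mul_const p) ((hasDerivAt_id t).mul_const q) n
    m).differentiableAt

/-- On the line `(tp, tq)` the derivative is left multiplication by the fixed generator `pa† - qa`:
`dispKer_annL` moves the right factor `a` to the left and absorbs the scalar terms. -/
lemma deriv_dispKer_line (p q : ℂ) (m n : ℕ) :
    deriv (fun t : ℂ => dispKer (t * p) (t * q) m n) = fun t =>
      p * nsqrt m * dispKer (t * p) (t * q) (m - 1) n
        - q * nsqrt (m + 1) * dispKer (t * p) (t * q) (m + 1) n := by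
  funext t
  have hd : HasDerivAt (fun t : ℂ => dispKer (t * p) (t * q) m n) _ t :=
    hasDerivAt_dispKer ((hasDerivAt_id t).mul_const p) ((hasDerivAt_id t).mul_const q) n m
  rw [hd.deriv]
  have := dispKer_annL (t * p) (t * q) n m
  simp only [id]
  linear_combination q * this

lemma iteratedDeriv_dispKer_line (p q : ℂ) (k : ℕ) : ∀ m n,
    iteratedDeriv k (fun t : ℂ => dispKer (t * p) (t * q) m n) 0 =
      opPow ((-q) • ann + p • annᴴ) k m n := by
  induction k with
  | zero => intro m n; simp [opPow, dispKer_at_zero]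
  | succ k ih =>
    intro m n
    have hc : ∀ m n, ContDiffAt ℂ k (fun t : ℂ => dispKer (t * p) (t * q) m n) 0 := fun m n =>
      (differentiable_dispKer_line p q m n).contDiff.contDiffAt
    rw [iteratedDeriv_succ', deriv_dispKer_line,
      iteratedDeriv_fun_sub (contDiffAt_const.mul (hc _ _)) (contDiffAt_const.mul (hc _ _)),
      iteratedDeriv_const_mul_field, iteratedDeriv_const_mul_field, ih, ih, opPow,
      opMul_ladder_left]
    simp only [Matrix.add_apply, Matrix.smul_apply, smul_eq_mul, annL, creL]
    ring

/-- With `z` and `z̄` frozen as independent parameters, the entry of `exp(t(za† - z̄a))` is entire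
in `t`, so its Taylor series at `0` may be summed at `t = 1`. The Taylor coefficients are the
entries of powers that define `opExp`. -/
theorem displacement_apply (z : ℂ) (m n : ℕ) : displacement z m n = dispKer z (conj z) m n := by
  have h := Complex.hasSum_taylorSeries_of_entire (differentiable_dispKer_line z (conj z) m n) 0 1
  have hM : raise z - lower z = (-(conj z)) • ann + z • annᴴ := by
    rw [raise, lower, neg_smul]
    abel
  simp only [iteratedDeriv_dispKer_line, sub_zero, one_pow, one_smul, one_mul, ← hM] at h
  rw [displacement, opExp, ← h.tsum_eq]
  refine tsum_congr fun k => ?_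
  rw [smul_eq_mul, div_eq_mul_inv, mul_comm]

lemma displacement_eq (z : ℂ) : displacement z = dispKer z (conj z) := by
  ext m n
  exact displacement_apply z m n

/-! ### Geometric bounds -/

/-- With `q = s/r`, each of the `m + 1` terms `qⁱ`, `i ≤ m`, is at least `qᵐ`, and their sum is at
most `1/(1 - q)`. This absorbs the factors `√m` of ladder operators into a slightly larger rate. -/
lemma succ_mul_pow_le {s r : ℝ} (hs : 0 < s) (hsr : s < r) :
    ∃ K : ℝ, 0 ≤ K ∧ ∀ m : ℕ, (m + 1) * s ^ m ≤ K * r ^ m := by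
  have hr : 0 < r := hs.trans hsr
  have hq0 : 0 ≤ s / r := (div_pos hs hr).le
  have hq1 : s / r < 1 := (div_lt_one hr).2 hsr
  refine ⟨(1 - s / r)⁻¹, inv_nonneg.2 (by linarith), fun m => ?_⟩
  have h1 : ((m : ℝ) + 1) * (s / r) ^ m ≤ ∑ i ∈ Finset.range (m + 1), (s / r) ^ i := by
    have := Finset.card_nsmul_le_sum (Finset.range (m + 1)) (fun i => (s / r) ^ i) ((s / r) ^ m)
      fun i hi => pow_le_pow_of_le_one hq0 hq1.le (Nat.lt_succ_iff.1 (Finset.mem_range.1 hi))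
    simpa using this
  have h2 : ∑ i ∈ Finset.range (m + 1), (s / r) ^ i ≤ (1 - s / r)⁻¹ := by
    rw [← tsum_geometric_of_lt_one hq0 hq1]
    exact (summable_geometric_of_lt_one hq0 hq1).sum_le_tsum _ fun i _ => pow_nonneg hq0 i
  have h3 := h1.trans h2
  rw [div_pow, mul_div_assoc', div_le_iff₀ (pow_pos hr m)] at h3
  exact h3

lemma sqrt_natCast_le_succ (m : ℕ) : Real.sqrt m ≤ m + 1 := by
  rw [Real.sqrt_le_left (by positivity)]
  nlinarith [(Nat.cast_nonneg m : (0 : ℝ) ≤ m)]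

lemma shift_up_bound {s r : ℝ} (hs : 0 < s) (hsr : s < r) : ∃ K : ℝ, 0 ≤ K ∧
    ∀ m : ℕ, Real.sqrt m * s ^ (m - 1) ≤ K * r ^ m := by
  obtain ⟨K, hK, h⟩ := succ_mul_pow_le hs hsr
  have hr : 0 < r := hs.trans hsr
  refine ⟨K / s, by positivity, fun m => ?_⟩
  rcases m with _ | m
  · simp
    positivity
  · rw [Nat.add_sub_cancel, div_mul_eq_mul_div, le_div_iff₀ hs]
    refine le_trans ?_ (h (m + 1))
    rw [mul_assoc, ← pow_succ]
    exact mul_le_mul_of_nonneg_right (sqrt_natCast_le_succ _) (by positivity)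

lemma shift_down_bound {s r : ℝ} (hs : 0 < s) (hsr : s < r) : ∃ K : ℝ, 0 ≤ K ∧
    ∀ m : ℕ, Real.sqrt (m + 1 : ℕ) * s ^ (m + 1) ≤ K * r ^ m := by
  obtain ⟨K, hK, h⟩ := succ_mul_pow_le hs hsr
  refine ⟨K * s, by positivity, fun m => ?_⟩
  have h1 : Real.sqrt (m + 1 : ℕ) ≤ m + 1 := by
    rw [Real.sqrt_le_left (by positivity)]
    push_cast
    nlinarith [(Nat.cast_nonneg m : (0 : ℝ) ≤ m)]
  calc Real.sqrt (m + 1 : ℕ) * s ^ (m + 1) ≤ (m + 1) * s ^ (m + 1) :=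
        mul_le_mul_of_nonneg_right h1 (by positivity)
    _ = (m + 1) * s ^ m * s := by ring
    _ ≤ K * r ^ m * s := mul_le_mul_of_nonneg_right (h m) hs.le
    _ = K * s * r ^ m := by ring

/-! ### Columns of the displacement operators -/

lemma dispKer_zero_right (p q : ℂ) (m : ℕ) : dispKer p q m 0 =
    Complex.exp (-(p * q) / 2) * p ^ m / ((Real.sqrt m.factorial : ℝ) : ℂ) := by
  induction m with
  | zero => simp [dispKer_zero_zero]
  | succ m ih =>
    have h : ((Real.sqrt (m + 1).factorial : ℝ) : ℂ) =
        nsqrt (m + 1) * ((Real.sqrt m.factorial : ℝ) : ℂ) := by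
      rw [nsqrt, ← Complex.ofReal_mul, ← Real.sqrt_mul (Nat.cast_nonneg _), Nat.factorial_succ]
      push_cast
      rfl
    rw [dispKer, ih, h]
    have h1 := nsqrt_succ_ne_zero m
    have h2 : ((Real.sqrt m.factorial : ℝ) : ℂ) ≠ 0 := by
      rw [Complex.ofReal_ne_zero]
      positivity
    field_simp
    ring

lemma norm_dispKer_zero_right_le (p q : ℂ) {y : ℝ} (hy : 0 < y) :
    ∃ C : ℝ, 0 ≤ C ∧ ∀ m, ‖dispKer p q m 0‖ ≤ C * y ^ m := by
  refine ⟨‖Complex.exp (-(p * q) / 2)‖ * Real.sqrt (Real.exp ((‖p‖ / y) ^ 2)), by positivity,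
    fun m => ?_⟩
  rw [dispKer_zero_right, norm_div, norm_mul, norm_pow, Complex.norm_real,
    Real.norm_of_nonneg (Real.sqrt_nonneg _), mul_div_assoc, mul_assoc]
  refine mul_le_mul_of_nonneg_left ?_ (norm_nonneg _)
  rw [← div_le_iff₀ (by positivity)]
  -- The square of the left side is `((‖p‖/y)²)ᵐ / m!`, a single term of the exponential series.
  refine Real.le_sqrt_of_sq_le ?_
  refine le_trans (le_of_eq ?_) (Real.pow_div_factorial_le_exp ((‖p‖ / y) ^ 2) (by positivity) m)
  rw [div_pow, div_pow, Real.sq_sqrt (by positivity), ← pow_mul, ← pow_mul, ← pow_mul, div_pow,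
    mul_comm 2 m]
  ring

/-- The rate `y` stays quantified inside the induction because passing to the next column costs a
factor `√m`, paid for by using the hypothesis at `y/2`. -/
lemma norm_dispKer_le (p q : ℂ) (n : ℕ) : ∀ y : ℝ, 0 < y →
    ∃ C : ℝ, 0 ≤ C ∧ ∀ m, ‖dispKer p q m n‖ ≤ C * y ^ m := by
  induction n with
  | zero => exact fun y hy => norm_dispKer_zero_right_le p q hy
  | succ n ih =>
    intro y hy
    obtain ⟨C, hC, h⟩ := ih (y / 2) (by positivity)
    obtain ⟨C', hC', h'⟩ := ih y hy
    obtain ⟨K, hK, hb⟩ := shift_up_bound (s := y / 2) (r := y) (by positivity) (by linarith)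
    refine ⟨(C * K + ‖q‖ * C') / ‖nsqrt (n + 1)‖, by positivity, fun m => ?_⟩
    rw [dispKer, norm_div, div_mul_eq_mul_div]
    refine div_le_div_of_nonneg_right ?_ (norm_nonneg _)
    refine (norm_sub_le _ _).trans ?_
    rw [norm_mul, norm_mul, norm_nsqrt, add_mul]
    refine add_le_add ?_ ?_
    · calc Real.sqrt m * ‖dispKer p q (m - 1) n‖ ≤ Real.sqrt m * (C * (y / 2) ^ (m - 1)) :=
            mul_le_mul_of_nonneg_left (h _) (Real.sqrt_nonneg _)
        _ = C * (Real.sqrt m * (y / 2) ^ (m - 1)) := by ring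
        _ ≤ C * (K * y ^ m) := mul_le_mul_of_nonneg_left (hb m) hC
        _ = C * K * y ^ m := by ring
    · rw [mul_assoc]
      exact mul_le_mul_of_nonneg_left (h' m) (norm_nonneg _)

lemma summable_dispKer_mul (p q p' q' : ℂ) (n n' : ℕ) :
    Summable fun m => conj (dispKer p q m n) * dispKer p' q' m n' := by
  obtain ⟨C, hC, h⟩ := norm_dispKer_le p q n (1 / 2) (by norm_num)
  obtain ⟨C', hC', h'⟩ := norm_dispKer_le p' q' n' 1 (by norm_num)
  refine Summable.of_norm_bounded (g := fun m => C * C' * (1 / 2 : ℝ) ^ m)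
    ((summable_geometric_of_lt_one (by norm_num) (by norm_num)).mul_left _) fun m => ?_
  rw [norm_mul, RCLike.norm_conj]
  calc _ ≤ C * (1 / 2) ^ m * (C' * 1 ^ m) := mul_le_mul (h m) (h' m) (norm_nonneg _) (by positivity)
    _ = _ := by rw [one_pow]; ring

/-- Inner products of the columns of `D(z)`. -/
noncomputable def colInner (z : ℂ) (n n' : ℕ) : ℂ :=
  ∑' m, conj (dispKer z (conj z) m n) * dispKer z (conj z) m n'

lemma colInner_conj (z : ℂ) (n n' : ℕ) : conj (colInner z n n') = colInner z n' n := by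
  rw [colInner, colInner, Complex.conj_tsum]
  refine tsum_congr fun m => ?_
  rw [map_mul, Complex.conj_conj, mul_comm]

/-- Says that the Gram matrix `D†D` commutes with `a`. Both sides equal the inner product of column
`n` with `a` applied to column `n'`, minus `z` times the Gram entry. -/
lemma colInner_step (z : ℂ) (n n' : ℕ) :
    nsqrt (n + 1) * colInner z (n + 1) n' = nsqrt n' * colInner z n (n' - 1) := by
  set Φ := dispKer z (conj z) with hΦ
  have hs := fun n n' => summable_dispKer_mul z (conj z) z (conj z) n n'
  rw [← hΦ] at hs
  have hR : Summable fun m => conj (Φ m n) * (nsqrt (m + 1) * Φ (m + 1) n') := by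
    refine (((hs n n').mul_left z).add ((hs n (n' - 1)).mul_left (nsqrt n'))).congr fun m => ?_
    rw [hΦ, dispKer_annL]
    ring
  have hL : Summable fun m => conj (nsqrt m * Φ (m - 1) n) * Φ m n' := by
    rw [← summable_nat_add_iff 1]
    refine hR.congr fun m => ?_
    simp only [Nat.add_sub_cancel, map_mul, conj_nsqrt]
    ring
  have hshift : ∑' m, conj (nsqrt m * Φ (m - 1) n) * Φ m n' =
      ∑' m, conj (Φ m n) * (nsqrt (m + 1) * Φ (m + 1) n') := by
    rw [hL.tsum_eq_zero_add]
    simp only [nsqrt_zero, zero_mul, map_zero, zero_add, Nat.add_sub_cancel, map_mul, conj_nsqrt]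
    exact tsum_congr fun m => by ring
  have h1 : nsqrt (n + 1) * colInner z (n + 1) n' =
      ∑' m, conj (nsqrt m * Φ (m - 1) n) * Φ m n' - z * colInner z n n' := by
    rw [colInner, colInner, ← hΦ, ← tsum_mul_left, ← tsum_mul_left, ← hL.tsum_sub ((hs n n').mul_left z)]
    refine tsum_congr fun m => ?_
    have := congrArg conj (dispKer_creR z (conj z) m n)
    rw [← hΦ] at this
    simp only [map_mul, map_sub, conj_nsqrt, Complex.conj_conj] at this ⊢
    linear_combination Φ m n' * this
  have h2 : nsqrt n' * colInner z n (n' - 1) =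
      ∑' m, conj (Φ m n) * (nsqrt (m + 1) * Φ (m + 1) n') - z * colInner z n n' := by
    rw [colInner, colInner, ← hΦ, ← tsum_mul_left, ← tsum_mul_left, ← hR.tsum_sub ((hs n n').mul_left z)]
    refine tsum_congr fun m => ?_
    have := dispKer_annL z (conj z) n' m
    rw [← hΦ] at this
    linear_combination - conj (Φ m n) * this
  rw [h1, h2, hshift]

lemma colInner_zero_zero (z : ℂ) : colInner z 0 0 = 1 := by
  have h : ∀ m, conj (dispKer z (conj z) m 0) * dispKer z (conj z) m 0 =
      ((Real.exp (-‖z‖ ^ 2) * ((‖z‖ ^ 2) ^ m / m.factorial) : ℝ) : ℂ) := by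
    intro m
    have e1 : Complex.exp (-(z * conj z) / 2) = ((Real.exp (-‖z‖ ^ 2 / 2) : ℝ) : ℂ) := by
      rw [Complex.mul_conj']
      push_cast
      rfl
    have e2 : Real.exp (-‖z‖ ^ 2) = Real.exp (-‖z‖ ^ 2 / 2) * Real.exp (-‖z‖ ^ 2 / 2) := by
      rw [← Real.exp_add]
      ring_nf
    have e3 : ((m.factorial : ℝ) : ℂ) =
        ((Real.sqrt m.factorial : ℝ) : ℂ) * ((Real.sqrt m.factorial : ℝ) : ℂ) := by
      rw [← Complex.ofReal_mul, Real.mul_self_sqrt (Nat.cast_nonneg _)]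
    rw [dispKer_zero_right, e1, map_div₀, map_mul, Complex.conj_ofReal, Complex.conj_ofReal, map_pow]
    have e4 : conj z ^ m * z ^ m = (((‖z‖ ^ 2) ^ m : ℝ) : ℂ) := by
      rw [← mul_pow, mul_comm, Complex.mul_conj']
      push_cast
      rfl
    rw [Complex.ofReal_mul, Complex.ofReal_div, ← e4, e3, e2, Complex.ofReal_mul]
    ring
  rw [colInner, tsum_congr h, ← Complex.ofReal_tsum, tsum_mul_left]
  have : ∑' m : ℕ, (‖z‖ ^ 2) ^ m / (m.factorial : ℝ) = Real.exp (‖z‖ ^ 2) := by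
    rw [Real.exp_eq_exp_ℝ, NormedSpace.exp_eq_tsum_div]
  rw [this, ← Real.exp_add]
  simp

/-- A Hermitian matrix that commutes with `a` is fixed by its vacuum entry, so `D†D = 1`. Only this
half of unitarity is needed. -/
lemma colInner_eq (z : ℂ) (n n' : ℕ) : colInner z n n' = if n = n' then 1 else 0 := by
  induction n generalizing n' with
  | zero =>
    rcases n' with _ | n'
    · simp [colInner_zero_zero]
    · have h := colInner_step z n' 0
      rw [nsqrt_zero, zero_mul, mul_eq_zero, or_iff_right (nsqrt_succ_ne_zero n')] at h
      rw [← colInner_conj, h]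
      simp
  | succ n ih =>
    refine mul_left_cancel₀ (nsqrt_succ_ne_zero n) ?_
    rw [colInner_step, ih]
    rcases n' with _ | n'
    · simp
    · by_cases h : n = n'
      · simp [h]
      · simp [h]

/-! ### Bessel's inequality and bounds on the characteristic function -/

lemma memlp_dispKer (z : ℂ) (n : ℕ) : Memℓp (fun m => dispKer z (conj z) m n) 2 := by
  refine memℓp_gen ?_
  obtain ⟨C, hC, h⟩ := norm_dispKer_le z (conj z) n (1 / 2) (by norm_num)
  refine Summable.of_norm_bounded (g := fun m => C ^ 2 * (1 / 4 : ℝ) ^ m)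
    ((summable_geometric_of_lt_one (by norm_num) (by norm_num)).mul_left _) fun m => ?_
  rw [ENNReal.toReal_ofNat, Real.rpow_ofNat, norm_pow, norm_norm]
  calc _ ≤ (C * (1 / 2) ^ m) ^ 2 := pow_le_pow_left₀ (norm_nonneg _) (h m) 2
    _ = _ := by rw [mul_pow, ← pow_mul, mul_comm m 2, pow_mul]; norm_num

/-- The columns of `D(z)` as vectors of `ℓ²`. -/
noncomputable def dispCol (z : ℂ) (n : ℕ) : lp (fun _ : ℕ => ℂ) 2 := ⟨_, memlp_dispKer z n⟩

lemma orthonormal_dispCol (z : ℂ) : Orthonormal ℂ (dispCol z) := by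
  classical
  rw [orthonormal_iff_ite]
  intro n n'
  rw [lp.inner_eq_tsum, ← colInner_eq z n n', colInner]
  refine tsum_congr fun m => ?_
  rw [RCLike.inner_apply, mul_comm]
  rfl

/-- Bessel's inequality for the orthonormal columns of `D(z)`, tested on a finitely supported
vector. The coefficients are conjugated because the inner product is conjugate-linear in its first
argument. -/
lemma bessel_dispKer (z : ℂ) (K N : Finset ℕ) (b : ℕ → ℂ) :
    ∑ n ∈ N, ‖∑ k ∈ K, b k * dispKer z (conj z) k n‖ ^ 2 ≤ ∑ k ∈ K, ‖b k‖ ^ 2 := by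
  classical
  set x : lp (fun _ : ℕ => ℂ) 2 := ∑ k ∈ K, lp.single 2 k (conj (b k)) with hx
  have h1 := (orthonormal_dispCol z).sum_inner_products_le (x := x) (s := N)
  have h2 : ‖x‖ ^ 2 = ∑ k ∈ K, ‖b k‖ ^ 2 := by
    have : (‖x‖ : ℂ) ^ 2 = ∑ k ∈ K, (‖b k‖ : ℂ) ^ 2 := by
      refine (inner_self_eq_norm_sq_to_K (𝕜 := ℂ) x).symm.trans ?_
      rw [hx, sum_inner]
      refine Finset.sum_congr rfl fun k hk => ?_
      rw [lp.inner_single_left, ← hx]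
      have : x k = conj (b k) := by
        rw [hx, lp.coeFn_sum, Finset.sum_apply, Finset.sum_eq_single k]
        · simp
        · intro j _ hjk
          simp [lp.single_apply, hjk.symm]
        · exact fun h => absurd hk h
      rw [this, RCLike.inner_apply, Complex.conj_conj, mul_comm, Complex.mul_conj']
    exact_mod_cast this
  rw [h2] at h1
  refine le_trans (le_of_eq (Finset.sum_congr rfl fun n _ => ?_)) h1
  rw [← norm_inner_symm, hx, sum_inner]
  congr 2
  refine Finset.sum_congr rfl fun k _ => ?_
  rw [lp.inner_single_left, RCLike.inner_apply, Complex.conj_conj, mul_comm]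
  rfl

lemma norm_dispKer_le_one (z : ℂ) (m n : ℕ) : ‖dispKer z (conj z) m n‖ ≤ 1 := by
  have h := bessel_dispKer z {m} {n} fun _ => 1
  simpa using h

/-- Working with finite corners of `ρ` avoids a square root of an infinite matrix; the estimates
below are uniform in the size `M`. -/
lemma exists_gram_of_posSemidef {ρ : Matrix ℕ ℕ ℂ} (hρ : ρ.PosSemidef) (M : ℕ) :
    ∃ B : Fin M → ℕ → ℂ, ∀ m < M, ∀ n < M, ρ m n = ∑ j, conj (B j m) * B j n := by
  classical
  have h := hρ.submatrix (fun i : Fin M => (i : ℕ))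
  obtain ⟨B, hB⟩ : ∃ B : Matrix (Fin M) (Fin M) ℂ,
      ρ.submatrix (fun i : Fin M => (i : ℕ)) (fun i : Fin M => (i : ℕ)) = Bᴴ * B := by
    open scoped MatrixOrder in
    exact CStarAlgebra.nonneg_iff_eq_star_mul_self.1 h.nonneg
  refine ⟨fun j m => if hm : m < M then B j ⟨m, hm⟩ else 0, fun m hm n hn => ?_⟩
  have := congrFun (congrFun hB ⟨m, hm⟩) ⟨n, hn⟩
  simp only [Matrix.submatrix_apply, Matrix.mul_apply, Matrix.conjTranspose_apply] at this
  simp [hm, hn, this]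

lemma re_diag_nonneg {ρ : Matrix ℕ ℕ ℂ} (hρ : ρ.PosSemidef) (n : ℕ) : 0 ≤ (ρ n n).re :=
  (Complex.nonneg_iff.1 hρ.diag_nonneg).1

lemma hasSum_re_diag {ρ : Matrix ℕ ℕ ℂ} (hρ : IsState ρ) : HasSum (fun n => (ρ n n).re) 1 := by
  simpa using Complex.hasSum_re hρ.2

lemma sum_re_diag_le_one {ρ : Matrix ℕ ℕ ℂ} (hρ : IsState ρ) (K : Finset ℕ) :
    ∑ k ∈ K, (ρ k k).re ≤ 1 :=
  sum_le_hasSum K (fun n _ => re_diag_nonneg hρ.1 n) (hasSum_re_diag hρ)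

/-- Write the corner of `ρ` as `B†B`, so that a diagonal entry of `ρD` is `∑ⱼ conj(Bⱼₙ)(BD)ⱼₙ`.
Cauchy–Schwarz over the pairs `(n, j)` leaves the diagonal of `ρ` and, by Bessel, a factor at most
`Tr ρ = 1`. The bound is uniform in `z` and in the truncation, hence yields `|χ| ≤ 1` and the
dominations used for the inversion formula. -/
lemma sum_norm_partial_le {ρ : Matrix ℕ ℕ ℂ} (hρ : IsState ρ) (z : ℂ) (N : Finset ℕ) (M : ℕ)
    (hN : ∀ n ∈ N, n < M) :
    ∑ n ∈ N, ‖∑ k ∈ Finset.range M, ρ n k * dispKer z (conj z) k n‖ ≤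
      Real.sqrt (∑ n ∈ N, (ρ n n).re) := by
  obtain ⟨B, hB⟩ := exists_gram_of_posSemidef hρ.1 M
  set T : Fin M → ℕ → ℂ := fun j n => ∑ k ∈ Finset.range M, B j k * dispKer z (conj z) k n with hT
  have hdiag : ∀ n < M, (ρ n n).re = ∑ j, ‖B j n‖ ^ 2 := by
    intro n hn
    rw [hB n hn n hn, Complex.re_sum]
    refine Finset.sum_congr rfl fun j _ => ?_
    rw [mul_comm, Complex.mul_conj']
    norm_cast
  have h1 : ∀ n ∈ N, ∑ k ∈ Finset.range M, ρ n k * dispKer z (conj z) k n =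
      ∑ j, conj (B j n) * T j n := by
    intro n hn
    rw [hT]
    simp only [Finset.mul_sum]
    rw [Finset.sum_comm]
    refine Finset.sum_congr rfl fun k hk => ?_
    rw [hB n (hN n hn) k (Finset.mem_range.1 hk), Finset.sum_mul]
    exact Finset.sum_congr rfl fun j _ => mul_assoc _ _ _
  calc ∑ n ∈ N, ‖∑ k ∈ Finset.range M, ρ n k * dispKer z (conj z) k n‖
      ≤ ∑ n ∈ N, ∑ j, ‖B j n‖ * ‖T j n‖ := by
        refine Finset.sum_le_sum fun n hn => ?_
        rw [h1 n hn]
        refine (norm_sum_le _ _).trans (le_of_eq (Finset.sum_congr rfl fun j _ => ?_))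
        rw [norm_mul, RCLike.norm_conj]
    _ = ∑ x ∈ N ×ˢ Finset.univ, ‖B x.2 x.1‖ * ‖T x.2 x.1‖ := by rw [Finset.sum_product]
    _ ≤ Real.sqrt (∑ x ∈ N ×ˢ Finset.univ, ‖B x.2 x.1‖ ^ 2) *
        Real.sqrt (∑ x ∈ N ×ˢ Finset.univ, ‖T x.2 x.1‖ ^ 2) :=
        Real.sum_mul_le_sqrt_mul_sqrt _ _ _
    _ ≤ Real.sqrt (∑ n ∈ N, (ρ n n).re) * 1 := by
        refine mul_le_mul (Real.sqrt_le_sqrt (le_of_eq ?_)) ?_ (Real.sqrt_nonneg _)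
          (Real.sqrt_nonneg _)
        · rw [Finset.sum_product]
          exact Finset.sum_congr rfl fun n hn => (hdiag n (hN n hn)).symm
        · refine Real.sqrt_le_one.2 ?_
          rw [Finset.sum_product_right]
          calc _ ≤ ∑ j, ∑ k ∈ Finset.range M, ‖B j k‖ ^ 2 :=
                Finset.sum_le_sum fun j _ => bessel_dispKer z (Finset.range M) N (B j)
            _ = ∑ k ∈ Finset.range M, (ρ k k).re := by
                rw [Finset.sum_comm]
                exact Finset.sum_congr rfl fun k hk => (hdiag k (Finset.mem_range.1 hk)).symm
            _ ≤ 1 := sum_re_diag_le_one hρ _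
    _ = _ := mul_one _

lemma norm_sq_entry_le {ρ : Matrix ℕ ℕ ℂ} (hρ : ρ.PosSemidef) (m n : ℕ) :
    ‖ρ m n‖ ^ 2 ≤ (ρ m m).re * (ρ n n).re := by
  obtain ⟨B, hB⟩ := exists_gram_of_posSemidef hρ (max m n + 1)
  have hm : m < max m n + 1 := by omega
  have hn : n < max m n + 1 := by omega
  have hd : ∀ k < max m n + 1, (ρ k k).re = ∑ j, ‖B j k‖ ^ 2 := by
    intro k hk
    rw [hB k hk k hk, Complex.re_sum]
    refine Finset.sum_congr rfl fun j _ => ?_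
    rw [mul_comm, Complex.mul_conj']
    norm_cast
  rw [hd m hm, hd n hn, hB m hm n hn]
  refine le_trans (pow_le_pow_left₀ (norm_nonneg _) (norm_sum_le _ _) 2) ?_
  simp only [norm_mul, RCLike.norm_conj]
  exact Finset.sum_mul_sq_le_sq_mul_sq _ _ _

lemma norm_entry_le_one {ρ : Matrix ℕ ℕ ℂ} (hρ : IsState ρ) (m n : ℕ) : ‖ρ m n‖ ≤ 1 := by
  have h := norm_sq_entry_le hρ.1 m n
  have hd : ∀ k, (ρ k k).re ≤ 1 := fun k => by simpa using sum_re_diag_le_one hρ {k}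
  have := mul_le_mul (hd m) (hd n) (re_diag_nonneg hρ.1 n) zero_le_one
  nlinarith [norm_nonneg (ρ m n)]

lemma summable_row_mul_dispKer {ρ : Matrix ℕ ℕ ℂ} (hρ : IsState ρ) (p q : ℂ) (n n' : ℕ) :
    Summable fun k => ‖ρ n k * dispKer p q k n'‖ := by
  obtain ⟨C, hC, h⟩ := norm_dispKer_le p q n' (1 / 2) (by norm_num)
  refine Summable.of_nonneg_of_le (fun _ => norm_nonneg _) (fun k => ?_)
    ((summable_geometric_of_lt_one (r := (1 / 2 : ℝ)) (by norm_num) (by norm_num)).mul_left C)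
  rw [norm_mul]
  calc _ ≤ 1 * (C * (1 / 2) ^ k) :=
        mul_le_mul (norm_entry_le_one hρ _ _) (h k) (norm_nonneg _) zero_le_one
    _ = _ := one_mul _

lemma opMul_dispKer_apply (ρ : Matrix ℕ ℕ ℂ) (z : ℂ) (n : ℕ) :
    (ρ ⊡ displacement z) n n = ∑' k, ρ n k * dispKer z (conj z) k n := by
  rw [displacement_eq]
  rfl

lemma sum_norm_diag_le {ρ : Matrix ℕ ℕ ℂ} (hρ : IsState ρ) (z : ℂ) (N : Finset ℕ) :
    ∑ n ∈ N, ‖(ρ ⊡ displacement z) n n‖ ≤ Real.sqrt (∑ n ∈ N, (ρ n n).re) := by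
  have ht : Filter.Tendsto (fun M => ∑ n ∈ N,
      ‖∑ k ∈ Finset.range M, ρ n k * dispKer z (conj z) k n‖) Filter.atTop
      (nhds (∑ n ∈ N, ‖(ρ ⊡ displacement z) n n‖)) := by
    refine tendsto_finsetSum _ fun n _ => Filter.Tendsto.norm ?_
    rw [opMul_dispKer_apply]
    exact (summable_row_mul_dispKer hρ z (conj z) n n).of_norm.hasSum.tendsto_sum_nat
  refine le_of_tendsto ht ?_
  filter_upwards [Filter.eventually_gt_atTop (N.sup id)] with M hM
  exact sum_norm_partial_le hρ z N M fun n hn => lt_of_le_of_lt (Finset.le_sup (f := id) hn) hM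

lemma summable_norm_diag {ρ : Matrix ℕ ℕ ℂ} (hρ : IsState ρ) (z : ℂ) :
    Summable fun n => ‖(ρ ⊡ displacement z) n n‖ := by
  refine summable_of_sum_le (c := 1) (fun _ => norm_nonneg _) fun N => ?_
  refine (sum_norm_diag_le hρ z N).trans ?_
  refine Real.sqrt_le_one.2 ?_
  exact sum_re_diag_le_one hρ N

lemma sum_norm_diag_le_one {ρ : Matrix ℕ ℕ ℂ} (hρ : IsState ρ) (z : ℂ) (N : Finset ℕ) :
    ∑ n ∈ N, ‖(ρ ⊡ displacement z) n n‖ ≤ 1 := by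
  refine (sum_norm_diag_le hρ z N).trans ?_
  refine Real.sqrt_le_one.2 ?_
  exact sum_re_diag_le_one hρ N

lemma norm_charFn_le_one {ρ : Matrix ℕ ℕ ℂ} (hρ : IsState ρ) (z : ℂ) : ‖charFn ρ z‖ ≤ 1 := by
  refine (norm_tsum_le_tsum_norm (summable_norm_diag hρ z)).trans ?_
  exact (summable_norm_diag hρ z).tsum_le_of_sum_le fun N => sum_norm_diag_le_one hρ z N

/-! ### Integration on the complex plane -/

/-- Continuous functions of Gaussian decay. -/
def GaussDecay (f : ℂ → ℂ) : Prop :=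
  Continuous f ∧ ∃ ε : ℝ, 0 < ε ∧ ∃ C : ℝ, 0 ≤ C ∧ ∀ z, ‖f z‖ ≤ C * Real.exp (-ε * ‖z‖ ^ 2)

/-- Continuous functions growing more slowly than every Gaussian. -/
def Tame (f : ℂ → ℂ) : Prop :=
  Continuous f ∧ ∀ ε : ℝ, 0 < ε → ∃ C : ℝ, 0 ≤ C ∧ ∀ z, ‖f z‖ ≤ C * Real.exp (ε * ‖z‖ ^ 2)

lemma GaussDecay.tame {f : ℂ → ℂ} (hf : GaussDecay f) : Tame f := by
  obtain ⟨hc, ε, hε, C, hC, h⟩ := hf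
  refine ⟨hc, fun δ hδ => ⟨C, hC, fun z => (h z).trans ?_⟩⟩
  refine mul_le_mul_of_nonneg_left (Real.exp_le_exp.2 ?_) hC
  nlinarith [sq_nonneg ‖z‖]

lemma Tame.add {f g : ℂ → ℂ} (hf : Tame f) (hg : Tame g) : Tame fun z => f z + g z := by
  refine ⟨hf.1.add hg.1, fun ε hε => ?_⟩
  obtain ⟨C, hC, h⟩ := hf.2 ε hε
  obtain ⟨C', hC', h'⟩ := hg.2 ε hε
  refine ⟨C + C', by positivity, fun z => (norm_add_le _ _).trans ?_⟩
  rw [add_mul]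
  exact add_le_add (h z) (h' z)

lemma Tame.mul {f g : ℂ → ℂ} (hf : Tame f) (hg : Tame g) : Tame fun z => f z * g z := by
  refine ⟨hf.1.mul hg.1, fun ε hε => ?_⟩
  obtain ⟨C, hC, h⟩ := hf.2 (ε / 2) (by positivity)
  obtain ⟨C', hC', h'⟩ := hg.2 (ε / 2) (by positivity)
  refine ⟨C * C', by positivity, fun z => ?_⟩
  rw [norm_mul]
  refine (mul_le_mul (h z) (h' z) (norm_nonneg _) (by positivity)).trans (le_of_eq ?_)
  rw [show ε * ‖z‖ ^ 2 = ε / 2 * ‖z‖ ^ 2 + ε / 2 * ‖z‖ ^ 2 by ring, Real.exp_add]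
  ring

lemma Tame.of_bounded {f : ℂ → ℂ} (hc : Continuous f) {C : ℝ} (hC : ∀ z, ‖f z‖ ≤ C) : Tame f := by
  have hC0 : 0 ≤ C := (norm_nonneg _).trans (hC 0)
  refine ⟨hc, fun ε hε => ⟨C, hC0, fun z => (hC z).trans ?_⟩⟩
  exact le_mul_of_one_le_right hC0 (Real.one_le_exp (by positivity))

lemma Tame.const (c : ℂ) : Tame fun _ => c :=
  .of_bounded continuous_const fun _ => le_rfl

lemma Tame.id : Tame fun z => z := by
  refine ⟨continuous_id, fun ε hε => ⟨1 + ε⁻¹, by positivity, fun z => ?_⟩⟩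
  have h1 : ε * ‖z‖ ^ 2 + 1 ≤ Real.exp (ε * ‖z‖ ^ 2) := Real.add_one_le_exp _
  have h2 : ε⁻¹ * ε = 1 := inv_mul_cancel₀ hε.ne'
  have h3 : 0 < ε⁻¹ := inv_pos.2 hε
  have h4 : (1 + ε⁻¹) * (ε * ‖z‖ ^ 2 + 1) = ε * ‖z‖ ^ 2 + 1 + ‖z‖ ^ 2 + ε⁻¹ := by
    linear_combination ‖z‖ ^ 2 * h2
  have h5 : (1 + ε⁻¹) * (ε * ‖z‖ ^ 2 + 1) ≤ (1 + ε⁻¹) * Real.exp (ε * ‖z‖ ^ 2) :=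
    mul_le_mul_of_nonneg_left h1 (by positivity)
  have h6 : 0 ≤ ε * ‖z‖ ^ 2 := by positivity
  nlinarith [sq_nonneg (‖z‖ - 1)]

lemma Tame.conj {f : ℂ → ℂ} (hf : Tame f) : Tame fun z => conj (f z) := by
  refine ⟨Complex.continuous_conj.comp hf.1, fun ε hε => ?_⟩
  obtain ⟨C, hC, h⟩ := hf.2 ε hε
  exact ⟨C, hC, fun z => (RCLike.norm_conj _).trans_le (h z)⟩

lemma Tame.const_mul {f : ℂ → ℂ} (hf : Tame f) (c : ℂ) : Tame fun z => c * f z :=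
  (Tame.const c).mul hf

lemma GaussDecay.mul_tame {f g : ℂ → ℂ} (hf : GaussDecay f) (hg : Tame g) :
    GaussDecay fun z => f z * g z := by
  obtain ⟨hc, ε, hε, C, hC, h⟩ := hf
  obtain ⟨C', hC', h'⟩ := hg.2 (ε / 2) (by positivity)
  refine ⟨hc.mul hg.1, ε / 2, by positivity, C * C', by positivity, fun z => ?_⟩
  rw [norm_mul]
  refine (mul_le_mul (h z) (h' z) (norm_nonneg _) (by positivity)).trans (le_of_eq ?_)
  rw [show -(ε / 2) * ‖z‖ ^ 2 = -ε * ‖z‖ ^ 2 + ε / 2 * ‖z‖ ^ 2 by ring, Real.exp_add]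
  ring

lemma Tame.mul_gaussDecay {f g : ℂ → ℂ} (hf : Tame f) (hg : GaussDecay g) :
    GaussDecay fun z => f z * g z := by
  simpa only [mul_comm] using hg.mul_tame hf

lemma GaussDecay.const_mul {f : ℂ → ℂ} (hf : GaussDecay f) (c : ℂ) : GaussDecay fun z => c * f z :=
  (Tame.const c).mul_gaussDecay hf

lemma GaussDecay.add {f g : ℂ → ℂ} (hf : GaussDecay f) (hg : GaussDecay g) :
    GaussDecay fun z => f z + g z := by
  obtain ⟨hc, ε, hε, C, hC, h⟩ := hf
  obtain ⟨hc', ε', hε', C', hC', h'⟩ := hg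
  refine ⟨hc.add hc', min ε ε', lt_min hε hε', C + C', by positivity, fun z => ?_⟩
  refine (norm_add_le _ _).trans ?_
  rw [add_mul]
  have aux : ∀ δ : ℝ, min ε ε' ≤ δ → Real.exp (-δ * ‖z‖ ^ 2) ≤ Real.exp (-min ε ε' * ‖z‖ ^ 2) :=
    fun δ hδ => Real.exp_le_exp.2 (by nlinarith [sq_nonneg ‖z‖])
  exact add_le_add ((h z).trans (mul_le_mul_of_nonneg_left (aux _ (min_le_left _ _)) hC))
    ((h' z).trans (mul_le_mul_of_nonneg_left (aux _ (min_le_right _ _)) hC'))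

lemma GaussDecay.conj {f : ℂ → ℂ} (hf : GaussDecay f) : GaussDecay fun z => conj (f z) := by
  obtain ⟨hc, ε, hε, C, hC, h⟩ := hf
  exact ⟨Complex.continuous_conj.comp hc, ε, hε, C, hC,
    fun z => (RCLike.norm_conj _).trans_le (h z)⟩

lemma GaussDecay.integrable {f : ℂ → ℂ} (hf : GaussDecay f) : Integrable f := by
  obtain ⟨hc, ε, hε, C, hC, h⟩ := hf
  have h1 : Integrable fun z : ℂ => Complex.exp (-(ε : ℂ) * ‖z‖ ^ 2) := by
    have := GaussianFourier.integrable_cexp_neg_mul_sq_norm_add (V := ℂ) (b := (ε : ℂ))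
      (by simpa using hε) 0 0
    simpa using this
  refine (h1.norm.const_mul C).mono' hc.aestronglyMeasurable (Filter.Eventually.of_forall fun z => ?_)
  refine (h z).trans (le_of_eq ?_)
  rw [Complex.norm_exp]
  congr 2
  norm_cast

/-- The Wirtinger derivatives of `f` at `z` are `fz` and `fzb`. -/
def HasWirt (f : ℂ → ℂ) (fz fzb : ℂ) (z : ℂ) : Prop :=
  ∀ e : ℂ, HasLineDerivAt ℝ f (e * fz + conj e * fzb) z e

/-! ### Calculus of Wirtinger derivatives -/

lemma HasWirt.congr_deriv {f : ℂ → ℂ} {a b a' b' z : ℂ} (h : HasWirt f a b z) (ha : a = a')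
    (hb : b = b') : HasWirt f a' b' z := ha ▸ hb ▸ h

lemma HasWirt.mul {f g : ℂ → ℂ} {a b a' b' z : ℂ} (hf : HasWirt f a b z) (hg : HasWirt g a' b' z) :
    HasWirt (fun w => f w * g w) (a * g z + f z * a') (b * g z + f z * b') z := by
  intro e
  have := HasDerivAt.mul (hf e) (hg e)
  simp only [zero_smul, add_zero] at this
  unfold HasLineDerivAt
  convert! this using 1
  ring

lemma HasWirt.add {f g : ℂ → ℂ} {a b a' b' z : ℂ} (hf : HasWirt f a b z) (hg : HasWirt g a' b' z) :
    HasWirt (fun w => f w + g w) (a + a') (b + b') z := by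
  intro e
  have := HasDerivAt.add (hf e) (hg e)
  unfold HasLineDerivAt
  convert! this using 1
  ring

lemma HasWirt.const (c z : ℂ) : HasWirt (fun _ => c) 0 0 z := by
  intro e
  unfold HasLineDerivAt
  simpa using hasDerivAt_const (0 : ℝ) c

lemma HasWirt.const_mul {f : ℂ → ℂ} {a b z : ℂ} (hf : HasWirt f a b z) (c : ℂ) :
    HasWirt (fun w => c * f w) (c * a) (c * b) z :=
  ((HasWirt.const c z).mul hf).congr_deriv (by ring) (by ring)

lemma hasDerivAt_line (z e : ℂ) : HasDerivAt (fun t : ℝ => z + t • e) e 0 := by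
  simpa using ((hasDerivAt_id (0 : ℝ)).smul_const e).const_add z

lemma HasWirt.id (z : ℂ) : HasWirt (fun w => w) 1 0 z := by
  intro e
  unfold HasLineDerivAt
  simpa using hasDerivAt_line z e

lemma HasWirt.conj {f : ℂ → ℂ} {a b z : ℂ} (hf : HasWirt f a b z) :
    HasWirt (fun w => conj (f w)) (conj b) (conj a) z := by
  intro e
  have h := (hf e)
  unfold HasLineDerivAt at h ⊢
  have := Complex.conjCLE.toContinuousLinearMap.hasFDerivAt.comp_hasDerivAt (0 : ℝ) h
  convert! this using 1
  simp
  ring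

lemma HasWirt.cexp {f : ℂ → ℂ} {a b z : ℂ} (hf : HasWirt f a b z) :
    HasWirt (fun w => Complex.exp (f w)) (a * Complex.exp (f z)) (b * Complex.exp (f z)) z := by
  intro e
  have := HasDerivAt.cexp (hf e)
  simp only [zero_smul, add_zero] at this
  unfold HasLineDerivAt
  convert! this using 1
  ring

lemma hasWirt_dispKer (m n : ℕ) (z : ℂ) : HasWirt (fun w => dispKer w (conj w) m n)
    (nsqrt m * dispKer z (conj z) (m - 1) n - conj z / 2 * dispKer z (conj z) m n)
    (-(nsqrt n * dispKer z (conj z) m (n - 1)) - z / 2 * dispKer z (conj z) m n) z := by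
  intro e
  have h1 := hasDerivAt_line z e
  have h2 : HasDerivAt (fun t : ℝ => conj (z + t • e)) (conj e) 0 := by
    simpa using hasDerivAt_line (conj z) (conj e)
  have := hasDerivAt_dispKer h1 h2 n m
  simp only [zero_smul, add_zero] at this
  unfold HasLineDerivAt
  convert! this using 1
  ring

/-- Integration by parts against the constant `1` kills the integral of every directional
derivative; the directions `1` and `i` separate the two Wirtinger parts. -/
lemma integral_wirt_eq_zero {f fz fzb : ℂ → ℂ} (h : ∀ z, HasWirt f (fz z) (fzb z) z)
    (hf : GaussDecay f) (hz : GaussDecay fz) (hzb : GaussDecay fzb) :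
    ∫ z, fz z = 0 ∧ ∫ z, fzb z = 0 := by
  have key : ∀ e : ℂ, e * (∫ z, fz z) + conj e * (∫ z, fzb z) = 0 := by
    intro e
    have hi : Integrable fun z => e * fz z + conj e * fzb z :=
      ((hz.const_mul e).add (hzb.const_mul (conj e))).integrable
    have := integral_bilinear_hasLineDerivAt_right_eq_neg_left_of_integrable (μ := volume)
      (f := f) (f' := fun z => e * fz z + conj e * fzb z) (g := fun _ => (1 : ℂ))
      (g' := fun _ => (0 : ℂ)) (v := e) (B := ContinuousLinearMap.mul ℝ ℂ)
      (by simpa using hi) (by simp) (by simpa using hf.integrable)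
      (fun z _ => h z e) (fun z _ => by
        unfold HasLineDerivAt
        exact hasDerivAt_const _ _)
    simp only [ContinuousLinearMap.mul_apply', mul_zero, integral_zero, mul_one] at this
    rw [eq_comm, neg_eq_zero, integral_add (hz.const_mul e).integrable
      (hzb.const_mul (conj e)).integrable, integral_const_mul, integral_const_mul] at this
    exact this
  have h1 := key 1
  have h2 := key Complex.I
  rw [map_one, one_mul, one_mul] at h1
  rw [Complex.conj_I] at h2
  have h3 := Complex.I_mul_I
  constructor
  · linear_combination (1 / 2 : ℂ) * h1 - (Complex.I / 2) * h2
      + (1 / 2 : ℂ) * ((∫ z, fz z) - ∫ z, fzb z) * h3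
  · linear_combination (1 / 2 : ℂ) * h1 + (Complex.I / 2) * h2
      - (1 / 2 : ℂ) * ((∫ z, fz z) - ∫ z, fzb z) * h3

lemma gaussDecay_dispKer (m n : ℕ) : GaussDecay fun z => dispKer z (conj z) m n := by
  induction n generalizing m with
  | zero =>
    induction m with
    | zero =>
      simp only [dispKer_zero_zero]
      refine ⟨by fun_prop, 1 / 2, by norm_num, 1, zero_le_one, fun z => ?_⟩
      rw [Complex.norm_exp, one_mul, Complex.mul_conj']
      refine Real.exp_le_exp.2 (le_of_eq ?_)
      have : (-((‖z‖ : ℂ) ^ 2) / 2) = ((-(1 / 2) * ‖z‖ ^ 2 : ℝ) : ℂ) := by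
        push_cast
        ring
      rw [this, Complex.ofReal_re]
    | succ m ih =>
      have := (Tame.id.mul_gaussDecay ih).const_mul (nsqrt (m + 1))⁻¹
      convert! this using 2 with z
      rw [dispKer, div_eq_inv_mul]
  | succ n ih =>
    have := (((ih (m - 1)).const_mul (nsqrt m)).add
      ((Tame.id.conj.mul_gaussDecay (ih m)).const_mul (-1))).const_mul (nsqrt (n + 1))⁻¹
    convert! this using 2 with z
    rw [dispKer, div_eq_inv_mul]
    ring

/-- The matrix `∫ f(z) D(z)† d²z`. -/
noncomputable def weylInt (f : ℂ → ℂ) : Matrix ℕ ℕ ℂ :=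
  fun n m => ∫ z, f z * conj (dispKer z (conj z) m n)

/-! ### The Weyl transform: multiplication and differentiation become ladder operators -/

lemma gaussDecay_mul_dispKer {f : ℂ → ℂ} (hf : Tame f) (m n : ℕ) :
    GaussDecay fun z => f z * conj (dispKer z (conj z) m n) :=
  hf.mul_gaussDecay (gaussDecay_dispKer m n).conj

lemma weylInt_add {f g : ℂ → ℂ} (hf : Tame f) (hg : Tame g) :
    weylInt (fun z => f z + g z) = weylInt f + weylInt g := by
  ext n m
  simp only [weylInt, Matrix.add_apply, add_mul]
  exact integral_add (gaussDecay_mul_dispKer hf m n).integrable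
    (gaussDecay_mul_dispKer hg m n).integrable

lemma weylInt_const_mul (c : ℂ) (f : ℂ → ℂ) : weylInt (fun z => c * f z) = c • weylInt f := by
  ext n m
  simp only [weylInt, Matrix.smul_apply, smul_eq_mul, mul_assoc]
  exact integral_const_mul _ _

/-- Adjoint of `Da† = (a† - z̄)D`: it reads `zD† = D†a - aD†`, so multiplication by `z` becomes a
commutator. -/
lemma weylInt_id_mul {f : ℂ → ℂ} (hf : Tame f) :
    weylInt (fun z => z * f z) = annR (weylInt f) - annL (weylInt f) := by
  ext n m
  simp only [weylInt, Matrix.sub_apply, annR, annL, ← integral_const_mul]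
  rw [← integral_sub ((gaussDecay_mul_dispKer hf _ _).const_mul _).integrable
    ((gaussDecay_mul_dispKer hf _ _).const_mul _).integrable]
  refine integral_congr_ae (Filter.Eventually.of_forall fun z => ?_)
  have := congrArg conj (dispKer_creR z (conj z) m n)
  simp only [map_mul, map_sub, conj_nsqrt, Complex.conj_conj] at this ⊢
  linear_combination f z * this

lemma weylInt_conj_mul {f : ℂ → ℂ} (hf : Tame f) :
    weylInt (fun z => conj z * f z) = creR (weylInt f) - creL (weylInt f) := by
  ext n m
  simp only [weylInt, Matrix.sub_apply, creR, creL, ← integral_const_mul]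
  rw [← integral_sub ((gaussDecay_mul_dispKer hf _ _).const_mul _).integrable
    ((gaussDecay_mul_dispKer hf _ _).const_mul _).integrable]
  refine integral_congr_ae (Filter.Eventually.of_forall fun z => ?_)
  have := congrArg conj (dispKer_annL z (conj z) n m)
  simp only [map_mul, map_add, conj_nsqrt] at this ⊢
  linear_combination - f z * this

/-- Integrating by parts moves the derivative onto `D†`, which it multiplies by `a` or `a†` up to a
scalar term; the commutation relations spread that term evenly over both sides, giving half an
anticommutator. -/
lemma weylInt_wirt {f fz fzb : ℂ → ℂ} (h : ∀ z, HasWirt f (fz z) (fzb z) z) (hf : Tame f)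
    (hz : Tame fz) (hzb : Tame fzb) :
    weylInt fz = (1 / 2 : ℂ) • (creR (weylInt f) + creL (weylInt f)) ∧
    weylInt fzb = -((1 / 2 : ℂ) • (annR (weylInt f) + annL (weylInt f))) := by
  have hw : ∀ m n z, HasWirt (fun w => f w * conj (dispKer w (conj w) m n))
      (fz z * conj (dispKer z (conj z) m n) + f z * conj (-(nsqrt n * dispKer z (conj z) m (n - 1))
        - z / 2 * dispKer z (conj z) m n))
      (fzb z * conj (dispKer z (conj z) m n) + f z * conj (nsqrt m * dispKer z (conj z) (m - 1) n
        - conj z / 2 * dispKer z (conj z) m n)) z :=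
    fun m n z => (h z).mul (hasWirt_dispKer m n z).conj
  have hG := fun {g : ℂ → ℂ} (hg : Tame g) (m n : ℕ) => gaussDecay_mul_dispKer hg m n
  have e1 : ∀ m n z, fz z * conj (dispKer z (conj z) m n) + f z * conj (-(nsqrt n *
      dispKer z (conj z) m (n - 1)) - z / 2 * dispKer z (conj z) m n) =
      fz z * conj (dispKer z (conj z) m n) +
      ((-(nsqrt (m + 1) / 2)) * (f z * conj (dispKer z (conj z) (m + 1) n)) +
      (-(nsqrt n / 2)) * (f z * conj (dispKer z (conj z) m (n - 1)))) := by
    intro m n z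
    have := congrArg conj (dispKer_annL z (conj z) n m)
    simp only [map_mul, map_add, map_sub, map_neg, map_div₀, conj_nsqrt, map_ofNat] at this ⊢
    linear_combination (1 / 2) * f z * this
  have e2 : ∀ m n z, fzb z * conj (dispKer z (conj z) m n) + f z * conj (nsqrt m *
      dispKer z (conj z) (m - 1) n - conj z / 2 * dispKer z (conj z) m n) =
      fzb z * conj (dispKer z (conj z) m n) +
      ((nsqrt m / 2) * (f z * conj (dispKer z (conj z) (m - 1) n)) +
      (nsqrt (n + 1) / 2) * (f z * conj (dispKer z (conj z) m (n + 1)))) := by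
    intro m n z
    have := congrArg conj (dispKer_creR z (conj z) m n)
    simp only [map_mul, map_sub, map_div₀, conj_nsqrt, Complex.conj_conj, map_ofNat] at this ⊢
    linear_combination - (1 / 2) * f z * this
  have key := fun m n => integral_wirt_eq_zero
    (fun z => (hw m n z).congr_deriv (e1 m n z) (e2 m n z)) (hG hf m n)
    ((hG hz m n).add (((hG hf (m + 1) n).const_mul _).add ((hG hf m (n - 1)).const_mul _)))
    ((hG hzb m n).add (((hG hf (m - 1) n).const_mul _).add ((hG hf m (n + 1)).const_mul _)))
  constructor
  · ext n m
    have := (key m n).1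
    rw [integral_add (hG hz m n).integrable (((hG hf (m + 1) n).const_mul _).add
      ((hG hf m (n - 1)).const_mul _)).integrable, integral_add ((hG hf (m + 1) n).const_mul
      _).integrable ((hG hf m (n - 1)).const_mul _).integrable, integral_const_mul,
      integral_const_mul] at this
    simp only [weylInt, Matrix.add_apply, Matrix.smul_apply, smul_eq_mul, creR, creL]
    linear_combination this
  · ext n m
    have := (key m n).2
    rw [integral_add (hG hzb m n).integrable (((hG hf (m - 1) n).const_mul _).add
      ((hG hf m (n + 1)).const_mul _)).integrable, integral_add ((hG hf (m - 1) n).const_mul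
      _).integrable ((hG hf m (n + 1)).const_mul _).integrable, integral_const_mul,
      integral_const_mul] at this
    simp only [weylInt, Matrix.add_apply, Matrix.smul_apply, Matrix.neg_apply, smul_eq_mul, annR,
      annL]
    linear_combination this

/-! ### Orthogonality of displacement operators and inversion of the characteristic function -/

lemma tame_dispKer (m n : ℕ) : Tame fun z => dispKer z (conj z) m n := (gaussDecay_dispKer m n).tame

/-- The rules of the Weyl transform applied to a matrix element of `D` itself, whose derivatives are
again matrix elements with shifted indices. -/
lemma weylInt_dispKer_ladder (l n : ℕ) :
    nsqrt l • weylInt (fun z => dispKer z (conj z) (l - 1) n) =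
      creR (weylInt fun z => dispKer z (conj z) l n) ∧
    nsqrt n • weylInt (fun z => dispKer z (conj z) l (n - 1)) =
      annL (weylInt fun z => dispKer z (conj z) l n) := by
  have hT := tame_dispKer
  have h1 : ∀ z, HasWirt (fun w => dispKer w (conj w) l n)
      (nsqrt l * dispKer z (conj z) (l - 1) n + (-(1 / 2)) * (conj z * dispKer z (conj z) l n))
      ((-nsqrt n) * dispKer z (conj z) l (n - 1) + (-(1 / 2)) * (z * dispKer z (conj z) l n)) z :=
    fun z => (hasWirt_dispKer l n z).congr_deriv (by ring) (by ring)
  obtain ⟨ha, hb⟩ := weylInt_wirt h1 (hT l n)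
    (((hT (l - 1) n).const_mul _).add ((Tame.id.conj.mul (hT l n)).const_mul _))
    (((hT l (n - 1)).const_mul _).add ((Tame.id.mul (hT l n)).const_mul _))
  rw [weylInt_add ((hT _ _).const_mul _) ((Tame.id.conj.mul (hT l n)).const_mul _),
    weylInt_const_mul, weylInt_const_mul, weylInt_conj_mul (hT l n)] at ha
  rw [weylInt_add ((hT _ _).const_mul _) ((Tame.id.mul (hT l n)).const_mul _),
    weylInt_const_mul, weylInt_const_mul, weylInt_id_mul (hT l n)] at hb
  constructor
  · linear_combination (norm := module) ha
  · linear_combination (norm := module) -hb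

/-- The constant `∫ |⟨0|D(z)|0⟩|² d²z`. -/
noncomputable def vacNorm : ℂ := weylInt (fun z => dispKer z (conj z) 0 0) 0 0

/-- The exact value of the constant is irrelevant: it cancels from every linear relation. -/
lemma vacNorm_ne_zero : vacNorm ≠ 0 := by
  have h : ∀ z : ℂ, dispKer z (conj z) 0 0 * conj (dispKer z (conj z) 0 0) =
      ((Real.exp (-1 * ‖z‖ ^ 2) : ℝ) : ℂ) := by
    intro z
    rw [dispKer_zero_zero, ← Complex.exp_conj, ← Complex.exp_add, Complex.ofReal_exp]
    congr 1
    simp only [map_div₀, map_neg, map_mul, Complex.conj_conj, map_ofNat]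
    push_cast
    rw [← Complex.mul_conj']
    ring
  rw [vacNorm, weylInt]
  simp only [h]
  rw [integral_complex_ofReal, Complex.ofReal_ne_zero, GaussianFourier.integral_rexp_neg_mul_sq_norm
    zero_lt_one]
  positivity

lemma weylInt_dispKer_conj (l n m n' : ℕ) :
    conj (weylInt (fun z => dispKer z (conj z) l n) n' m) =
      weylInt (fun z => dispKer z (conj z) m n') n l := by
  rw [weylInt, weylInt, ← integral_conj]
  refine integral_congr_ae (Filter.Eventually.of_forall fun z => ?_)
  simp only [map_mul, Complex.conj_conj]
  ring

/-- Schur orthogonality of the displacement operators. The ladder relations lower all indices until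
one of them reaches zero, where the factor `nsqrt 0` or the vacuum constant decides. -/
lemma weylInt_dispKer (m n' : ℕ) : ∀ l n, weylInt (fun z => dispKer z (conj z) l n) n' m =
    if l = m ∧ n = n' then vacNorm else 0 := by
  have hR : ∀ l n n' m, nsqrt l * weylInt (fun z => dispKer z (conj z) (l - 1) n) n' m =
      nsqrt (m + 1) * weylInt (fun z => dispKer z (conj z) l n) n' (m + 1) :=
    fun l n n' m => congrFun (congrFun (weylInt_dispKer_ladder l n).1 n') m
  have hL : ∀ l n n' m, nsqrt n * weylInt (fun z => dispKer z (conj z) l (n - 1)) n' m =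
      nsqrt (n' + 1) * weylInt (fun z => dispKer z (conj z) l n) (n' + 1) m :=
    fun l n n' m => congrFun (congrFun (weylInt_dispKer_ladder l n).2 n') m
  induction m with
  | zero =>
    induction n' with
    | zero =>
      intro l n
      rcases n with _ | n
      · rcases l with _ | l
        · simp [vacNorm]
        · have := hR 0 0 0 l
          rw [nsqrt_zero, zero_mul, eq_comm, mul_eq_zero, or_iff_right (nsqrt_succ_ne_zero l)] at this
          rw [← weylInt_dispKer_conj, this]
          simp
      · have := hL 0 0 n l
        rw [nsqrt_zero, zero_mul, eq_comm, mul_eq_zero, or_iff_right (nsqrt_succ_ne_zero n)] at this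
        rw [← weylInt_dispKer_conj, this]
        simp
    | succ n' ih =>
      intro l n
      refine mul_left_cancel₀ (nsqrt_succ_ne_zero n') ?_
      rw [← hL, ih]
      rcases n with _ | n
      · simp
      · by_cases h : n = n' <;> simp [h]
  | succ m ih =>
    intro l n
    refine mul_left_cancel₀ (nsqrt_succ_ne_zero m) ?_
    rw [← hR, ih]
    rcases l with _ | l
    · simp
    · by_cases h : l = m <;> simp [h]

lemma measurable_diag {ρ : Matrix ℕ ℕ ℂ} (hρ : IsState ρ) (n : ℕ) :
    Measurable fun z => (ρ ⊡ displacement z) n n := by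
  refine measurable_of_tendsto_metrizable (f := fun K z =>
    ∑ k ∈ Finset.range K, ρ n k * dispKer z (conj z) k n) (fun K => ?_) ?_
  · exact (continuous_finsetSum _ fun k _ =>
      continuous_const.mul (gaussDecay_dispKer k n).1).measurable
  · rw [tendsto_pi_nhds]
    intro z
    rw [opMul_dispKer_apply]
    exact (summable_row_mul_dispKer hρ z (conj z) n n).of_norm.hasSum.tendsto_sum_nat

/-- Inner half of the inversion formula: the sum over `k` in `(ρD)ₙₙ` is exchanged with the
integral, its partial sums being eventually bounded by `1`. -/
lemma weylInt_diag {ρ : Matrix ℕ ℕ ℂ} (hρ : IsState ρ) (n n' m : ℕ) :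
    weylInt (fun z => (ρ ⊡ displacement z) n n) n' m = if n = n' then vacNorm * ρ n' m else 0 := by
  have hlim : Filter.Tendsto (fun K => ∫ z, (∑ k ∈ Finset.range K, ρ n k * dispKer z (conj z) k n) *
      conj (dispKer z (conj z) m n')) Filter.atTop
      (nhds (weylInt (fun z => (ρ ⊡ displacement z) n n) n' m)) := by
    refine tendsto_integral_filter_of_dominated_convergence
      (fun z => ‖conj (dispKer z (conj z) m n')‖) ?_ ?_ ?_ ?_
    · refine Filter.Eventually.of_forall fun K => Continuous.aestronglyMeasurable ?_
      exact (continuous_finsetSum _ fun k _ =>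
        continuous_const.mul (gaussDecay_dispKer k n).1).mul (gaussDecay_dispKer m n').conj.1
    · filter_upwards [Filter.eventually_gt_atTop n] with K hK
      refine Filter.Eventually.of_forall fun z => ?_
      rw [norm_mul]
      refine mul_le_of_le_one_left (norm_nonneg _) ?_
      have h := sum_norm_partial_le hρ z {n} K (by simpa using hK)
      rw [Finset.sum_singleton] at h
      exact h.trans (Real.sqrt_le_one.2 (sum_re_diag_le_one hρ _))
    · exact (gaussDecay_dispKer m n').conj.integrable.norm
    · refine Filter.Eventually.of_forall fun z => Filter.Tendsto.mul_const _ ?_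
      beta_reduce
      rw [opMul_dispKer_apply]
      exact (summable_row_mul_dispKer hρ z (conj z) n n).of_norm.hasSum.tendsto_sum_nat
  refine tendsto_nhds_unique hlim (tendsto_const_nhds.congr' ?_)
  filter_upwards [Filter.eventually_gt_atTop m] with K hK
  have hi : ∀ k ∈ Finset.range K, Integrable fun z =>
      ρ n k * dispKer z (conj z) k n * conj (dispKer z (conj z) m n') := fun k _ =>
    (gaussDecay_mul_dispKer ((tame_dispKer k n).const_mul (ρ n k)) m n').integrable
  simp only [Finset.sum_mul]
  rw [integral_finsetSum _ hi]
  have e : ∀ k, ∫ z, ρ n k * dispKer z (conj z) k n * conj (dispKer z (conj z) m n') =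
      ρ n k * if k = m ∧ n = n' then vacNorm else 0 := by
    intro k
    simp only [mul_assoc]
    rw [integral_const_mul, ← weylInt_dispKer m n' k n]
    rfl
  simp only [e]
  rw [Finset.sum_eq_single m]
  · by_cases h : n = n'
    · simp [h, mul_comm]
    · simp [h]
  · intro k _ hk
    simp [hk]
  · intro h
    exact absurd (Finset.mem_range.2 hK) h

/-- Inversion of the characteristic function, by orthogonality after exchanging the trace with the
integral. The matrix elements of `D†` supply Gaussian decay, so `|χ| ≤ 1` suffices and integrability
of `χ` is not required. -/
theorem weylInt_charFn {ρ : Matrix ℕ ℕ ℂ} (hρ : IsState ρ) : weylInt (charFn ρ) = vacNorm • ρ := by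
  ext n' m
  have hlim : Filter.Tendsto (fun N => ∫ z, (∑ n ∈ Finset.range N, (ρ ⊡ displacement z) n n) *
      conj (dispKer z (conj z) m n')) Filter.atTop (nhds (weylInt (charFn ρ) n' m)) := by
    refine tendsto_integral_of_dominated_convergence
      (fun z => ‖conj (dispKer z (conj z) m n')‖) ?_ ?_ ?_ ?_
    · intro N
      refine ((Finset.measurable_fun_sum _ fun n _ => measurable_diag hρ n).mul
        (gaussDecay_dispKer m n').conj.1.measurable).aestronglyMeasurable
    · exact (gaussDecay_dispKer m n').conj.integrable.norm
    · intro N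
      refine Filter.Eventually.of_forall fun z => ?_
      rw [norm_mul]
      exact mul_le_of_le_one_left (norm_nonneg _)
        ((norm_sum_le _ _).trans (sum_norm_diag_le_one hρ z _))
    · refine Filter.Eventually.of_forall fun z => Filter.Tendsto.mul_const _ ?_
      exact (summable_norm_diag hρ z).of_norm.hasSum.tendsto_sum_nat
  refine tendsto_nhds_unique hlim (tendsto_const_nhds.congr' ?_)
  filter_upwards [Filter.eventually_gt_atTop n'] with N hN
  have hi : ∀ n ∈ Finset.range N, Integrable fun z =>
      (ρ ⊡ displacement z) n n * conj (dispKer z (conj z) m n') := by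
    intro n _
    refine (gaussDecay_dispKer m n').conj.integrable.norm.mono'
      ((measurable_diag hρ n).mul (gaussDecay_dispKer m n').conj.1.measurable).aestronglyMeasurable
      (Filter.Eventually.of_forall fun z => ?_)
    rw [norm_mul]
    refine mul_le_of_le_one_left (norm_nonneg _) ?_
    simpa using sum_norm_diag_le_one hρ z {n}
  simp only [Finset.sum_mul]
  rw [integral_finsetSum _ hi]
  have e : ∀ n, ∫ z, (ρ ⊡ displacement z) n n * conj (dispKer z (conj z) m n') =
      if n = n' then vacNorm * ρ n' m else 0 := fun n => weylInt_diag hρ n n' m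
  simp only [e]
  rw [Finset.sum_ite_eq', if_pos (Finset.mem_range.2 hN)]
  rfl

/-! ### Gaussian functions -/

/-- The function `exp(-k|z|² - Re(l̄z²) + az + bz̄)`. -/
noncomputable def gaussFn (k : ℝ) (l a b z : ℂ) : ℂ :=
  Complex.exp (-(k * (z * conj z) + (conj l * z ^ 2 + l * conj z ^ 2) / 2) + (a * z + b * conj z))

lemma hasWirt_gaussFn (k : ℝ) (l a b z : ℂ) : HasWirt (gaussFn k l a b)
    ((-k * conj z - conj l * z + a) * gaussFn k l a b z)
    ((-k * z - l * conj z + b) * gaussFn k l a b z) z := by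
  have h1 := HasWirt.id z
  have h2 := h1.conj
  have h3 := ((h1.mul h2).const_mul (-k)).add ((((h1.mul h1).const_mul (-(conj l) / 2)).add
    ((h2.mul h2).const_mul (-l / 2))).add ((h1.const_mul a).add (h2.const_mul b)))
  have h4 := h3.cexp
  have e : (fun w => Complex.exp (-k * (w * conj w) + ((-(conj l) / 2) * (w * w) +
      (-l / 2) * (conj w * conj w) + (a * w + b * conj w)))) = gaussFn k l a b := by
    funext w
    rw [gaussFn]
    congr 1
    ring
  have e' := congrFun e z
  rw [e] at h4
  simp only [e'] at h4
  refine h4.congr_deriv ?_ ?_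
  · simp only [map_zero]
    ring
  · simp only [map_one]
    ring

lemma norm_gaussFn_le (k : ℝ) (l a b z : ℂ) : ‖gaussFn k l a b z‖ ≤
    Real.exp (-(k - ‖l‖) * ‖z‖ ^ 2 + (‖a‖ + ‖b‖) * ‖z‖) := by
  rw [gaussFn, Complex.norm_exp]
  refine Real.exp_le_exp.2 ?_
  rw [Complex.mul_conj', Complex.add_re, Complex.neg_re, Complex.add_re]
  have h0 : ((k : ℂ) * (‖z‖ : ℂ) ^ 2).re = k * ‖z‖ ^ 2 := by norm_cast
  have h1 : |((conj l * z ^ 2 + l * conj z ^ 2) / 2).re| ≤ ‖l‖ * ‖z‖ ^ 2 := by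
    refine (Complex.abs_re_le_norm _).trans ?_
    rw [norm_div, Complex.norm_ofNat, div_le_iff₀ two_pos]
    refine (norm_add_le _ _).trans (le_of_eq ?_)
    simp only [norm_mul, norm_pow, RCLike.norm_conj]
    ring
  have h2 : (a * z + b * conj z).re ≤ (‖a‖ + ‖b‖) * ‖z‖ := by
    refine (Complex.re_le_norm _).trans ((norm_add_le _ _).trans (le_of_eq ?_))
    simp only [norm_mul, RCLike.norm_conj]
    ring
  have h3 := neg_le_of_abs_le h1
  rw [h0]
  linarith

lemma continuous_gaussFn (k : ℝ) (l a b : ℂ) : Continuous (gaussFn k l a b) := by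
  unfold gaussFn
  fun_prop

lemma gaussDecay_gaussFn {k : ℝ} {l : ℂ} (h : ‖l‖ < k) (a b : ℂ) :
    GaussDecay (gaussFn k l a b) := by
  set δ := k - ‖l‖ with hδ
  have hδ0 : 0 < δ := by linarith
  set c := ‖a‖ + ‖b‖
  refine ⟨continuous_gaussFn k l a b, δ / 2, by positivity, Real.exp (c ^ 2 / (2 * δ)),
    (Real.exp_pos _).le, fun z => (norm_gaussFn_le k l a b z).trans ?_⟩
  rw [← Real.exp_add]
  refine Real.exp_le_exp.2 ?_
  have : c ^ 2 / (2 * δ) + -(δ / 2) * ‖z‖ ^ 2 - (-δ * ‖z‖ ^ 2 + c * ‖z‖) =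
      (c - δ * ‖z‖) ^ 2 / (2 * δ) := by
    field_simp
    ring
  have h2 : 0 ≤ (c - δ * ‖z‖) ^ 2 / (2 * δ) := by positivity
  linarith

/-! ### The ladder relations of a Gaussian state -/

/-- The linear relations between `aX`, `Xa`, `a†X` and `Xa†` for an operator `X` whose
characteristic function is the Gaussian `exp(-k|z|² - Re(l̄z²) + gz - ḡz̄)`. -/
structure GaussRel (k : ℝ) (l g : ℂ) (X : Matrix ℕ ℕ ℂ) : Prop where
  rel_ann : (1 / 2 : ℂ) • (annR X + annL X) =
    (k : ℂ) • (annR X - annL X) + l • (creR X - creL X) + conj g • X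
  rel_cre : (1 / 2 : ℂ) • (creR X + creL X) =
    -((k : ℂ) • (creR X - creL X)) - conj l • (annR X - annL X) + g • X

@[simp] lemma annL_smul (c : ℂ) (X : Matrix ℕ ℕ ℂ) : annL (c • X) = c • annL X := by
  ext m n; simp [annL]; ring

@[simp] lemma annR_smul (c : ℂ) (X : Matrix ℕ ℕ ℂ) : annR (c • X) = c • annR X := by
  ext m n; simp [annR]; ring

@[simp] lemma creL_smul (c : ℂ) (X : Matrix ℕ ℕ ℂ) : creL (c • X) = c • creL X := by
  ext m n; simp [creL]; ring

@[simp] lemma creR_smul (c : ℂ) (X : Matrix ℕ ℕ ℂ) : creR (c • X) = c • creR X := by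
  ext m n; simp [creR]; ring

/-- The Weyl transform of the two equations `∂χ = (-kz̄ - l̄z + g)χ` and `∂̄χ = (-kz - lz̄ - ḡ)χ`.
-/
theorem gaussRel_of_charFn {ρ : Matrix ℕ ℕ ℂ} (hρ : IsState ρ) {k : ℝ} {l g : ℂ}
    (hχ : charFn ρ = gaussFn k l g (-conj g)) : GaussRel k l g ρ := by
  set G := gaussFn k l g (-conj g) with hG
  -- Temperateness is taken from `|χ| ≤ 1`, so no inequality between `k` and `|l|` is assumed here.
  have hT : Tame G := .of_bounded (continuous_gaussFn _ _ _ _) (C := 1) fun z => by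
    rw [← hχ]
    exact norm_charFn_le_one hρ z
  have hI := Tame.id
  have hw : ∀ z, HasWirt G ((-k) * (conj z * G z) + ((-(conj l)) * (z * G z) + g * G z))
      ((-k) * (z * G z) + ((-l) * (conj z * G z) + (-conj g) * G z)) z := fun z =>
    (hasWirt_gaussFn k l g (-conj g) z).congr_deriv (by ring) (by ring)
  have h1 := (hI.mul hT)
  have h2 := (hI.conj.mul hT)
  obtain ⟨ha, hb⟩ := weylInt_wirt hw hT
    ((h2.const_mul _).add ((h1.const_mul _).add (hT.const_mul _)))
    ((h1.const_mul _).add ((h2.const_mul _).add (hT.const_mul _)))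
  rw [weylInt_add (h2.const_mul _) ((h1.const_mul _).add (hT.const_mul _)),
    weylInt_add (h1.const_mul _) (hT.const_mul _), weylInt_const_mul, weylInt_const_mul,
    weylInt_const_mul, weylInt_id_mul hT, weylInt_conj_mul hT] at ha
  rw [weylInt_add (h1.const_mul _) ((h2.const_mul _).add (hT.const_mul _)),
    weylInt_add (h2.const_mul _) (hT.const_mul _), weylInt_const_mul, weylInt_const_mul,
    weylInt_const_mul, weylInt_id_mul hT, weylInt_conj_mul hT] at hb
  rw [← hχ, weylInt_charFn hρ] at ha hb
  have hv := vacNorm_ne_zero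
  simp only [annL_smul, annR_smul, creL_smul, creR_smul] at ha hb
  constructor
  · refine smul_right_injective _ hv ?_
    linear_combination (norm := module) hb
  · refine smul_right_injective _ hv ?_
    linear_combination (norm := module) -ha

/-! ### Consequences of the ladder relations -/

/-- The coefficient `k² - |l|² - 1/4`. -/
noncomputable def relB (k : ℝ) (l : ℂ) : ℝ := k ^ 2 - ‖l‖ ^ 2 - 1 / 4

/-- The determinant `(k + 1/2)² - |l|²`. -/
noncomputable def relDet (k : ℝ) (l : ℂ) : ℝ := (k + 1 / 2) ^ 2 - ‖l‖ ^ 2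

/-- The coefficient `l g + (k + 1/2) ḡ`. -/
noncomputable def relC (k : ℝ) (l g : ℂ) : ℂ := l * g + (k + 1 / 2) * conj g

lemma ofReal_relB (k : ℝ) (l : ℂ) : ((relB k l : ℝ) : ℂ) = k ^ 2 - l * conj l - 1 / 4 := by
  rw [relB, Complex.mul_conj']
  push_cast
  ring

lemma ofReal_relDet (k : ℝ) (l : ℂ) :
    ((relDet k l : ℝ) : ℂ) = (k + 1 / 2) ^ 2 - l * conj l := by
  rw [relDet, Complex.mul_conj']
  push_cast
  ring

section

variable {k : ℝ} {l g : ℂ} {X : Matrix ℕ ℕ ℂ}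

/-- Solves the two relations for `aX` and `Xa†`, the products that reach an entry of higher index,
in terms of `Xa`, `a†X` and `X`, which involve only entries of no larger index. The determinant is
`relDet`. -/
lemma GaussRel.annL_eq (h : GaussRel k l g X) : ((relDet k l : ℝ) : ℂ) • annL X =
    ((relB k l : ℝ) : ℂ) • annR X - l • creL X + relC k l g • X := by
  obtain ⟨h1, h2⟩ := h
  rw [ofReal_relDet, ofReal_relB, relC]
  linear_combination (norm := module) ((k : ℂ) + 1 / 2) • h1 + l • h2

lemma GaussRel.creR_eq (h : GaussRel k l g X) : ((relDet k l : ℝ) : ℂ) • creR X =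
    ((relB k l : ℝ) : ℂ) • creL X - conj l • annR X + conj (relC k l g) • X := by
  obtain ⟨h1, h2⟩ := h
  rw [ofReal_relDet, ofReal_relB, relC]
  simp only [map_add, map_mul, Complex.conj_conj, Complex.conj_ofReal, map_div₀, map_one, map_ofNat]
  linear_combination (norm := module) ((k : ℂ) + 1 / 2) • h2 + conj l • h1

lemma GaussRel.sub {Y : Matrix ℕ ℕ ℂ} (h : GaussRel k l g X) (h' : GaussRel k l g Y) :
    GaussRel k l g (X - Y) := by
  have e1 : annL (X - Y) = annL X - annL Y := by ext m n; simp [annL, mul_sub]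
  have e2 : annR (X - Y) = annR X - annR Y := by ext m n; simp [annR, mul_sub]
  have e3 : creL (X - Y) = creL X - creL Y := by ext m n; simp [creL, mul_sub]
  have e4 : creR (X - Y) = creR X - creR Y := by ext m n; simp [creR, mul_sub]
  constructor
  · rw [e1, e2, e3, e4]
    linear_combination (norm := module) h.rel_ann - h'.rel_ann
  · rw [e1, e2, e3, e4]
    linear_combination (norm := module) h.rel_cre - h'.rel_cre

lemma GaussRel.smul (h : GaussRel k l g X) (c : ℂ) : GaussRel k l g (c • X) := by
  constructor
  · simp only [annL_smul, annR_smul, creL_smul, creR_smul]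
    linear_combination (norm := module) c • h.rel_ann
  · simp only [annL_smul, annR_smul, creL_smul, creR_smul]
    linear_combination (norm := module) c • h.rel_cre

lemma GaussRel.entry_ann (h : GaussRel k l g X) (m n : ℕ) :
    relDet k l * (nsqrt (m + 1) * X (m + 1) n) =
      relB k l * (nsqrt n * X m (n - 1)) - l * (nsqrt m * X (m - 1) n) + relC k l g * X m n :=
  congrFun (congrFun h.annL_eq m) n

lemma GaussRel.entry_cre (h : GaussRel k l g X) (m n : ℕ) :
    relDet k l * (nsqrt (n + 1) * X m (n + 1)) =
      relB k l * (nsqrt m * X (m - 1) n) - conj l * (nsqrt n * X m (n - 1))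
        + conj (relC k l g) * X m n :=
  congrFun (congrFun h.creR_eq m) n

/-- The recursion, run by induction on `m + n`, determines all entries from the vacuum entry. This
uniqueness later identifies `ρ` with a mixture of coherent states. -/
lemma GaussRel.eq_zero (h : GaussRel k l g X) (hD : relDet k l ≠ 0) (h0 : X 0 0 = 0) : X = 0 := by
  have hD' : ((relDet k l : ℝ) : ℂ) ≠ 0 := Complex.ofReal_ne_zero.2 hD
  have key : ∀ s m n, m + n ≤ s → X m n = 0 := by
    intro s
    induction s with
    | zero =>
      intro m n hmn
      obtain ⟨rfl, rfl⟩ : m = 0 ∧ n = 0 := by omega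
      exact h0
    | succ s ih =>
      intro m n hmn
      rcases m with _ | m
      · rcases n with _ | n
        · exact h0
        · have := h.entry_cre 0 n
          rw [ih 0 n (by omega), ih 0 (n - 1) (by omega)] at this
          simpa [hD', nsqrt_succ_ne_zero] using this
      · have := h.entry_ann m n
        rw [ih m n (by omega), ih m (n - 1) (by omega), ih (m - 1) n (by omega)] at this
        simpa [hD', nsqrt_succ_ne_zero] using this
  ext m n
  exact key _ m n le_rfl

lemma GaussRel.eq_smul {Y : Matrix ℕ ℕ ℂ} (hX : GaussRel k l g X) (hY : GaussRel k l g Y)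
    (hD : relDet k l ≠ 0) (hY0 : Y 0 0 ≠ 0) : X = (X 0 0 / Y 0 0) • Y := by
  have := (hX.sub (hY.smul (X 0 0 / Y 0 0))).eq_zero hD (by simp [hY0])
  rwa [sub_eq_zero] at this

lemma GaussRel.zero_zero_pos (h : GaussRel k l g X) (hD : relDet k l ≠ 0) (hX : IsState X) :
    0 < (X 0 0).re := by
  refine lt_of_le_of_ne (re_diag_nonneg hX.1 0) fun h0 => ?_
  have h1 : X 0 0 = 0 := by
    refine Complex.ext h0.symm ?_
    exact (Complex.nonneg_iff.1 (hX.1.diag_nonneg (i := 0))).2.symm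
  have h2 := hX.2
  rw [h.eq_zero hD h1] at h2
  exact one_ne_zero (h2.unique (by simp))

lemma entry_eq_ofReal {X : Matrix ℕ ℕ ℂ} (hX : X.PosSemidef) (n : ℕ) :
    X n n = ((X n n).re : ℂ) := by
  refine Complex.ext (by simp) ?_
  simpa using (Complex.nonneg_iff.1 (hX.diag_nonneg (i := n))).2.symm

/-- The recursion gives `relDet · (X₀₀X₁₁ - |X₀₁|²) = relB · X₀₀²`, and the 2×2 minor of a positive
matrix is nonnegative. In terms of the covariance eigenvalues this is the uncertainty relation `v₁v₂
≥ 1`. -/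
lemma GaussRel.relB_nonneg (h : GaussRel k l g X) (hD : 0 < relDet k l) (hX : IsState X) :
    0 ≤ relB k l := by
  have h0 := h.zero_zero_pos hD.ne' hX
  have e1 := h.entry_ann 0 1
  have e2 := h.entry_cre 0 0
  simp only [zero_add, nsqrt_one, nsqrt_zero, one_mul, zero_mul, mul_zero, sub_zero, sub_self,
    Nat.sub_self] at e1 e2
  have hH := hX.1.isHermitian.apply 0 1
  have hle := norm_sq_entry_le hX.1 0 1
  have hn : ((‖X 0 1‖ ^ 2 : ℝ) : ℂ) = X 0 1 * conj (X 0 1) := by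
    rw [Complex.mul_conj']
    norm_cast
  have key : relDet k l * ((X 0 0).re * (X 1 1).re) =
      relB k l * (X 0 0).re ^ 2 + relDet k l * ‖X 0 1‖ ^ 2 := by
    apply Complex.ofReal_injective
    rw [Complex.ofReal_mul, Complex.ofReal_mul, Complex.ofReal_add, Complex.ofReal_mul,
      Complex.ofReal_mul, hn, Complex.ofReal_pow, ← entry_eq_ofReal hX.1 0, ← entry_eq_ofReal hX.1 1]
    have e3 := congrArg conj e2
    simp only [map_mul, Complex.conj_ofReal, Complex.conj_conj] at e3
    have e4 : conj (X 0 0) = X 0 0 := hX.1.isHermitian.apply 0 0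
    rw [e4] at e3
    linear_combination X 0 0 * e1 - X 0 1 * e3
  have h1 : 0 ≤ relB k l * (X 0 0).re ^ 2 := by
    nlinarith [mul_le_mul_of_nonneg_left hle hD.le]
  exact nonneg_of_mul_nonneg_left h1 (by positivity)

/-- Matrices all of whose entries are bounded by a multiple of `y^(m+n)`. -/
def GeomBound (y : ℝ) (X : Matrix ℕ ℕ ℂ) : Prop :=
  ∃ C : ℝ, 0 ≤ C ∧ ∀ m n, ‖X m n‖ ≤ C * (y ^ m * y ^ n)

/-- For `n ≤ m + 1` the ratios `√n/√(m+1)` and `√m/√(m+1)` are at most `1`. The recursion then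
bounds an entry by `α` and `β` times entries of total index lower by two, plus `γ/√N` times one of
total index lower by one. -/
lemma entry_bound_step {α β γ y M : ℝ} (hα : 0 ≤ α) (hβ : 0 ≤ β) (hγ : 0 ≤ γ) (hy : 0 < y)
    (hy1 : y ≤ 1) (hM : 0 ≤ M) {N : ℕ} {x : ℕ → ℕ → ℝ} {m n : ℕ} (hmn : n ≤ m + 1)
    (hN : N ≤ m + 1) (hstep : Real.sqrt (m + 1 : ℕ) * x (m + 1) n ≤
      α * (Real.sqrt n * x m (n - 1)) + β * (Real.sqrt m * x (m - 1) n) + γ * x m n)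
    (hyN : α + β + γ / Real.sqrt N ≤ y ^ 2) (hN0 : 0 < N)
    (ih : ∀ m' n', m' + n' ≤ m + n → x m' n' ≤ M * y ^ (m' + n')) :
    x (m + 1) n ≤ M * y ^ (m + 1 + n) := by
  set S := Real.sqrt (m + 1 : ℕ) with hS
  have hS0 : 0 < S := by positivity
  have hMy : 0 ≤ M * y ^ (m + 1 + n) := by positivity
  -- The bounds carry the factor `y²` to avoid negative powers of `y`.
  have a1 : y ^ 2 * (Real.sqrt n * x m (n - 1)) ≤ S * (M * y ^ (m + 1 + n)) := by
    rcases n with _ | n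
    · simp
      positivity
    · have h1 := ih m n (by omega)
      have h2 : Real.sqrt (n + 1 : ℕ) ≤ S := Real.sqrt_le_sqrt (by exact_mod_cast hmn)
      calc y ^ 2 * (Real.sqrt (n + 1 : ℕ) * x m n)
          ≤ y ^ 2 * (Real.sqrt (n + 1 : ℕ) * (M * y ^ (m + n))) := by gcongr
        _ ≤ y ^ 2 * (S * (M * y ^ (m + n))) := by gcongr
        _ = S * (M * y ^ (m + 1 + (n + 1))) := by ring
  have a2 : y ^ 2 * (Real.sqrt m * x (m - 1) n) ≤ S * (M * y ^ (m + 1 + n)) := by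
    rcases m with _ | m
    · simp only [Nat.cast_zero, Real.sqrt_zero, zero_mul, mul_zero]
      positivity
    · have h1 := ih m n (by omega)
      have h2 : Real.sqrt (m + 1 : ℕ) ≤ S := Real.sqrt_le_sqrt (by exact_mod_cast Nat.le_succ _)
      calc y ^ 2 * (Real.sqrt (m + 1 : ℕ) * x m n)
          ≤ y ^ 2 * (Real.sqrt (m + 1 : ℕ) * (M * y ^ (m + n))) := by gcongr
        _ ≤ y ^ 2 * (S * (M * y ^ (m + n))) := by gcongr
        _ = S * (M * y ^ (m + 1 + 1 + n)) := by ring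
  have hSN : Real.sqrt N ≤ S := Real.sqrt_le_sqrt (by exact_mod_cast hN)
  have hSN0 : 0 < Real.sqrt N := by positivity
  have a3 : y ^ 2 * (γ * x m n) ≤ γ / Real.sqrt N * (S * (M * y ^ (m + 1 + n))) := by
    have h1 := ih m n le_rfl
    have h3 : y ^ 2 * (γ * x m n) ≤ γ * (M * y ^ (m + 1 + n)) := by
      calc y ^ 2 * (γ * x m n) ≤ y ^ 2 * (γ * (M * y ^ (m + n))) := by gcongr
        _ = γ * (M * y ^ (m + 1 + n)) * y := by ring
        _ ≤ γ * (M * y ^ (m + 1 + n)) := mul_le_of_le_one_right (by positivity) hy1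
    refine h3.trans ?_
    rw [div_mul_eq_mul_div, le_div_iff₀ hSN0]
    calc γ * (M * y ^ (m + 1 + n)) * Real.sqrt N ≤ γ * (M * y ^ (m + 1 + n)) * S := by gcongr
      _ = γ * (S * (M * y ^ (m + 1 + n))) := by ring
  set T := S * (M * y ^ (m + 1 + n)) with hT
  have hT0 : 0 ≤ T := by positivity
  have h5 : y ^ 2 * (S * x (m + 1) n) ≤ y ^ 2 * T := by
    calc y ^ 2 * (S * x (m + 1) n) ≤ y ^ 2 * (α * (Real.sqrt n * x m (n - 1)) +
          β * (Real.sqrt m * x (m - 1) n) + γ * x m n) := by gcongr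
      _ = α * (y ^ 2 * (Real.sqrt n * x m (n - 1))) + β * (y ^ 2 * (Real.sqrt m * x (m - 1) n))
          + y ^ 2 * (γ * x m n) := by ring
      _ ≤ α * T + β * T + γ / Real.sqrt N * T := by gcongr
      _ = (α + β + γ / Real.sqrt N) * T := by ring
      _ ≤ y ^ 2 * T := by gcongr
  have h6 := le_of_mul_le_mul_left h5 (by positivity)
  exact le_of_mul_le_mul_left h6 hS0

lemma GaussRel.geomBound (h : GaussRel k l g X) (hl : ‖l‖ < k + 1 / 2) (hX : IsState X) :
    ∃ y : ℝ, 0 < y ∧ y < 1 ∧ GeomBound y X := by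
  have hD : 0 < relDet k l := by
    rw [relDet]
    nlinarith [norm_nonneg l]
  have hB := h.relB_nonneg hD hX
  set α := relB k l / relDet k l with hα
  set β := ‖l‖ / relDet k l with hβ
  set γ := ‖relC k l g‖ / relDet k l with hγ
  have hα0 : 0 ≤ α := by positivity
  have hβ0 : 0 ≤ β := by positivity
  have hγ0 : 0 ≤ γ := by positivity
  -- Equivalent to `|l| < k + 1/2`, because `relDet - relB = k + 1/2`.
  have hαβ : α + β < 1 := by
    rw [hα, hβ, ← add_div, div_lt_one hD, relB, relDet]
    nlinarith
  have hstep1 : ∀ m n, Real.sqrt (m + 1 : ℕ) * ‖X (m + 1) n‖ ≤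
      α * (Real.sqrt n * ‖X m (n - 1)‖) + β * (Real.sqrt m * ‖X (m - 1) n‖) + γ * ‖X m n‖ := by
    intro m n
    have e := congrArg norm (h.entry_ann m n)
    rw [norm_mul, norm_mul, norm_nsqrt, Complex.norm_real, Real.norm_of_nonneg hD.le] at e
    have e2 : relDet k l * (Real.sqrt (m + 1 : ℕ) * ‖X (m + 1) n‖) ≤
        relB k l * (Real.sqrt n * ‖X m (n - 1)‖) + ‖l‖ * (Real.sqrt m * ‖X (m - 1) n‖)
          + ‖relC k l g‖ * ‖X m n‖ := by
      rw [e]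
      refine (norm_add_le _ _).trans (add_le_add ((norm_sub_le _ _).trans (le_of_eq ?_))
        (norm_mul_le _ _))
      simp only [norm_mul, norm_nsqrt, Complex.norm_real, Real.norm_of_nonneg hB]
    rw [hα, hβ, hγ, div_mul_eq_mul_div, div_mul_eq_mul_div, div_mul_eq_mul_div, ← add_div,
      ← add_div, le_div_iff₀ hD]
    linarith
  have hsymm : ∀ m n, ‖X m n‖ = ‖X n m‖ := by
    intro m n
    rw [← hX.1.isHermitian.apply m n, norm_star]
  set δ := (1 - (α + β)) / 2 with hδ
  have hδ0 : 0 < δ := by linarith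
  -- Beyond index `N` the linear term `γ` costs at most `δ`, half of the gap between `α + β` and
  -- `1`.
  obtain ⟨N, hN⟩ := exists_nat_gt ((γ / δ) ^ 2)
  have hN0 : 0 < N := by
    have : (0 : ℝ) < N := lt_of_le_of_lt (sq_nonneg _) hN
    exact_mod_cast this
  have hγN : γ / Real.sqrt N ≤ δ := by
    have h1 : γ / δ ≤ Real.sqrt N := Real.le_sqrt_of_sq_le hN.le
    rw [div_le_iff₀ hδ0] at h1
    rw [div_le_iff₀ (by positivity)]
    linarith
  set y := Real.sqrt (α + β + δ) with hy
  have hy2 : y ^ 2 = α + β + δ := Real.sq_sqrt (by positivity)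
  have hy0 : 0 < y := Real.sqrt_pos.2 (by positivity)
  have hy1 : y < 1 := by
    rw [hy, Real.sqrt_lt' one_pos]
    linarith
  -- Makes the claimed bound at least `1` for `m + n ≤ 2N`, where entries of a state are at most
  -- `1`. For `m + n > 2N` the larger index exceeds `N`, and Hermitian symmetry lets it be the row
  -- index.
  set M := (y ^ (2 * N))⁻¹ with hM
  have hM0 : 0 < M := by positivity
  have key : ∀ s m n, m + n ≤ s → ‖X m n‖ ≤ M * y ^ (m + n) := by
    intro s
    induction s with
    | zero =>
      intro m n hmn
      obtain ⟨rfl, rfl⟩ : m = 0 ∧ n = 0 := by omega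
      refine (norm_entry_le_one hX 0 0).trans ?_
      rw [pow_zero, mul_one, hM]
      exact one_le_inv_iff₀.2 ⟨by positivity, pow_le_one₀ hy0.le hy1.le⟩
    | succ s ih =>
      intro m n hmn
      by_cases hs : m + n ≤ 2 * N
      · refine (norm_entry_le_one hX m n).trans ?_
        rw [hM, ← div_eq_inv_mul, one_le_div (by positivity)]
        exact pow_le_pow_of_le_one hy0.le hy1.le hs
      · wlog hle : n ≤ m generalizing m n
        · rw [hsymm, add_comm]
          exact this n m (by omega) (by omega) (by omega)
        obtain ⟨m, rfl⟩ : ∃ m', m = m' + 1 := ⟨m - 1, by omega⟩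
        exact entry_bound_step (x := fun m n => ‖X m n‖) hα0 hβ0 hγ0 hy0 hy1.le hM0.le hle
          (by omega) (hstep1 m n) (by rw [hy2]; linarith) hN0
          fun m' n' h' => ih m' n' (by omega)
  refine ⟨y, hy0, hy1, M, hM0.le, fun m n => ?_⟩
  rw [← pow_add]
  exact key _ m n le_rfl

end

/-! ### Traces of products -/

section

variable {X Y Z : Matrix ℕ ℕ ℂ} {s r y : ℝ}

lemma GeomBound.mono (h : GeomBound s X) (hs : 0 ≤ s) (hsr : s ≤ r) : GeomBound r X := by
  obtain ⟨C, hC, hb⟩ := h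
  have hr : 0 ≤ r := hs.trans hsr
  refine ⟨C, hC, fun m n => (hb m n).trans ?_⟩
  gcongr

lemma GeomBound.add (h : GeomBound s X) (h' : GeomBound s Y) : GeomBound s (X + Y) := by
  obtain ⟨C, hC, hb⟩ := h
  obtain ⟨C', hC', hb'⟩ := h'
  refine ⟨C + C', by positivity, fun m n => (norm_add_le _ _).trans ?_⟩
  rw [add_mul]
  exact add_le_add (hb m n) (hb' m n)

lemma GeomBound.smul (h : GeomBound s X) (c : ℂ) : GeomBound s (c • X) := by
  obtain ⟨C, hC, hb⟩ := h
  refine ⟨‖c‖ * C, by positivity, fun m n => ?_⟩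
  rw [Matrix.smul_apply, norm_smul, mul_assoc]
  exact mul_le_mul_of_nonneg_left (hb m n) (norm_nonneg _)

lemma GeomBound.annL (h : GeomBound s X) (hs : 0 < s) (hsr : s < r) : GeomBound r (annL X) := by
  obtain ⟨C, hC, hb⟩ := h
  obtain ⟨K, hK, hk⟩ := shift_down_bound hs hsr
  have hr : 0 < r := hs.trans hsr
  refine ⟨C * K, by positivity, fun m n => ?_⟩
  rw [OneMode.annL, norm_mul, norm_nsqrt]
  calc _ ≤ Real.sqrt (m + 1 : ℕ) * (C * (s ^ (m + 1) * s ^ n)) := by gcongr; exact hb _ _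
    _ = C * (Real.sqrt (m + 1 : ℕ) * s ^ (m + 1)) * s ^ n := by ring
    _ ≤ C * (K * r ^ m) * r ^ n := mul_le_mul (mul_le_mul_of_nonneg_left (hk m) hC)
        (pow_le_pow_left₀ hs.le hsr.le _) (by positivity) (by positivity)
    _ = _ := by ring

lemma GeomBound.creR (h : GeomBound s X) (hs : 0 < s) (hsr : s < r) : GeomBound r (creR X) := by
  obtain ⟨C, hC, hb⟩ := h
  obtain ⟨K, hK, hk⟩ := shift_down_bound hs hsr
  have hr : 0 < r := hs.trans hsr
  refine ⟨C * K, by positivity, fun m n => ?_⟩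
  rw [OneMode.creR, norm_mul, norm_nsqrt]
  calc _ ≤ Real.sqrt (n + 1 : ℕ) * (C * (s ^ m * s ^ (n + 1))) := by gcongr; exact hb _ _
    _ = C * (Real.sqrt (n + 1 : ℕ) * s ^ (n + 1)) * s ^ m := by ring
    _ ≤ C * (K * r ^ n) * r ^ m := mul_le_mul (mul_le_mul_of_nonneg_left (hk n) hC)
        (pow_le_pow_left₀ hs.le hsr.le _) (by positivity) (by positivity)
    _ = _ := by ring

lemma GeomBound.creL (h : GeomBound s X) (hs : 0 < s) (hsr : s < r) : GeomBound r (creL X) := by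
  obtain ⟨C, hC, hb⟩ := h
  obtain ⟨K, hK, hk⟩ := shift_up_bound hs hsr
  have hr : 0 < r := hs.trans hsr
  refine ⟨C * K, by positivity, fun m n => ?_⟩
  rw [OneMode.creL, norm_mul, norm_nsqrt]
  calc _ ≤ Real.sqrt m * (C * (s ^ (m - 1) * s ^ n)) := by gcongr; exact hb _ _
    _ = C * (Real.sqrt m * s ^ (m - 1)) * s ^ n := by ring
    _ ≤ C * (K * r ^ m) * r ^ n := mul_le_mul (mul_le_mul_of_nonneg_left (hk m) hC)
        (pow_le_pow_left₀ hs.le hsr.le _) (by positivity) (by positivity)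
    _ = _ := by ring

lemma GeomBound.annR (h : GeomBound s X) (hs : 0 < s) (hsr : s < r) : GeomBound r (annR X) := by
  obtain ⟨C, hC, hb⟩ := h
  obtain ⟨K, hK, hk⟩ := shift_up_bound hs hsr
  have hr : 0 < r := hs.trans hsr
  refine ⟨C * K, by positivity, fun m n => ?_⟩
  rw [OneMode.annR, norm_mul, norm_nsqrt]
  calc _ ≤ Real.sqrt n * (C * (s ^ m * s ^ (n - 1))) := by gcongr; exact hb _ _
    _ = C * (Real.sqrt n * s ^ (n - 1)) * s ^ m := by ring
    _ ≤ C * (K * r ^ n) * r ^ m := mul_le_mul (mul_le_mul_of_nonneg_left (hk n) hC)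
        (pow_le_pow_left₀ hs.le hsr.le _) (by positivity) (by positivity)
    _ = _ := by ring

/-- Matrices with geometrically decaying entries. -/
def GeomDecay (X : Matrix ℕ ℕ ℂ) : Prop := ∃ y : ℝ, 0 < y ∧ y < 1 ∧ GeomBound y X

/-- Matrices whose entries grow more slowly than every geometric sequence. -/
def Tempered (X : Matrix ℕ ℕ ℂ) : Prop := ∀ r : ℝ, 1 < r → GeomBound r X

lemma GeomDecay.tempered (h : GeomDecay X) : Tempered X := by
  obtain ⟨y, h0, h1, hb⟩ := h
  exact fun r hr => hb.mono h0.le (by linarith)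

lemma GeomDecay.add (h : GeomDecay X) (h' : GeomDecay Y) : GeomDecay (X + Y) := by
  obtain ⟨y, h0, h1, hb⟩ := h
  obtain ⟨y', h0', h1', hb'⟩ := h'
  exact ⟨max y y', lt_max_of_lt_left h0, max_lt h1 h1',
    (hb.mono h0.le (le_max_left _ _)).add (hb'.mono h0'.le (le_max_right _ _))⟩

lemma GeomDecay.smul (h : GeomDecay X) (c : ℂ) : GeomDecay (c • X) := by
  obtain ⟨y, h0, h1, hb⟩ := h
  exact ⟨y, h0, h1, hb.smul c⟩

lemma GeomDecay.sub (h : GeomDecay X) (h' : GeomDecay Y) : GeomDecay (X - Y) := by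
  have := h.add (h'.smul (-1))
  rwa [neg_one_smul, ← sub_eq_add_neg] at this

lemma GeomDecay.of_geomBound (h : GeomDecay X)
    (hY : ∀ s r : ℝ, GeomBound s X → 0 < s → s < r → GeomBound r Y) : GeomDecay Y := by
  obtain ⟨y, h0, h1, hb⟩ := h
  exact ⟨(y + 1) / 2, by linarith, by linarith, hY y _ hb h0 (by linarith)⟩

lemma GeomDecay.annL (h : GeomDecay X) : GeomDecay (annL X) :=
  h.of_geomBound fun _ _ h hs hsr => h.annL hs hsr

lemma GeomDecay.annR (h : GeomDecay X) : GeomDecay (annR X) :=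
  h.of_geomBound fun _ _ h hs hsr => h.annR hs hsr

lemma GeomDecay.creL (h : GeomDecay X) : GeomDecay (creL X) :=
  h.of_geomBound fun _ _ h hs hsr => h.creL hs hsr

lemma GeomDecay.creR (h : GeomDecay X) : GeomDecay (creR X) :=
  h.of_geomBound fun _ _ h hs hsr => h.creR hs hsr

lemma Tempered.of_geomBound (h : Tempered X)
    (hY : ∀ s r : ℝ, GeomBound s X → 0 < s → s < r → GeomBound r Y) : Tempered Y := fun r hr =>
  hY ((1 + r) / 2) r (h _ (by linarith)) (by linarith) (by linarith)

lemma Tempered.annR (h : Tempered X) : Tempered (annR X) :=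
  h.of_geomBound fun _ _ h hs hsr => h.annR hs hsr

lemma Tempered.creL (h : Tempered X) : Tempered (creL X) :=
  h.of_geomBound fun _ _ h hs hsr => h.creL hs hsr

lemma Tempered.smul (h : Tempered X) (c : ℂ) : Tempered (c • X) := fun r hr => (h r hr).smul c

lemma tempered_displacement (z : ℂ) : Tempered (displacement z) := by
  intro r hr
  refine ⟨1, zero_le_one, fun m n => ?_⟩
  rw [displacement_apply, one_mul]
  exact (norm_dispKer_le_one z m n).trans
    (one_le_mul_of_one_le_of_one_le (one_le_pow₀ hr.le) (one_le_pow₀ hr.le))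

/-- The trace `Tr XY`, as an unordered double sum. -/
noncomputable def trMul (X Y : Matrix ℕ ℕ ℂ) : ℂ := ∑' p : ℕ × ℕ, X p.1 p.2 * Y p.2 p.1

lemma summable_geometric_prod (hy : 0 ≤ y) (hy1 : y < 1) :
    Summable fun p : ℕ × ℕ => y ^ p.1 * y ^ p.2 :=
  (summable_geometric_of_lt_one hy hy1).mul_of_nonneg (summable_geometric_of_lt_one hy hy1)
    (fun _ => pow_nonneg hy _) fun _ => pow_nonneg hy _

lemma summable_trMul (hX : GeomDecay X) (hY : Tempered Y) :
    Summable fun p : ℕ × ℕ => X p.1 p.2 * Y p.2 p.1 := by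
  obtain ⟨y, h0, h1, C, hC, hb⟩ := hX
  -- Any rate with `1 < r < 1/y` works.
  set r := (1 + y⁻¹) / 2 with hr
  have hyi : 1 < y⁻¹ := (one_lt_inv₀ h0).2 h1
  have hr1 : 1 < r := by linarith
  have hyr : y * r < 1 := by
    rw [hr, ← mul_div_assoc, mul_add, mul_inv_cancel₀ h0.ne']
    linarith
  obtain ⟨C', hC', hb'⟩ := hY r hr1
  have hyr0 : 0 ≤ y * r := by positivity
  refine Summable.of_norm_bounded ((summable_geometric_prod hyr0 hyr).mul_left (C * C'))
    fun p => ?_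
  rw [norm_mul]
  calc _ ≤ C * (y ^ p.1 * y ^ p.2) * (C' * (r ^ p.2 * r ^ p.1)) :=
        mul_le_mul (hb _ _) (hb' _ _) (norm_nonneg _) (by positivity)
    _ = _ := by rw [mul_pow, mul_pow]; ring

lemma opTr_opMul (hX : GeomDecay X) (hY : Tempered Y) : opTr (X ⊡ Y) = trMul X Y :=
  ((summable_trMul hX hY).tsum_prod).symm

lemma trMul_comm (X Y : Matrix ℕ ℕ ℂ) : trMul X Y = trMul Y X := by
  rw [trMul, trMul, ← (Equiv.prodComm ℕ ℕ).tsum_eq]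
  refine tsum_congr fun p => ?_
  simp only [Equiv.prodComm_apply, Prod.fst_swap, Prod.snd_swap]
  rw [mul_comm]

lemma trMul_add_left (hX : GeomDecay X) (hZ : GeomDecay Z) (hY : Tempered Y) :
    trMul (X + Z) Y = trMul X Y + trMul Z Y := by
  rw [trMul, trMul, trMul, ← (summable_trMul hX hY).tsum_add (summable_trMul hZ hY)]
  refine tsum_congr fun p => ?_
  rw [Matrix.add_apply, add_mul]

lemma trMul_add_right (hX : GeomDecay X) (hY : Tempered Y) (hZ : Tempered Z) :
    trMul X (Y + Z) = trMul X Y + trMul X Z := by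
  rw [trMul, trMul, trMul, ← (summable_trMul hX hY).tsum_add (summable_trMul hX hZ)]
  refine tsum_congr fun p => ?_
  rw [Matrix.add_apply, mul_add]

lemma trMul_smul_left (c : ℂ) (X Y : Matrix ℕ ℕ ℂ) : trMul (c • X) Y = c * trMul X Y := by
  rw [trMul, trMul, ← tsum_mul_left]
  exact tsum_congr fun p => by rw [Matrix.smul_apply, smul_eq_mul, mul_assoc]

lemma trMul_smul_right (c : ℂ) (X Y : Matrix ℕ ℕ ℂ) : trMul X (c • Y) = c * trMul X Y := by
  rw [trMul_comm, trMul_smul_left, trMul_comm]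

lemma trMul_sub_left (hX : GeomDecay X) (hZ : GeomDecay Z) (hY : Tempered Y) :
    trMul (X - Z) Y = trMul X Y - trMul Z Y := by
  rw [sub_eq_add_neg, ← neg_one_smul ℂ Z, trMul_add_left hX (hZ.smul _) hY, trMul_smul_left]
  ring

lemma trMul_sub_right (hX : GeomDecay X) (hY : Tempered Y) (hZ : Tempered Z) :
    trMul X (Y - Z) = trMul X Y - trMul X Z := by
  rw [sub_eq_add_neg, ← neg_one_smul ℂ Z, trMul_add_right hX hY (hZ.smul _), trMul_smul_right]
  ring

/-- Cyclicity of the trace by shifting the row index. The row missed by the shift has the factor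
`nsqrt 0`, so the identity needs no summability. -/
lemma trMul_annL (X Y : Matrix ℕ ℕ ℂ) : trMul (annL X) Y = trMul X (annR Y) := by
  have hi : Function.Injective fun p : ℕ × ℕ => (p.1 + 1, p.2) := by
    rintro ⟨a, b⟩ ⟨c, d⟩ h
    simpa using h
  rw [trMul, trMul, ← hi.tsum_eq (f := fun p => X p.1 p.2 * annR Y p.2 p.1)]
  · refine tsum_congr fun p => ?_
    simp only [annL, annR, Nat.add_sub_cancel]
    ring
  · rintro ⟨m, n⟩ h
    rcases m with _ | m
    · simp [annR] at h
    · exact ⟨(m, n), rfl⟩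

lemma trMul_creL (X Y : Matrix ℕ ℕ ℂ) : trMul (creL X) Y = trMul X (creR Y) := by
  have hi : Function.Injective fun p : ℕ × ℕ => (p.1 + 1, p.2) := by
    rintro ⟨a, b⟩ ⟨c, d⟩ h
    simpa using h
  rw [trMul, trMul, ← hi.tsum_eq]
  · refine tsum_congr fun p => ?_
    simp only [creL, creR, Nat.add_sub_cancel]
    ring
  · rintro ⟨m, n⟩ h
    rcases m with _ | m
    · simp [creL] at h
    · exact ⟨(m, n), rfl⟩

lemma trMul_annR (X Y : Matrix ℕ ℕ ℂ) : trMul (annR X) Y = trMul X (annL Y) := by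
  rw [trMul_comm, ← trMul_annL, trMul_comm]

lemma trMul_creR (X Y : Matrix ℕ ℕ ℂ) : trMul (creR X) Y = trMul X (creL Y) := by
  rw [trMul_comm, ← trMul_creL, trMul_comm]

end

/-! ### Commutation relations -/

lemma annL_creR (X : Matrix ℕ ℕ ℂ) : annL (creR X) = creR (annL X) := by
  ext m n
  simp only [annL, creR]
  ring

lemma creL_creR (X : Matrix ℕ ℕ ℂ) : creL (creR X) = creR (creL X) := by
  ext m n
  simp only [creL, creR]
  ring

lemma annL_creL (X : Matrix ℕ ℕ ℂ) : annL (creL X) = creL (annL X) + X := by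
  ext m n
  rcases m with _ | m
  · simp [annL, creL]
  · simp only [annL, creL, Matrix.add_apply, Nat.add_sub_cancel, ← mul_assoc, nsqrt_mul_self]
    push_cast
    ring

lemma creR_annR (X : Matrix ℕ ℕ ℂ) : creR (annR X) = annR (creR X) + X := by
  ext m n
  rcases n with _ | n
  · simp [annR, creR]
  · simp only [annR, creR, Matrix.add_apply, Nat.add_sub_cancel, ← mul_assoc, nsqrt_mul_self]
    push_cast
    ring

lemma annL_displacement (z : ℂ) :
    annL (displacement z) = annR (displacement z) + z • displacement z := by
  ext m n
  simp only [annL, annR, Matrix.add_apply, Matrix.smul_apply, smul_eq_mul, displacement_apply]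
  rw [dispKer_annL, add_comm]

lemma creR_displacement (z : ℂ) :
    creR (displacement z) = creL (displacement z) - conj z • displacement z := by
  ext m n
  simp only [creL, creR, Matrix.sub_apply, Matrix.smul_apply, smul_eq_mul, displacement_apply]
  exact dispKer_creR z (conj z) m n

section

variable {X : Matrix ℕ ℕ ℂ}

lemma trMul_annR_displacement (hX : GeomDecay X) (z : ℂ) : trMul (annR X) (displacement z) =
    trMul (annL X) (displacement z) + z * trMul X (displacement z) := by
  have hD := tempered_displacement z
  rw [trMul_annR, annL_displacement, trMul_add_right hX hD.annR (hD.smul _), trMul_annL,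
    trMul_smul_right]

lemma trMul_creL_displacement (hX : GeomDecay X) (z : ℂ) : trMul (creL X) (displacement z) =
    trMul (creR X) (displacement z) - conj z * trMul X (displacement z) := by
  have hD := tempered_displacement z
  rw [trMul_creL, creR_displacement, trMul_sub_right hX hD.creL (hD.smul _), trMul_creR,
    trMul_smul_right]

lemma charFn_eq_trMul (hX : GeomDecay X) (z : ℂ) : charFn X z = trMul X (displacement z) :=
  opTr_opMul hX (tempered_displacement z)

variable {k : ℝ} {l g : ℂ}

/-- Under the trace against `D(z)`, commutators with `a` and `a†` become multiplication by `z` and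
`z̄`, so the relation can be solved for `Tr Xa†D`. -/
lemma GaussRel.trMul_creR_displacement (h : GaussRel k l g X) (hX : GeomDecay X) (z : ℂ) :
    trMul (creR X) (displacement z) =
      (-(k - 1 / 2) * conj z - conj l * z + g) * charFn X z := by
  have hD := tempered_displacement z
  have e := congrArg (fun M => trMul M (displacement z)) h.rel_cre
  simp only [← neg_smul] at e
  rw [trMul_add_left (((hX.creR.sub hX.creL).smul _).sub ((hX.annR.sub hX.annL).smul _))
    (hX.smul _) hD, trMul_sub_left ((hX.creR.sub hX.creL).smul _) ((hX.annR.sub hX.annL).smul _) hD,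
    trMul_smul_left, trMul_smul_left, trMul_smul_left, trMul_smul_left,
    trMul_add_left hX.creR hX.creL hD, trMul_sub_left hX.annR hX.annL hD,
    trMul_sub_left hX.creR hX.creL hD, trMul_annR_displacement hX, trMul_creL_displacement hX] at e
  rw [charFn_eq_trMul hX]
  linear_combination e

lemma creR_add (X Y : Matrix ℕ ℕ ℂ) : creR (X + Y) = creR X + creR Y := by
  ext m n; simp [creR, mul_add]

lemma creR_sub (X Y : Matrix ℕ ℕ ℂ) : creR (X - Y) = creR X - creR Y := by
  ext m n; simp [creR, mul_sub]

/-- The characteristic function of `aXa†`. -/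
theorem GaussRel.charFn_annL_creR (h : GaussRel k l g X) (hX : GeomDecay X) (z : ℂ) :
    charFn (annL (creR X)) z = ((k - 1 / 2) + ((k - 1 / 2) * z + l * conj z + conj g) *
      (g - (k - 1 / 2) * conj z - conj l * z)) * charFn X z := by
  have hD := tempered_displacement z
  have hM := hX.creR
  -- The first relation multiplied by `a†` on the right: reordering `Xaa†` as `(Xa†)a + X` produces
  -- the constant `k - 1/2`, and the remaining terms involve only `Tr Xa†D`.
  have e := congrArg creR h.rel_ann
  simp only [creR_add, creR_sub, creR_smul, creR_annR, ← annL_creR, ← creL_creR] at e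
  have e := congrArg (fun M => trMul M (displacement z)) e
  rw [trMul_add_left ((((hM.annR.add hX).sub hM.annL).smul _).add ((hM.creR.sub hM.creL).smul _))
    (hM.smul _) hD, trMul_add_left (((hM.annR.add hX).sub hM.annL).smul _)
    ((hM.creR.sub hM.creL).smul _) hD,
    trMul_smul_left, trMul_smul_left, trMul_smul_left, trMul_smul_left,
    trMul_add_left (hM.annR.add hX) hM.annL hD, trMul_sub_left (hM.annR.add hX) hM.annL hD,
    trMul_add_left hM.annR hX hD, trMul_sub_left hM.creR hM.creL hD, trMul_annR_displacement hM,
    trMul_creL_displacement hM, h.trMul_creR_displacement hX, ← charFn_eq_trMul hX] at e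
  rw [charFn_eq_trMul hM.annL]
  linear_combination e

end

/-! ### The photon-subtracted state -/

/-- The phase contributes `|c|² = 1`, so the subtracted state does not depend on `c`. -/
lemma lower_opMul_raise {c : ℂ} (hc : ‖c‖ = 1) (X : Matrix ℕ ℕ ℂ) :
    lower c ⊡ X ⊡ raise c = annL (creR X) := by
  have h1 : lower c = conj c • ann + (0 : ℂ) • annᴴ := by simp [lower]
  have h2 : raise c = (0 : ℂ) • ann + c • annᴴ := by simp [raise]
  rw [h1, h2, opMul_ladder_left, opMul_ladder_right, zero_smul, zero_smul, add_zero, zero_add,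
    creR_smul, smul_smul, Complex.mul_conj', hc, ← annL_creR]
  simp

/-- `aXa†` is the corner of `X` without the first row and column, scaled on both sides by the
diagonal matrix of the `√(n+1)`. -/
lemma posSemidef_annL_creR {X : Matrix ℕ ℕ ℂ} (hX : X.PosSemidef) :
    (annL (creR X)).PosSemidef := by
  classical
  have hS := hX.submatrix Nat.succ
  have hsymm : ∀ m n, conj (X n m) = X m n := fun m n => hX.isHermitian.apply m n
  constructor
  · ext m n
    simp only [Matrix.conjTranspose_apply, annL, creR, RCLike.star_def, map_mul, conj_nsqrt, hsymm]
    ring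
  · intro x
    have h := hS.2 (Finsupp.onFinset x.support (fun i => nsqrt (i + 1) * x i) (by
      intro i hi
      rw [Finsupp.mem_support_iff]
      exact right_ne_zero_of_mul hi))
    rw [Finsupp.onFinset_sum _ (by simp)] at h
    rw [Finsupp.sum]
    convert! h using 2 with i
    rw [Finsupp.onFinset_sum _ (by simp), Finsupp.sum]
    refine Finset.sum_congr rfl fun j _ => ?_
    simp only [annL, creR, Matrix.submatrix_apply, RCLike.star_def, map_mul, conj_nsqrt,
      Nat.succ_eq_add_one]
    ring

lemma posSemidef_eq_zero_of_diag {X : Matrix ℕ ℕ ℂ} (hX : X.PosSemidef)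
    (h : ∀ n, (X n n).re = 0) : X = 0 := by
  ext m n
  have h1 := norm_sq_entry_le hX m n
  rw [h m, zero_mul] at h1
  simpa using le_antisymm h1 (sq_nonneg _)

lemma summable_diag {X : Matrix ℕ ℕ ℂ} (hX : GeomDecay X) : Summable fun n => X n n := by
  obtain ⟨y, h0, h1, C, hC, hb⟩ := hX
  refine Summable.of_norm_bounded (g := fun n => C * (y ^ 2) ^ n)
    ((summable_geometric_of_lt_one (by positivity) (pow_lt_one₀ h0.le h1 two_ne_zero)).mul_left C)
    fun n => (hb n n).trans (le_of_eq ?_)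
  rw [← pow_mul, ← pow_add, two_mul]

lemma displacement_zero : displacement 0 = 1 := by
  ext m n
  rw [displacement_apply, map_zero, dispKer_at_zero]

lemma charFn_zero (X : Matrix ℕ ℕ ℂ) : charFn X 0 = opTr X := by
  rw [charFn, displacement_zero, opTr, opTr]
  refine tsum_congr fun n => ?_
  rw [opMul, tsum_eq_single n]
  · simp
  · intro k hk
    simp [hk]

lemma charFn_smul (c : ℂ) (X : Matrix ℕ ℕ ℂ) (z : ℂ) : charFn (c • X) z = c * charFn X z := by
  simp only [charFn, opTr, opMul, ← tsum_mul_left, Matrix.smul_apply, smul_eq_mul, mul_assoc]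

section

variable {k : ℝ} {l g : ℂ} {ρ : Matrix ℕ ℕ ℂ}

lemma GaussRel.opTr_annL_creR (h : GaussRel k l g ρ) (hG : GeomDecay ρ) (hρ : IsState ρ) :
    opTr (annL (creR ρ)) = ((k - 1 / 2 + ‖g‖ ^ 2 : ℝ) : ℂ) := by
  rw [← charFn_zero, h.charFn_annL_creR hG, charFn_zero, opTr, hρ.2.tsum_eq]
  push_cast
  rw [← Complex.conj_mul']
  simp

lemma opTr_re_pos {X : Matrix ℕ ℕ ℂ} (hX : X.PosSemidef) (hG : GeomDecay X) (h0 : X ≠ 0) :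
    0 < (opTr X).re := by
  have hs := (Complex.hasSum_re (summable_diag hG).hasSum)
  have hn : ∀ n, 0 ≤ (X n n).re := fun n => re_diag_nonneg hX n
  have hsum : (opTr X).re = ∑' n, (X n n).re := hs.tsum_eq.symm
  rw [hsum]
  refine lt_of_le_of_ne (tsum_nonneg hn) fun h => h0 (posSemidef_eq_zero_of_diag hX fun n => ?_)
  have := (hasSum_zero_iff_of_nonneg hn).1 (h ▸ hs.summable.hasSum)
  exact congrFun this n

/-- The trace `Tr aρa†`, the mean photon number of a Gaussian state. -/
noncomputable def photonNumber (k : ℝ) (g : ℂ) : ℝ := k - 1 / 2 + ‖g‖ ^ 2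

lemma GaussRel.photonNumber_pos (h : GaussRel k l g ρ) (hG : GeomDecay ρ) (hρ : IsState ρ)
    (h0 : annL (creR ρ) ≠ 0) : 0 < photonNumber k g := by
  have := opTr_re_pos (posSemidef_annL_creR hρ.1) hG.creR.annL h0
  rwa [h.opTr_annL_creR hG hρ, Complex.ofReal_re] at this

lemma GaussRel.photonSub_eq (h : GaussRel k l g ρ) (hG : GeomDecay ρ) (hρ : IsState ρ)
    {c : ℂ} (hc : ‖c‖ = 1) :
    photonSub c ρ = ((photonNumber k g : ℝ) : ℂ)⁻¹ • annL (creR ρ) := by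
  rw [photonSub, lower_opMul_raise hc, h.opTr_annL_creR hG hρ]
  rfl

lemma GaussRel.isState_photonSub (h : GaussRel k l g ρ) (hG : GeomDecay ρ) (hρ : IsState ρ)
    {c : ℂ} (hc : ‖c‖ = 1) (h0 : annL (creR ρ) ≠ 0) : IsState (photonSub c ρ) := by
  have hN := h.photonNumber_pos hG hρ h0
  rw [h.photonSub_eq hG hρ hc]
  constructor
  · refine (posSemidef_annL_creR hρ.1).smul ?_
    rw [← Complex.ofReal_inv]
    exact Complex.zero_le_real.2 (inv_nonneg.2 hN.le)
  · have h1 := (summable_diag hG.creR.annL).hasSum.mul_left ((photonNumber k g : ℝ) : ℂ)⁻¹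
    have h2 : ∑' n, annL (creR ρ) n n = ((photonNumber k g : ℝ) : ℂ) := h.opTr_annL_creR hG hρ
    rw [h2, inv_mul_cancel₀ (Complex.ofReal_ne_zero.2 hN.ne')] at h1
    exact h1

end

/-! ### The quadrature coherence scale -/

section

variable {k : ℝ} {l g : ℂ} {ρ : Matrix ℕ ℕ ℂ}

lemma inv_sqrt_two_sq : (((Real.sqrt 2 : ℝ) : ℂ)⁻¹) ^ 2 = 1 / 2 := by
  rw [inv_pow, ← Complex.ofReal_pow, Real.sq_sqrt two_pos.le]
  norm_num

lemma quad_eq (j : Fin 2) : ∃ α β : ℂ, quad j = α • ann + β • annᴴ := by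
  fin_cases j
  · exact ⟨_, _, smul_add _ _ _⟩
  · refine ⟨-Complex.I * ((Real.sqrt 2 : ℝ) : ℂ)⁻¹, -(-Complex.I * ((Real.sqrt 2 : ℝ) : ℂ)⁻¹), ?_⟩
    simp [quad, sub_eq_add_neg]

lemma comm_ladder (α β : ℂ) (X : Matrix ℕ ℕ ℂ) : comm X (α • ann + β • annᴴ) =
    α • (annR X - annL X) + β • (creR X - creL X) := by
  rw [comm, opMul_ladder_left, opMul_ladder_right]
  module

lemma comm_swap (X Y : Matrix ℕ ℕ ℂ) : comm X Y = -comm Y X := by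
  rw [comm, comm, neg_sub]

lemma GeomDecay.hasQCS (hG : GeomDecay ρ) : HasQCS ρ := by
  intro j
  obtain ⟨α, β, hq⟩ := quad_eq j
  rw [hq, comm_ladder]
  obtain ⟨y, h0, h1, C, hC, hb⟩ :=
    ((hG.annR.sub hG.annL).smul α).add ((hG.creR.sub hG.creL).smul β)
  refine Summable.of_nonneg_of_le (fun _ => sq_nonneg _) (fun p => ?_)
    ((summable_geometric_prod (sq_nonneg y) (pow_lt_one₀ h0.le h1 two_ne_zero)).mul_left (C ^ 2))
  refine (pow_le_pow_left₀ (norm_nonneg _) (hb p.1 p.2) 2).trans (le_of_eq ?_)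
  rw [← pow_mul, ← pow_mul]
  ring

lemma trMul_self_eq {X : Matrix ℕ ℕ ℂ} (hX : X.IsHermitian) :
    trMul X X = ((∑' p : ℕ × ℕ, ‖X p.1 p.2‖ ^ 2 : ℝ) : ℂ) := by
  rw [trMul, Complex.ofReal_tsum]
  refine tsum_congr fun p => ?_
  rw [← hX.apply p.2 p.1, RCLike.star_def, Complex.mul_conj']
  push_cast
  rfl

lemma trMul_self_re_pos {X : Matrix ℕ ℕ ℂ} (hX : X.IsHermitian) (hG : GeomDecay X)
    (h0 : X 0 0 ≠ 0) : 0 < (trMul X X).re := by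
  have hs : Summable fun p : ℕ × ℕ => ‖X p.1 p.2‖ ^ 2 := by
    refine (summable_trMul hG hG.tempered).norm.congr fun p => ?_
    rw [← hX.apply p.2 p.1, RCLike.star_def, norm_mul, RCLike.norm_conj, sq]
  rw [trMul_self_eq hX, Complex.ofReal_re]
  exact hs.tsum_pos (fun _ => sq_nonneg _) (0, 0) (by positivity)

/-- `C² = k / (2 (k² - |l|²))` in terms of the parameters of the characteristic function. -/
theorem GaussRel.qcsSq_eq (h : GaussRel k l g ρ) (hG : GeomDecay ρ) (hρ : IsState ρ)
    (h0 : ρ 0 0 ≠ 0) (hd : 0 < k ^ 2 - ‖l‖ ^ 2) :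
    qcsSq ρ = k / (2 * (k ^ 2 - ‖l‖ ^ 2)) := by
  have hT := hG.tempered
  set A := annR ρ - annL ρ with hA
  set B := creR ρ - creL ρ with hB
  have hAG : GeomDecay A := hG.annR.sub hG.annL
  have hBG : GeomDecay B := hG.creR.sub hG.creL
  set p := trMul ρ ρ with hp
  set t := trMul A B with ht
  set u := trMul B B with hu
  -- Both relations are paired with `B = [ρ, a†]`. Cyclicity leaves `0` for `ρ` and for the
  -- anticommutator with `a†`, and `-Tr ρ²` for the anticommutator with `a`, the latter from `[a,
  -- a†] = 1`.
  have e0 : trMul ρ B = 0 := by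
    rw [hB, trMul_sub_right hG hG.creR.tempered hG.creL.tempered, trMul_comm ρ (creR ρ), trMul_creR,
      sub_self]
  have e1 : trMul (annR ρ + annL ρ) B = -p := by
    rw [hB, trMul_add_left hG.annR hG.annL hBG.tempered,
      trMul_sub_right hG.annR hG.creR.tempered hG.creL.tempered,
      trMul_sub_right hG.annL hG.creR.tempered hG.creL.tempered,
      trMul_comm (annL ρ) (creL ρ), trMul_comm (annL ρ) (creR ρ), trMul_annR, trMul_annR,
      trMul_creR, trMul_creL, annL_creL, annL_creR,
      trMul_add_right hG hG.annL.creL.tempered hT]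
    ring
  have e2 : trMul (creR ρ + creL ρ) B = 0 := by
    rw [hB, trMul_add_left hG.creR hG.creL hBG.tempered,
      trMul_sub_right hG.creR hG.creR.tempered hG.creL.tempered,
      trMul_sub_right hG.creL hG.creR.tempered hG.creL.tempered,
      trMul_comm (creL ρ) (creR ρ), trMul_creR ρ (creR ρ), trMul_creL ρ (creL ρ), creL_creR]
    ring
  have r1 := congrArg (fun M => trMul M B) h.rel_ann
  have r2 := congrArg (fun M => trMul M B) h.rel_cre
  simp only [← neg_smul, ← hA, ← hB] at r1 r2
  rw [trMul_smul_left, e1, trMul_add_left ((hAG.smul _).add (hBG.smul _)) (hG.smul _) hBG.tempered,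
    trMul_add_left (hAG.smul _) (hBG.smul _) hBG.tempered, trMul_smul_left, trMul_smul_left,
    trMul_smul_left, e0] at r1
  rw [trMul_smul_left, e2, trMul_add_left ((hBG.smul _).sub (hAG.smul _)) (hG.smul _) hBG.tempered,
    trMul_sub_left (hBG.smul _) (hAG.smul _) hBG.tempered, trMul_smul_left, trMul_smul_left,
    trMul_smul_left, e0] at r2
  -- Elimination of `u = Tr B²` from the two linear equations.
  have hdet : ((k ^ 2 - ‖l‖ ^ 2 : ℝ) : ℂ) * t = -(k / 2 : ℝ) * p := by
    push_cast
    rw [← Complex.mul_conj']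
    linear_combination (-(k : ℂ)) * r1 - l * r2
  have hq0 : quad 0 = ((Real.sqrt 2 : ℝ) : ℂ)⁻¹ • ann + ((Real.sqrt 2 : ℝ) : ℂ)⁻¹ • annᴴ := by
    simp [quad]
  have hq1 : quad 1 = (-Complex.I * ((Real.sqrt 2 : ℝ) : ℂ)⁻¹) • ann +
      (Complex.I * ((Real.sqrt 2 : ℝ) : ℂ)⁻¹) • annᴴ := by
    simp [quad, sub_eq_add_neg]
  have hcomm : ∀ α β : ℂ, opTr (comm ρ (α • ann + β • annᴴ) ⊡ comm (α • ann + β • annᴴ) ρ) =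
      -(α ^ 2 * trMul A A + 2 * α * β * t + β ^ 2 * u) := by
    intro α β
    have hab := (hAG.smul α).add (hBG.smul β)
    rw [comm_swap (α • ann + β • annᴴ) ρ, comm_ladder, ← hA, ← hB, ← neg_one_smul ℂ (_ + _),
      opTr_opMul hab (hab.smul _).tempered, trMul_smul_right,
      trMul_add_left (hAG.smul _) (hBG.smul _) hab.tempered,
      trMul_add_right (hAG.smul _) (hAG.smul _).tempered (hBG.smul _).tempered,
      trMul_add_right (hBG.smul _) (hAG.smul _).tempered (hBG.smul _).tempered]
    simp only [trMul_smul_left, trMul_smul_right]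
    rw [trMul_comm B A]
    ring
  have hs := inv_sqrt_two_sq
  -- The coefficients of `x̂` and `p̂` differ by `±i`, so the `A²` and `B²` terms cancel and only
  -- the mixed trace survives.
  have hsum : opTr (comm ρ (quad 0) ⊡ comm (quad 0) ρ) + opTr (comm ρ (quad 1) ⊡ comm (quad 1) ρ)
      = -2 * t := by
    rw [hq0, hq1, hcomm, hcomm]
    have hI := Complex.I_sq
    linear_combination (-(2 * t + trMul A A + u) - Complex.I ^ 2 * trMul A A
      + 2 * Complex.I ^ 2 * t - Complex.I ^ 2 * u) * hs
      + (-(1 / 2) * trMul A A + t - (1 / 2) * u) * hI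
  have hpr : p = ((p.re : ℝ) : ℂ) := by
    rw [hp, trMul_self_eq hρ.1.isHermitian, Complex.ofReal_re]
  have hp0 : 0 < p.re := trMul_self_re_pos hρ.1.isHermitian hG h0
  have hpur : purity ρ = p.re := by
    rw [purity, opTr_opMul hG hT]
  have htr : (k ^ 2 - ‖l‖ ^ 2) * t.re = -(k / 2) * p.re := by
    rw [hpr] at hdet
    have := congrArg Complex.re hdet
    rw [Complex.re_ofReal_mul, ← Complex.ofReal_neg, Complex.re_ofReal_mul, Complex.ofReal_re] at this
    exact this
  rw [qcsSq, Fin.sum_univ_two, ← Complex.add_re, hsum, hpur]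
  have : (-2 * t).re = -2 * t.re := by simp
  rw [this]
  field_simp
  linear_combination -2 * htr

end

/-! ### Gaussian integrals and moments -/

section

variable {k : ℝ} {l : ℂ}

lemma integral_gaussian_line {b : ℝ} (hb : 0 < b) (t : ℝ) :
    ∃ r : ℝ, 0 < r ∧ ∫ x : ℝ, Complex.exp (Complex.I * t * x) * Complex.exp (-b * (x : ℂ) ^ 2) = r := by
  refine ⟨(Real.pi / b) ^ (1 / 2 : ℝ) * Real.exp (-t ^ 2 / (4 * b)), by positivity, ?_⟩
  rw [fourierIntegral_gaussian (by simpa using hb)]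
  push_cast
  rw [Complex.ofReal_cpow (by positivity)]
  push_cast
  rfl

lemma exists_norm_mul_sq (l : ℂ) : ∃ ε : ℂ, ‖ε‖ = 1 ∧ l = ‖l‖ * ε ^ 2 := by
  by_cases hl : l = 0
  · exact ⟨1, by simp, by simp [hl]⟩
  · obtain ⟨w, hw⟩ := IsAlgClosed.exists_pow_nat_eq (l / ‖l‖) two_pos
    have hn : (‖l‖ : ℂ) ≠ 0 := by simpa using hl
    refine ⟨w, ?_, ?_⟩
    · have h1 := congrArg norm hw
      rw [norm_pow, norm_div, Complex.norm_real, norm_norm, div_self (norm_ne_zero_iff.2 hl)] at h1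
      exact (pow_eq_one_iff_of_nonneg (norm_nonneg _) two_ne_zero).1 h1
    · rw [hw, mul_div_cancel₀ _ hn]

lemma integral_comp_rotation {ε : ℂ} (hε : ‖ε‖ = 1) (f : ℂ → ℂ) : ∫ z, f (ε * z) = ∫ z, f z := by
  have hmem : ε ∈ Submonoid.unitSphere ℂ := by simpa [Submonoid.unitSphere] using hε
  exact (rotation ⟨ε, hmem⟩).measurePreserving.integral_comp
    (rotation ⟨ε, hmem⟩).toHomeomorph.measurableEmbedding f

/-- The rotation `z ↦ εz` with `l = |l|ε²` diagonalises the quadratic form. As `az - āz̄` is purely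
imaginary, the integral splits into Fourier integrals of real Gaussians with coefficients `k + |l|`
and `k - |l|`, both positive. -/
lemma integral_gaussFn_pos (hl : ‖l‖ < k) (a : ℂ) :
    ∃ r : ℝ, 0 < r ∧ ∫ z, gaussFn k l a (-conj a) z = r := by
  obtain ⟨ε, hε, hle⟩ := exists_norm_mul_sq l
  obtain ⟨r₁, h₁, e₁⟩ := integral_gaussian_line (b := k + ‖l‖) (by linarith [norm_nonneg l])
    (2 * (a * ε).im)
  obtain ⟨r₂, h₂, e₂⟩ := integral_gaussian_line (b := k - ‖l‖) (by linarith) (2 * (a * ε).re)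
  refine ⟨r₁ * r₂, by positivity, ?_⟩
  rw [← integral_comp_rotation hε, ← Complex.volume_preserving_equiv_real_prod.symm.integral_comp',
    Complex.ofReal_mul, ← e₁, ← e₂, ← integral_prod_mul]
  refine integral_congr_ae (Filter.Eventually.of_forall fun p => ?_)
  obtain ⟨x, y⟩ := p
  have hz : Complex.measurableEquivRealProd.symm (x, y) = x + y * Complex.I := by
    rw [Complex.measurableEquivRealProd_symm_apply]
    exact Complex.mk_eq_add_mul_I x y
  have hcε : ε * conj ε = 1 := by
    rw [Complex.mul_conj', hε]
    simp
  have hcz : conj ((x : ℂ) + y * Complex.I) = x - y * Complex.I := by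
    simp [sub_eq_add_neg]
  have h1 := Complex.re_add_im (a * ε)
  have h2 : conj a * conj ε = (a * ε).re - (a * ε).im * Complex.I := by
    rw [← map_mul]
    nth_rewrite 1 [← h1]
    simp [sub_eq_add_neg]
  have h3 : conj l = ‖l‖ * conj ε ^ 2 := by
    nth_rewrite 1 [hle]
    simp
  beta_reduce
  rw [hz, gaussFn, map_mul, hcz, ← Complex.exp_add, ← Complex.exp_add, ← Complex.exp_add]
  congr 1
  rw [h3]
  have h4 : l * (conj ε * (↑x - ↑y * Complex.I)) ^ 2 =
      ‖l‖ * (ε * conj ε) ^ 2 * (↑x - ↑y * Complex.I) ^ 2 := by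
    nth_rewrite 1 [hle]
    ring
  rw [h4, hcε]
  push_cast
  have hI := Complex.I_sq
  linear_combination (-(k : ℂ) * (x ^ 2 - y ^ 2 * Complex.I ^ 2)
    - (‖l‖ : ℂ) / 2 * (x + y * Complex.I) ^ 2 * (ε * conj ε + 1)) * hcε
    - (x + y * Complex.I) * h1 - (x - y * Complex.I) * h2 + ((k : ℂ) - ‖l‖) * y ^ 2 * hI

/-- Integrating the Wirtinger derivatives of `G`, `zG` and `z̄G` to zero gives linear equations for
the moments, with determinant `k² - |l|²`; the normalisation `I` is never evaluated. -/
lemma gaussFn_moments (hl : ‖l‖ < k) (b : ℂ) :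
    let G := gaussFn k l (-conj b) b
    let d : ℂ := ((k ^ 2 - ‖l‖ ^ 2 : ℝ) : ℂ)
    let μ : ℂ := (k * b + l * conj b) / d
    let I := ∫ z, G z
    ∫ z, z * G z = μ * I ∧ ∫ z, conj z * G z = -conj μ * I ∧
    ∫ z, z * (z * G z) = (μ ^ 2 - l / d) * I ∧
    ∫ z, z * (conj z * G z) = (k / d - μ * conj μ) * I ∧
    ∫ z, conj z * (conj z * G z) = (conj μ ^ 2 - conj l / d) * I := by
  intro G d μ I
  have hG : GaussDecay G := gaussDecay_gaussFn hl _ _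
  have hi := Tame.id
  have hz := hi.mul_gaussDecay hG
  have hb := hi.conj.mul_gaussDecay hG
  have hzz := hi.mul_gaussDecay hz
  have hzb := hi.mul_gaussDecay hb
  have hbb := hi.conj.mul_gaussDecay hb
  have hw : ∀ z, HasWirt G ((-conj l) * (z * G z) + ((-k) * (conj z * G z) + (-conj b) * G z))
      ((-k) * (z * G z) + ((-l) * (conj z * G z) + b * G z)) z := fun z =>
    (hasWirt_gaussFn k l (-conj b) b z).congr_deriv (by ring) (by ring)
  have hwz : ∀ z, HasWirt (fun z => z * G z)
      (G z + ((-conj l) * (z * (z * G z)) + ((-k) * (z * (conj z * G z)) + (-conj b) * (z * G z))))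
      ((-k) * (z * (z * G z)) + ((-l) * (z * (conj z * G z)) + b * (z * G z))) z := fun z =>
    ((HasWirt.id z).mul (hw z)).congr_deriv (by ring) (by ring)
  have hwb : ∀ z, HasWirt (fun z => conj z * G z)
      ((-conj l) * (z * (conj z * G z)) + ((-k) * (conj z * (conj z * G z))
        + (-conj b) * (conj z * G z)))
      (G z + ((-k) * (z * (conj z * G z)) + ((-l) * (conj z * (conj z * G z))
        + b * (conj z * G z)))) z := fun z =>
    ((HasWirt.id z).conj.mul (hw z)).congr_deriv (by simp only [map_zero]; ring)
      (by simp only [map_one]; ring)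
  have hlin : ∀ {f₁ f₂ f₃ : ℂ → ℂ} (_ : GaussDecay f₁) (_ : GaussDecay f₂) (_ : GaussDecay f₃)
      (c₁ c₂ c₃ : ℂ), ∫ z, (c₁ * f₁ z + (c₂ * f₂ z + c₃ * f₃ z)) =
        c₁ * (∫ z, f₁ z) + (c₂ * (∫ z, f₂ z) + c₃ * (∫ z, f₃ z)) := by
    intro f₁ f₂ f₃ g₁ g₂ g₃ c₁ c₂ c₃
    rw [integral_add (g₁.const_mul _).integrable ((g₂.const_mul _).add (g₃.const_mul _)).integrable,
      integral_add (g₂.const_mul _).integrable (g₃.const_mul _).integrable, integral_const_mul,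
      integral_const_mul, integral_const_mul]
  have hcl : ∀ {f₁ f₂ f₃ : ℂ → ℂ} (_ : GaussDecay f₁) (_ : GaussDecay f₂) (_ : GaussDecay f₃)
      (c₁ c₂ c₃ : ℂ), GaussDecay fun z => (c₁ * f₁ z + (c₂ * f₂ z + c₃ * f₃ z)) :=
    fun g₁ g₂ g₃ c₁ c₂ c₃ => (g₁.const_mul _).add ((g₂.const_mul _).add (g₃.const_mul _))
  obtain ⟨e1, e2⟩ := integral_wirt_eq_zero hw hG (hcl hz hb hG _ _ _) (hcl hz hb hG _ _ _)
  obtain ⟨e3, e4⟩ := integral_wirt_eq_zero hwz hz (hG.add (hcl hzz hzb hz _ _ _))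
    (hcl hzz hzb hz _ _ _)
  have e5 := (integral_wirt_eq_zero hwb hb (hcl hzb hbb hb _ _ _)
    (hG.add (hcl hzb hbb hb _ _ _))).1
  rw [hlin hz hb hG] at e1 e2
  rw [integral_add hG.integrable (hcl hzz hzb hz _ _ _).integrable, hlin hzz hzb hz] at e3
  rw [hlin hzz hzb hz] at e4
  rw [hlin hzb hbb hb] at e5
  have hd0 : (k ^ 2 - ‖l‖ ^ 2 : ℝ) ≠ 0 := by
    have := norm_nonneg l
    have h : 0 < (k - ‖l‖) * (k + ‖l‖) := mul_pos (by linarith) (by linarith)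
    nlinarith
  have hd : d ≠ 0 := Complex.ofReal_ne_zero.2 hd0
  have hdv : d = k ^ 2 - l * conj l := by
    simp only [d]
    rw [Complex.mul_conj']
    push_cast
    rfl
  have hdc : conj d = d := Complex.conj_ofReal _
  have hμ : d * μ = k * b + l * conj b := mul_div_cancel₀ _ hd
  have hμc : d * conj μ = k * conj b + conj l * b := by
    have := congrArg conj hμ
    simpa [hdc] using this
  have m1 : ∫ z, z * G z = μ * I := by
    refine mul_left_cancel₀ hd ?_
    linear_combination (∫ z, z * G z) * hdv - (k : ℂ) * e2 + l * e1 - I * hμ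
  have m1' : ∫ z, conj z * G z = -conj μ * I := by
    refine mul_left_cancel₀ hd ?_
    linear_combination (∫ z, conj z * G z) * hdv - (k : ℂ) * e1 + conj l * e2 + I * hμc
  have hld : d * (l / d) = l := mul_div_cancel₀ _ hd
  have hlcd : d * (conj l / d) = conj l := mul_div_cancel₀ _ hd
  have hkd : d * (k / d) = k := mul_div_cancel₀ _ hd
  rw [m1] at e3 e4
  rw [m1'] at e5
  refine ⟨m1, m1', ?_, ?_, ?_⟩
  · refine mul_left_cancel₀ hd ?_
    linear_combination (∫ z, z * (z * G z)) * hdv - (k : ℂ) * e4 + l * e3 - I * μ * hμ + I * hld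
  · refine mul_left_cancel₀ hd ?_
    linear_combination (∫ z, z * (conj z * G z)) * hdv - (k : ℂ) * e3 + conj l * e4
      + I * μ * hμc - I * hkd
  · have hq : ∫ z, z * (conj z * G z) = (k / d - μ * conj μ) * I := by
      refine mul_left_cancel₀ hd ?_
      linear_combination (∫ z, z * (conj z * G z)) * hdv - (k : ℂ) * e3 + conj l * e4
        + I * μ * hμc - I * hkd
    -- With the mixed moment known, `e5` alone gives the remaining one, whose coefficient there is
    -- `k`.
    have hk0 : (k : ℂ) ≠ 0 := Complex.ofReal_ne_zero.2 (by linarith [norm_nonneg l])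
    refine mul_left_cancel₀ (mul_ne_zero hk0 hd) ?_
    rw [hq] at e5
    linear_combination -d * e5 - conj l * I * hkd + (k : ℂ) * I * hlcd
      - conj μ * I * (k : ℂ) * hμc + conj l * conj μ * I * hμ + I * conj μ * conj b * hdv

end

/-! ### The Wigner function of the photon-subtracted state -/

section

variable {k : ℝ} {l g : ℂ} {ρ : Matrix ℕ ℕ ℂ}

lemma sq_sub_normSq_pos (hl : ‖l‖ < k) : 0 < k ^ 2 - ‖l‖ ^ 2 := by
  have := norm_nonneg l
  have h : 0 < (k - ‖l‖) * (k + ‖l‖) := mul_pos (by linarith) (by linarith)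
  nlinarith

lemma GaussRel.charFn_photonSub (h : GaussRel k l g ρ) (hG : GeomDecay ρ) (hρ : IsState ρ)
    (hχ : charFn ρ = gaussFn k l g (-conj g)) {c : ℂ} (hc : ‖c‖ = 1) (z : ℂ) :
    charFn (photonSub c ρ) z = ((photonNumber k g : ℝ) : ℂ)⁻¹ *
      (((k - 1 / 2) + ((k - 1 / 2) * z + l * conj z + conj g) *
      (g - (k - 1 / 2) * conj z - conj l * z)) * gaussFn k l g (-conj g) z) := by
  rw [h.photonSub_eq hG hρ hc, charFn_smul, h.charFn_annL_creR hG, hχ]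

lemma GaussRel.integrable_charFn_photonSub (h : GaussRel k l g ρ) (hG : GeomDecay ρ)
    (hρ : IsState ρ) (hχ : charFn ρ = gaussFn k l g (-conj g)) (hl : ‖l‖ < k)
    {c : ℂ} (hc : ‖c‖ = 1) : Integrable (charFn (photonSub c ρ)) := by
  have hi := Tame.id
  have hT : Tame fun z => (k - 1 / 2 : ℂ) + ((k - 1 / 2) * z + (l * conj z + conj g)) *
      (g + (-(k - 1 / 2) * conj z + (-conj l) * z)) :=
    (Tame.const _).add (((hi.const_mul _).add ((hi.conj.const_mul _).add (Tame.const _))).mul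
      ((Tame.const _).add ((hi.conj.const_mul _).add (hi.const_mul _))))
  have hD := (hT.mul_gaussDecay (gaussDecay_gaussFn hl g (-conj g))).const_mul
    ((photonNumber k g : ℝ) : ℂ)⁻¹
  refine hD.integrable.congr (Filter.Eventually.of_forall fun z => ?_)
  rw [h.charFn_photonSub hG hρ hχ hc]
  ring

/-- The Wigner function of the photon-subtracted state at `α = kμ - lμ̄ + ḡ`. -/
theorem GaussRel.wigner_photonSub (h : GaussRel k l g ρ) (hG : GeomDecay ρ) (hρ : IsState ρ)
    (hχ : charFn ρ = gaussFn k l g (-conj g)) (hl : ‖l‖ < k)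
    (hN : 0 < photonNumber k g) {c : ℂ} (hc : ‖c‖ = 1) (μ : ℂ) :
    ∃ r : ℝ, 0 < r ∧ wigner (photonSub c ρ) (k * μ - l * conj μ + conj g) =
      ((r * (‖(k - 1 / 2) * μ - l * conj μ + conj g‖ ^ 2 +
        (1 - k / (2 * (k ^ 2 - ‖l‖ ^ 2))) / 2) : ℝ) : ℂ) := by
  set b := k * μ - l * conj μ with hb
  set G := gaussFn k l (-conj b) b with hGd
  have hGG : GaussDecay G := gaussDecay_gaussFn hl _ _
  have hd0 := sq_sub_normSq_pos hl
  obtain ⟨r, hr, hI⟩ := integral_gaussFn_pos hl (-conj b)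
  have hbb : -conj (-conj b) = b := by simp
  rw [hbb, ← hGd] at hI
  set N := photonNumber k g with hNd
  refine ⟨(Real.pi ^ 2)⁻¹ * (N⁻¹ * r), by positivity, ?_⟩
  -- The displacement of `α` by `ḡ` cancels the linear term of `χ` in the Fourier kernel.
  have hshift : ∀ z, gaussFn k l g (-conj g) z *
      Complex.exp (conj z * (b + conj g) - z * conj (b + conj g)) = G z := by
    intro z
    rw [hGd, gaussFn, gaussFn, ← Complex.exp_add]
    congr 1
    simp only [map_add, Complex.conj_conj]
    ring
  have hd : ((k ^ 2 - ‖l‖ ^ 2 : ℝ) : ℂ) ≠ 0 := Complex.ofReal_ne_zero.2 hd0.ne'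
  have hdv : ((k ^ 2 - ‖l‖ ^ 2 : ℝ) : ℂ) = k ^ 2 - l * conj l := by
    rw [Complex.mul_conj']
    push_cast
    rfl
  obtain ⟨m1, m1', m2, m11, m2'⟩ := gaussFn_moments hl b
  -- The reason for parametrising `α` by `μ`: it is the normalised first moment of the shifted
  -- Gaussian, so that the polynomial integrates without inverting `(k, l)`.
  have hμ : (k * b + l * conj b) / ((k ^ 2 - ‖l‖ ^ 2 : ℝ) : ℂ) = μ := by
    rw [div_eq_iff hd, hdv, hb]
    simp only [map_sub, map_mul, Complex.conj_ofReal, Complex.conj_conj]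
    ring
  rw [← hGd, hI] at m1 m1' m2 m11 m2'
  rw [hμ] at m1 m1' m2 m11 m2'
  have hi := Tame.id
  have dz := hi.mul_gaussDecay hGG
  have db := hi.conj.mul_gaussDecay hGG
  have dzz := hi.mul_gaussDecay dz
  have dzb := hi.mul_gaussDecay db
  have dbb := hi.conj.mul_gaussDecay db
  set η : ℂ := k - 1 / 2 with hη
  have hint : ∫ z, charFn (photonSub c ρ) z *
      Complex.exp (conj z * (b + conj g) - z * conj (b + conj g)) = (N : ℂ)⁻¹ *
      ((η + conj g * g) * r + ((η * g - conj g * conj l) * (μ * r) +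
      ((l * g - conj g * η) * (-conj μ * r) + ((-(η * conj l)) * ((μ ^ 2 - l /
        ((k ^ 2 - ‖l‖ ^ 2 : ℝ) : ℂ)) * r) +
      ((-(η ^ 2) - l * conj l) * ((k / ((k ^ 2 - ‖l‖ ^ 2 : ℝ) : ℂ) - μ * conj μ) * r) +
      (-(l * η)) * ((conj μ ^ 2 - conj l / ((k ^ 2 - ‖l‖ ^ 2 : ℝ) : ℂ)) * r)))))) := by
    rw [← m1, ← m1', ← m2, ← m11, ← m2', ← hI]
    simp only [← integral_const_mul]
    have d6 := dbb.const_mul (-(l * η))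
    have d5 := (dzb.const_mul (-(η ^ 2) - l * conj l)).add d6
    have d4 := (dzz.const_mul (-(η * conj l))).add d5
    have d3 := (db.const_mul (l * g - conj g * η)).add d4
    have d2 := (dz.const_mul (η * g - conj g * conj l)).add d3
    have d1 := (hGG.const_mul (η + conj g * g)).add d2
    rw [← integral_add (dzb.const_mul _).integrable d6.integrable,
      ← integral_add (dzz.const_mul _).integrable d5.integrable,
      ← integral_add (db.const_mul _).integrable d4.integrable,
      ← integral_add (dz.const_mul _).integrable d3.integrable,
      ← integral_add (hGG.const_mul _).integrable d2.integrable, ← integral_const_mul]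
    refine integral_congr_ae (Filter.Eventually.of_forall fun z => ?_)
    beta_reduce
    rw [h.charFn_photonSub hG hρ hχ hc, ← hshift z]
    ring
  rw [wigner, hint]
  have hnorm : ((‖η * μ - l * conj μ + conj g‖ ^ 2 : ℝ) : ℂ) =
      (η * μ - l * conj μ + conj g) * (η * conj μ - conj l * μ + g) := by
    rw [Complex.ofReal_pow, ← Complex.mul_conj']
    congr 1
    simp only [hη, map_add, map_sub, map_mul, Complex.conj_ofReal, map_div₀, map_one, map_ofNat,
      Complex.conj_conj]
  have hC : (((1 - k / (2 * (k ^ 2 - ‖l‖ ^ 2))) / 2 : ℝ) : ℂ) =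
      (1 - k / (k ^ 2 - l * conj l) / 2) / 2 := by
    rw [← hdv, div_div, mul_comm _ (2 : ℂ)]
    push_cast
    rfl
  rw [Complex.ofReal_mul, Complex.ofReal_add, hnorm, hC, hdv]
  rw [hdv] at hd
  push_cast
  have hE := inv_mul_cancel₀ hd
  rw [hη]
  -- The variance terms add up to `(1 - k) - k/(4(k² - |l|²))`; with the constant `k - 1/2` they
  -- make `(1 - C²)/2`.
  linear_combination ((Real.pi : ℂ) ^ 2)⁻¹ * (N : ℂ)⁻¹ * r * (1 - k) * hE

lemma exists_eq_sub_conj (hd0 : k ^ 2 - ‖l‖ ^ 2 ≠ 0) (β : ℂ) :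
    ∃ μ : ℂ, β = k * μ - l * conj μ := by
  have hd : ((k ^ 2 - ‖l‖ ^ 2 : ℝ) : ℂ) ≠ 0 := Complex.ofReal_ne_zero.2 hd0
  have hdv : ((k ^ 2 - ‖l‖ ^ 2 : ℝ) : ℂ) = k ^ 2 - l * conj l := by
    rw [Complex.mul_conj']
    push_cast
    rfl
  refine ⟨(k * β + l * conj β) / ((k ^ 2 - ‖l‖ ^ 2 : ℝ) : ℂ), ?_⟩
  simp only [map_div₀, map_add, map_mul, Complex.conj_ofReal, Complex.conj_conj]
  rw [← mul_div_assoc, ← mul_div_assoc, ← sub_div, eq_div_iff hd, hdv]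
  ring

/-- For `|l| < k` the map `μ ↦ kμ - lμ̄ + ḡ` reaches every point of phase space. -/
theorem GaussRel.wignerPositive_iff (h : GaussRel k l g ρ) (hG : GeomDecay ρ) (hρ : IsState ρ)
    (hχ : charFn ρ = gaussFn k l g (-conj g)) (hl : ‖l‖ < k)
    (hN : 0 < photonNumber k g) {c : ℂ} (hc : ‖c‖ = 1) :
    WignerPositive (photonSub c ρ) ↔ ∀ μ : ℂ,
      0 ≤ ‖(k - 1 / 2) * μ - l * conj μ + conj g‖ ^ 2 + (1 - k / (2 * (k ^ 2 - ‖l‖ ^ 2))) / 2 := by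
  constructor
  · intro hW μ
    obtain ⟨r, hr, e⟩ := h.wigner_photonSub hG hρ hχ hl hN hc μ
    have := hW (k * μ - l * conj μ + conj g)
    rw [e, Complex.zero_le_real] at this
    exact nonneg_of_mul_nonneg_right this hr
  · intro hW α
    obtain ⟨μ, hμ⟩ := exists_eq_sub_conj (sq_sub_normSq_pos hl).ne' (α - conj g)
    obtain ⟨r, hr, e⟩ := h.wigner_photonSub hG hρ hχ hl hN hc μ
    rw [← hμ, sub_add_cancel] at e
    rw [e, Complex.zero_le_real]
    exact mul_nonneg hr.le (hW μ)

end

/-! ### Integrals of coherent states -/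

lemma coherent_eq (z : ℂ) (m : ℕ) : coherent z m = dispKer z (conj z) m 0 := displacement_apply z m 0

lemma nsqrt_mul_coherent_succ (z : ℂ) (m : ℕ) :
    nsqrt (m + 1) * coherent z (m + 1) = z * coherent z m := by
  rw [coherent_eq, coherent_eq, dispKer_annL, nsqrt_zero]
  ring

lemma gaussDecay_coherent (m : ℕ) : GaussDecay fun z => coherent z m := by
  simp only [coherent_eq]
  exact gaussDecay_dispKer m 0

lemma gaussDecay_coherent_mul (m n : ℕ) :
    GaussDecay fun z => coherent z m * conj (coherent z n) :=
  (gaussDecay_coherent m).mul_tame (gaussDecay_coherent n).conj.tame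

lemma hasWirt_coherent (m : ℕ) (z : ℂ) : HasWirt (fun w => coherent w m)
    (nsqrt m * coherent z (m - 1) - conj z / 2 * coherent z m) (-(z / 2 * coherent z m)) z := by
  simp only [coherent_eq]
  exact (hasWirt_dispKer m 0 z).congr_deriv rfl (by rw [nsqrt_zero]; ring)

lemma hasWirt_coherent_mul (m n : ℕ) (z : ℂ) :
    HasWirt (fun w => coherent w m * conj (coherent w n))
    (nsqrt m * (coherent z (m - 1) * conj (coherent z n)) -
      conj z * (coherent z m * conj (coherent z n)))
    (nsqrt n * (coherent z m * conj (coherent z (n - 1))) -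
      z * (coherent z m * conj (coherent z n))) z := by
  refine ((hasWirt_coherent m z).mul (hasWirt_coherent n z).conj).congr_deriv ?_ ?_
  · simp only [map_neg, map_mul, map_div₀, map_ofNat]
    ring
  · simp only [map_sub, map_mul, map_div₀, map_ofNat, conj_nsqrt, Complex.conj_conj]
    ring

/-- The operator `∫ f(z) |z⟩⟨z| d²z`. -/
noncomputable def cohInt (f : ℂ → ℂ) : Matrix ℕ ℕ ℂ :=
  fun m n => ∫ z, f z * (coherent z m * conj (coherent z n))

lemma gaussDecay_mul_coherent {f : ℂ → ℂ} (hf : Tame f) (m n : ℕ) :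
    GaussDecay fun z => f z * (coherent z m * conj (coherent z n)) :=
  hf.mul_gaussDecay (gaussDecay_coherent_mul m n)

lemma cohInt_add {f g : ℂ → ℂ} (hf : Tame f) (hg : Tame g) :
    cohInt (fun z => f z + g z) = cohInt f + cohInt g := by
  ext m n
  simp only [cohInt, Matrix.add_apply, add_mul]
  exact integral_add (gaussDecay_mul_coherent hf m n).integrable
    (gaussDecay_mul_coherent hg m n).integrable

lemma cohInt_const_mul (c : ℂ) (f : ℂ → ℂ) : cohInt (fun z => c * f z) = c • cohInt f := by
  ext m n
  simp only [cohInt, Matrix.smul_apply, smul_eq_mul, mul_assoc]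
  exact integral_const_mul _ _

/-- The eigenvalue equation `a|z⟩ = z|z⟩`. -/
lemma cohInt_id_mul (f : ℂ → ℂ) : cohInt (fun z => z * f z) = annL (cohInt f) := by
  ext m n
  simp only [cohInt, annL, ← integral_const_mul]
  refine integral_congr_ae (Filter.Eventually.of_forall fun z => ?_)
  linear_combination (-f z * conj (coherent z n)) * nsqrt_mul_coherent_succ z m

lemma cohInt_conj_mul (f : ℂ → ℂ) : cohInt (fun z => conj z * f z) = creR (cohInt f) := by
  ext m n
  simp only [cohInt, creR, ← integral_const_mul]
  refine integral_congr_ae (Filter.Eventually.of_forall fun z => ?_)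
  have h := congrArg conj (nsqrt_mul_coherent_succ z n)
  simp only [map_mul, conj_nsqrt] at h
  linear_combination (-f z * coherent z m) * h

/-- Integration by parts with `∂_z |z⟩⟨z| = (a† - z̄)|z⟩⟨z|` and its adjoint. -/
lemma cohInt_wirt {f fz fzb : ℂ → ℂ} (h : ∀ z, HasWirt f (fz z) (fzb z) z) (hf : Tame f)
    (hz : Tame fz) (hzb : Tame fzb) :
    cohInt fz = creR (cohInt f) - creL (cohInt f) ∧
    cohInt fzb = annL (cohInt f) - annR (cohInt f) := by
  have hI := Tame.id
  have key : ∀ m n : ℕ,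
      (∫ z, (fz z * (coherent z m * conj (coherent z n)) +
        (nsqrt m * (f z * (coherent z (m - 1) * conj (coherent z n))) +
        (-1) * ((conj z * f z) * (coherent z m * conj (coherent z n))))) = 0) ∧
      (∫ z, (fzb z * (coherent z m * conj (coherent z n)) +
        (nsqrt n * (f z * (coherent z m * conj (coherent z (n - 1)))) +
        (-1) * ((z * f z) * (coherent z m * conj (coherent z n))))) = 0) := by
    intro m n
    refine integral_wirt_eq_zero (f := fun z => f z * (coherent z m * conj (coherent z n)))
      (fun z => ((h z).mul (hasWirt_coherent_mul m n z)).congr_deriv (by ring) (by ring))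
      (gaussDecay_mul_coherent hf m n) ?_ ?_
    · exact (gaussDecay_mul_coherent hz m n).add
        (((gaussDecay_mul_coherent hf (m - 1) n).const_mul _).add
        ((gaussDecay_mul_coherent (hI.conj.mul hf) m n).const_mul _))
    · exact (gaussDecay_mul_coherent hzb m n).add
        (((gaussDecay_mul_coherent hf m (n - 1)).const_mul _).add
        ((gaussDecay_mul_coherent (hI.mul hf) m n).const_mul _))
  constructor
  · rw [← cohInt_conj_mul]
    ext m n
    have d1 := (gaussDecay_mul_coherent hf (m - 1) n).const_mul (nsqrt m)
    have d2 := (gaussDecay_mul_coherent (hI.conj.mul hf) m n).const_mul (-1)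
    have := (key m n).1
    rw [integral_add (gaussDecay_mul_coherent hz m n).integrable (d1.add d2).integrable,
      integral_add d1.integrable d2.integrable, integral_const_mul, integral_const_mul] at this
    simp only [Matrix.sub_apply, creL, cohInt]
    linear_combination this
  · rw [← cohInt_id_mul]
    ext m n
    have d1 := (gaussDecay_mul_coherent hf m (n - 1)).const_mul (nsqrt n)
    have d2 := (gaussDecay_mul_coherent (hI.mul hf) m n).const_mul (-1)
    have := (key m n).2
    rw [integral_add (gaussDecay_mul_coherent hzb m n).integrable (d1.add d2).integrable,
      integral_add d1.integrable d2.integrable, integral_const_mul, integral_const_mul] at this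
    simp only [Matrix.sub_apply, annR, cohInt]
    linear_combination this

/-! ### Gaussian mixtures of coherent states -/

section

variable {h : ℝ} {b : ℂ}

lemma gaussFn_eq_ofReal (h : ℝ) (b a z : ℂ) :
    gaussFn h b a (conj a) z = ((Real.exp (-(h * ‖z‖ ^ 2) - (conj b * z ^ 2).re +
      2 * (a * z).re) : ℝ) : ℂ) := by
  rw [gaussFn, Complex.ofReal_exp]
  congr 1
  have h1 := Complex.add_conj (conj b * z ^ 2)
  have h2 := Complex.add_conj (a * z)
  simp only [map_mul, map_pow, Complex.conj_conj] at h1 h2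
  push_cast at h1 h2 ⊢
  rw [Complex.mul_conj']
  linear_combination h2 - h1 / 2

lemma cohInt_gaussFn (hb : ‖b‖ < h) (a a' : ℂ) :
    creL (cohInt (gaussFn h b a a')) = ((h : ℂ) + 1) • creR (cohInt (gaussFn h b a a')) +
      conj b • annL (cohInt (gaussFn h b a a')) - a • cohInt (gaussFn h b a a') ∧
    annR (cohInt (gaussFn h b a a')) = ((h : ℂ) + 1) • annL (cohInt (gaussFn h b a a')) +
      b • creR (cohInt (gaussFn h b a a')) - a' • cohInt (gaussFn h b a a') := by
  set G := gaussFn h b a a' with hG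
  have hT : Tame G := (gaussDecay_gaussFn hb a a').tame
  have hI := Tame.id
  have hw : ∀ z, HasWirt G ((-h) * (conj z * G z) + ((-(conj b)) * (z * G z) + a * G z))
      ((-h) * (z * G z) + ((-b) * (conj z * G z) + a' * G z)) z := fun z =>
    (hasWirt_gaussFn h b a a' z).congr_deriv (by ring) (by ring)
  have h1 := (hI.mul hT)
  have h2 := (hI.conj.mul hT)
  obtain ⟨ha, hb⟩ := cohInt_wirt hw hT
    ((h2.const_mul _).add ((h1.const_mul _).add (hT.const_mul _)))
    ((h1.const_mul _).add ((h2.const_mul _).add (hT.const_mul _)))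
  rw [cohInt_add (h2.const_mul _) ((h1.const_mul _).add (hT.const_mul _)),
    cohInt_add (h1.const_mul _) (hT.const_mul _), cohInt_const_mul, cohInt_const_mul,
    cohInt_const_mul, cohInt_id_mul, cohInt_conj_mul] at ha
  rw [cohInt_add (h1.const_mul _) ((h2.const_mul _).add (hT.const_mul _)),
    cohInt_add (h2.const_mul _) (hT.const_mul _), cohInt_const_mul, cohInt_const_mul,
    cohInt_const_mul, cohInt_id_mul, cohInt_conj_mul] at hb
  constructor
  · linear_combination (norm := module) ha
  · linear_combination (norm := module) hb

lemma cohInt_gaussFn_zero_zero (hb : ‖b‖ < h) (a : ℂ) :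
    ∃ r : ℝ, 0 < r ∧ cohInt (gaussFn h b a (conj a)) 0 0 = r := by
  have e : ∀ z, gaussFn h b a (conj a) z * (coherent z 0 * conj (coherent z 0)) =
      ((Real.exp (-(h * ‖z‖ ^ 2) - (conj b * z ^ 2).re + 2 * (a * z).re) *
        Real.exp (-‖z‖ ^ 2) : ℝ) : ℂ) := by
    intro z
    rw [gaussFn_eq_ofReal, Complex.ofReal_mul, coherent_eq, dispKer_zero_zero, ← Complex.exp_conj,
      ← Complex.exp_add, Complex.ofReal_exp (-‖z‖ ^ 2)]
    congr 2
    simp only [map_div₀, map_neg, map_mul, Complex.conj_conj, map_ofNat]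
    push_cast
    rw [← Complex.mul_conj']
    ring
  have hi := (gaussDecay_mul_coherent (gaussDecay_gaussFn hb a (conj a)).tame 0 0).integrable
  simp only [e] at hi
  refine ⟨∫ z : ℂ, Real.exp (-(h * ‖z‖ ^ 2) - (conj b * z ^ 2).re + 2 * (a * z).re) *
    Real.exp (-‖z‖ ^ 2), ?_, ?_⟩
  rotate_left
  · simp only [cohInt, e]
    exact integral_complex_ofReal
  · refine integral_pos_of_integrable_nonneg_nonzero (x := 0) (by fun_prop) ?_ ?_ ?_
    · exact hi.re
    · intro z
      positivity
    · positivity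

end

section

variable {k : ℝ} {l g : ℂ} {ρ : Matrix ℕ ℕ ℂ}

/-- The parameters solve the linear equations that match `cohInt_gaussFn` with `GaussRel`. Their
determinant is `D = (k - 1/2)² - |l|²`, and the hypothesis, which amounts to `v₁ > 1`, makes the
weight integrable. -/
lemma gaussRel_cohInt (hl : ‖l‖ < k - 1 / 2) :
    ∃ (h : ℝ) (b a : ℂ), ‖b‖ < h ∧ GaussRel k l g (cohInt (gaussFn h b a (conj a))) := by
  have hn := norm_nonneg l
  set η : ℝ := k - 1 / 2 with hη
  set D : ℝ := η ^ 2 - ‖l‖ ^ 2 with hD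
  have hD0 : 0 < D := sq_sub_normSq_pos hl
  have hDc : (D : ℂ) ≠ 0 := Complex.ofReal_ne_zero.2 hD0.ne'
  have hDe : (D : ℂ)⁻¹ * (η ^ 2 - l * conj l) = 1 := by
    rw [Complex.mul_conj', ← inv_mul_cancel₀ hDc, hD]
    push_cast
    rfl
  have hk : (k : ℂ) = η + 1 / 2 := by
    rw [hη]
    push_cast
    ring
  refine ⟨η / D, l / D, (η * g + conj l * conj g) / D, ?_, ?_⟩
  · rw [norm_div, Complex.norm_real, Real.norm_of_nonneg hD0.le]
    gcongr
  · have hb : ‖l / (D : ℂ)‖ < η / D := by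
      rw [norm_div, Complex.norm_real, Real.norm_of_nonneg hD0.le]
      gcongr
    set a : ℂ := (η * g + conj l * conj g) / D with ha
    have hac : conj a = (η * conj g + l * g) / D := by
      simp [ha]
    obtain ⟨e1, e2⟩ := cohInt_gaussFn hb a (conj a)
    set τ := cohInt (gaussFn (η / D) (l / D) a (conj a))
    have hbc : conj (l / (D : ℂ)) = conj l / D := by simp
    rw [hbc, Complex.ofReal_div] at e1
    rw [Complex.ofReal_div] at e2
    constructor
    · rw [hk, e1, e2, hac]
      match_scalars
      · linear_combination (-1 : ℂ) * hDe
      · ring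
      · linear_combination conj g * hDe
    · rw [hk, e1, e2, hac]
      match_scalars
      · linear_combination (-1 : ℂ) * hDe
      · ring
      · linear_combination g * hDe

/-- By uniqueness for the ladder relations, `ρ` is a positive multiple of the Gaussian mixture.
Subtraction multiplies the weight by `z` on the left and by `z̄` on the right. -/
theorem GaussRel.hasPFunction_photonSub (h : GaussRel k l g ρ) (hG : GeomDecay ρ) (hρ : IsState ρ)
    (hl : ‖l‖ < k - 1 / 2) (hN : 0 < photonNumber k g) {c : ℂ} (hc : ‖c‖ = 1) :
    ∃ P, HasPFunction (photonSub c ρ) P := by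
  obtain ⟨s, b, a, hb, hτ⟩ := gaussRel_cohInt (g := g) hl
  obtain ⟨r, hr, e0⟩ := cohInt_gaussFn_zero_zero hb a
  have hD : relDet k l ≠ 0 := by
    have h1 : 0 < (k + 1 / 2) ^ 2 - ‖l‖ ^ 2 := sq_sub_normSq_pos (by linarith)
    exact h1.ne'
  have hY0 : cohInt (gaussFn s b a (conj a)) 0 0 ≠ 0 := by
    rw [e0]
    exact Complex.ofReal_ne_zero.2 hr.ne'
  have hX := h.eq_smul hτ hD hY0
  have h0 := h.zero_zero_pos hD hρ
  rw [e0, entry_eq_ofReal hρ.1] at hX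
  set x := (ρ 0 0).re
  set p : ℂ → ℝ := fun z => Real.exp (-(s * ‖z‖ ^ 2) - (conj b * z ^ 2).re + 2 * (a * z).re) with hp
  have hgp : ∀ z, gaussFn s b a (conj a) z = (p z : ℂ) := gaussFn_eq_ofReal s b a
  have hI := Tame.id
  have hP : ∀ z, ((((photonNumber k g)⁻¹ * (x / r)) * (p z * ‖z‖ ^ 2) : ℝ) : ℂ) =
      ((photonNumber k g : ℂ)⁻¹ * (x / r)) * (z * (conj z * gaussFn s b a (conj a) z)) := by
    intro z
    rw [hgp]
    push_cast
    rw [← Complex.mul_conj']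
    ring
  refine ⟨fun z => ((photonNumber k g)⁻¹ * (x / r)) * (p z * ‖z‖ ^ 2), fun z => ?_, ?_,
    fun m n => ?_⟩
  · have := Real.exp_pos (-(s * ‖z‖ ^ 2) - (conj b * z ^ 2).re + 2 * (a * z).re)
    simp only [hp]
    positivity
  · have := ((hI.mul_gaussDecay (hI.conj.mul_gaussDecay
      (gaussDecay_gaussFn hb a (conj a)))).const_mul
      ((photonNumber k g : ℂ)⁻¹ * (x / r))).integrable
    simp only [← hP] at this
    exact this.re
  · simp only [hP]
    change _ = cohInt (fun z => ((photonNumber k g : ℂ)⁻¹ * (x / r)) *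
      (z * (conj z * gaussFn s b a (conj a) z))) m n
    rw [cohInt_const_mul, cohInt_id_mul (fun z => conj z * gaussFn s b a (conj a) z),
      cohInt_conj_mul, h.photonSub_eq hG hρ hc]
    nth_rewrite 1 [hX]
    rw [creR_smul, annL_smul, smul_smul]

end

lemma tsum_coherent (z : ℂ) : ∑' n, coherent z n * conj (coherent z n) = 1 := by
  rw [← colInner_zero_zero z, colInner]
  refine tsum_congr fun n => ?_
  rw [coherent_eq, mul_comm]

/-- What is missing is total mass one: summing the diagonal entries, with `∑ₙ |⟨n|z⟩|² = 1`,
identifies `∫ P` with the trace. The terms are nonnegative with summable integrals, which justifies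
the exchange. -/
theorem HasPFunction.isClassical {ρ : Matrix ℕ ℕ ℂ} {P : ℂ → ℝ} (h : HasPFunction ρ P)
    (hρ : IsState ρ) : IsClassical ρ := by
  obtain ⟨hP, hi, he⟩ := h
  have hm : AEMeasurable (fun z => ENNReal.ofReal (P z)) := hi.1.aemeasurable.ennreal_ofReal
  have hF : ∀ n, Integrable fun z => (P z : ℂ) * (coherent z n * conj (coherent z n)) := by
    intro n
    obtain ⟨hc, ε, hε, C, hC, hb⟩ := gaussDecay_coherent_mul n n
    refine hi.ofReal.mul_bdd (c := C) hc.aestronglyMeasurable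
      (Filter.Eventually.of_forall fun z => (hb z).trans ?_)
    exact mul_le_of_le_one_right hC (Real.exp_le_one_iff.2 (by nlinarith [sq_nonneg ‖z‖]))
  have hnorm : ∀ n z, ((‖(P z : ℂ) * (coherent z n * conj (coherent z n))‖ : ℝ) : ℂ) =
      (P z : ℂ) * (coherent z n * conj (coherent z n)) := by
    intro n z
    rw [Complex.mul_conj', norm_mul, Complex.norm_real, Real.norm_of_nonneg (hP z), norm_pow,
      Complex.norm_real, norm_norm]
    push_cast
    rfl
  have hsum : Summable fun n => ∫ z, ‖(P z : ℂ) * (coherent z n * conj (coherent z n))‖ := by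
    refine (hρ.2.summable.mapL Complex.reCLM).congr fun n => ?_
    have e := integral_complex_ofReal (μ := (volume : Measure ℂ))
      (f := fun z => ‖(P z : ℂ) * (coherent z n * conj (coherent z n))‖)
    simp only [hnorm] at e
    rw [he n n, e]
    simp
  have hS := hasSum_integral_of_summable_integral_norm hF hsum
  simp only [← he, tsum_mul_left, tsum_coherent, mul_one] at hS
  have h1 : ∫ z, P z = 1 := by
    have := hS.unique hρ.2
    rw [integral_complex_ofReal] at this
    exact_mod_cast this
  refine ⟨volume.withDensity fun z => ENNReal.ofReal (P z), ⟨?_⟩, fun m n => ?_⟩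
  · rw [withDensity_apply _ MeasurableSet.univ, Measure.restrict_univ,
      ← ofReal_integral_eq_lintegral_ofReal hi (Filter.Eventually.of_forall hP), h1,
      ENNReal.ofReal_one]
  · rw [integral_withDensity_eq_integral_toReal_smul₀ hm (by simp), he m n]
    refine integral_congr_ae (Filter.Eventually.of_forall fun z => ?_)
    beta_reduce
    rw [ENNReal.toReal_ofReal (hP z), Complex.real_smul]

/-! ### Gaussian states in terms of the eigenbasis of the covariance matrix -/

section

variable {V : Matrix (Fin 2) (Fin 2) ℝ} {v₁ v₂ : ℝ} {e₁ e₂ : Fin 2 → ℝ}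

/-- In the plane the second eigenvector is `e₁` rotated by a right angle up to sign, and the entries
are quadratic in it, so `e₁` alone describes `V`. Orthonormality of the rows is first derived from
that of the columns. -/
lemma entries_of_eigenbasis (he₁ : V *ᵥ e₁ = v₁ • e₁) (he₂ : V *ᵥ e₂ = v₂ • e₂)
    (hn₁ : e₁ ⬝ᵥ e₁ = 1) (hn₂ : e₂ ⬝ᵥ e₂ = 1) (horth : e₁ ⬝ᵥ e₂ = 0) :
    V 0 0 = v₁ * e₁ 0 ^ 2 + v₂ * e₁ 1 ^ 2 ∧ V 0 1 = (v₁ - v₂) * (e₁ 0 * e₁ 1) ∧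
    V 1 0 = (v₁ - v₂) * (e₁ 0 * e₁ 1) ∧ V 1 1 = v₁ * e₁ 1 ^ 2 + v₂ * e₁ 0 ^ 2 := by
  have a0 := congrFun he₁ 0
  have a1 := congrFun he₁ 1
  have b0 := congrFun he₂ 0
  have b1 := congrFun he₂ 1
  simp only [Matrix.mulVec, dotProduct, Fin.sum_univ_two, Pi.smul_apply, smul_eq_mul] at *
  generalize e₁ 0 = a at *
  generalize e₁ 1 = b at *
  generalize e₂ 0 = c at *
  generalize e₂ 1 = d at *
  have h1 : a * a + c * c = 1 := by
    linear_combination (a * c - b * d) * horth + (1 - c * c) * hn₁ + b * b * hn₂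
  have h2 : b * b + d * d = 1 := by linear_combination hn₁ + hn₂ - h1
  have h3 : a * b + c * d = 0 := by
    have : (a * b + c * d) ^ 2 = 0 := by
      have hc : c * c = b * b := by linear_combination h1 - hn₁
      have hd : d * d = a * a := by linear_combination h2 - hn₁
      linear_combination 2 * a * c * horth + (d * d - 2 * a * a) * hc + b * b * hd
    exact pow_eq_zero_iff two_ne_zero |>.1 this
  refine ⟨?_, ?_, ?_, ?_⟩
  · linear_combination a * a0 + c * b0 - V 0 0 * h1 - V 0 1 * h3 + v₂ * (h1 - hn₁)
  · linear_combination b * a0 + d * b0 - V 0 0 * h3 - V 0 1 * h2 + v₂ * h3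
  · linear_combination a * a1 + c * b1 - V 1 0 * h1 - V 1 1 * h3 + v₂ * h3
  · linear_combination b * a1 + d * b1 - V 1 0 * h3 - V 1 1 * h2 + v₂ * (h2 - hn₁)

lemma gaussianCharFn_eq (he₁ : V *ᵥ e₁ = v₁ • e₁) (he₂ : V *ᵥ e₂ = v₂ • e₂)
    (hn₁ : e₁ ⬝ᵥ e₁ = 1) (hn₂ : e₂ ⬝ᵥ e₂ = 1) (horth : e₁ ⬝ᵥ e₂ = 0) (d : Fin 2 → ℝ) {ε g : ℂ}
    (hε : ε = ⟨e₁ 0, e₁ 1⟩) (hg : g = (Real.sqrt 2 / 2 : ℝ) * ⟨d 0, -d 1⟩) :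
    gaussianCharFn V d =
      gaussFn ((v₁ + v₂) / 4) (((v₂ - v₁) / 4 : ℝ) * ε ^ 2) g (-conj g) := by
  obtain ⟨h00, h01, h10, h11⟩ := entries_of_eigenbasis he₁ he₂ hn₁ hn₂ horth
  have hn : e₁ 0 * e₁ 0 + e₁ 1 * e₁ 1 = 1 := by simpa [dotProduct] using hn₁
  funext z
  obtain ⟨x, y⟩ := z
  have hq : ![x, y] ⬝ᵥ (symp * V * sympᵀ) *ᵥ ![x, y] =
      V 1 1 * x ^ 2 - (V 0 1 + V 1 0) * (x * y) + V 0 0 * y ^ 2 := by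
    simp [symp, Matrix.mulVec, Matrix.vecMul, dotProduct, Fin.sum_univ_two, Matrix.mul_apply]
    ring
  have hl : (symp *ᵥ d) ⬝ᵥ ![x, y] = d 1 * x - d 0 * y := by
    simp [symp, Matrix.mulVec, dotProduct, Fin.sum_univ_two]
    ring
  rw [gaussianCharFn, gaussFn]
  dsimp only
  rw [hq, hl, h00, h01, h10, h11, hg, hε]
  congr 1
  obtain ⟨s, hs⟩ : ∃ s, s = Real.sqrt 2 / 2 := ⟨_, rfl⟩
  obtain ⟨q, hq⟩ : ∃ q, q = (v₂ - v₁) / 4 := ⟨_, rfl⟩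
  have hs2 : Real.sqrt 2 = 2 * s := by rw [hs]; ring
  rw [← hs, ← hq, hs2]
  refine Complex.ext ?_ ?_
  · simp [pow_two]
    rw [hq]
    linear_combination (-(v₁ + v₂) / 4 * (x * x + y * y)) * hn
  · simp [pow_two]
    ring

end

lemma norm_gaussFn_neg_conj (k : ℝ) (l g z : ℂ) :
    ‖gaussFn k l g (-conj g) z‖ = Real.exp (-(k * ‖z‖ ^ 2 + (conj l * z ^ 2).re)) := by
  rw [gaussFn, Complex.norm_exp]
  congr 1
  have h1 := Complex.add_conj (conj l * z ^ 2)
  have h2 := Complex.sub_conj (g * z)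
  simp only [map_mul, map_pow, Complex.conj_conj] at h1 h2
  rw [h1, Complex.mul_conj', neg_mul, ← sub_eq_add_neg, h2]
  have e : -((k : ℂ) * (‖z‖ : ℂ) ^ 2 + ((2 * (conj l * z ^ 2).re : ℝ) : ℂ) / 2) +
      ((2 * (g * z).im : ℝ) : ℂ) * Complex.I =
      ((-(k * ‖z‖ ^ 2 + (conj l * z ^ 2).re) : ℝ) : ℂ) + ((2 * (g * z).im : ℝ) : ℂ) * Complex.I := by
    push_cast
    ring
  rw [e]
  simp only [Complex.add_re, Complex.ofReal_re, Complex.re_ofReal_mul, Complex.I_re, mul_zero,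
    add_zero]

/-- Evaluates `|χ| ≤ 1` at `iε`, the direction of slowest decay. Strict inequality follows only
later, from the uncertainty relation. -/
lemma norm_le_of_charFn {ρ : Matrix ℕ ℕ ℂ} (hρ : IsState ρ) {k : ℝ} {l g : ℂ}
    (hχ : charFn ρ = gaussFn k l g (-conj g)) : ‖l‖ ≤ k := by
  obtain ⟨ε, hε, hl⟩ := exists_norm_mul_sq l
  have h := norm_charFn_le_one hρ (Complex.I * ε)
  rw [hχ, norm_gaussFn_neg_conj, Real.exp_le_one_iff] at h
  have e : conj l * (Complex.I * ε) ^ 2 = ((-‖l‖ : ℝ) : ℂ) := by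
    have hεc : ε * conj ε = 1 := by
      rw [Complex.mul_conj', hε]
      simp
    nth_rewrite 1 [hl]
    simp only [map_mul, map_pow, Complex.conj_ofReal]
    push_cast
    linear_combination (‖l‖ * (ε * conj ε + 1) * Complex.I ^ 2) * hεc + ‖l‖ * Complex.I_sq
  rw [e, Complex.ofReal_re, norm_mul, Complex.norm_I, hε] at h
  linarith

/-! ### The minimum of the Wigner function of the photon-subtracted state -/

section

variable {k : ℝ} {l g : ℂ} {ρ : Matrix ℕ ℕ ℂ}

lemma forall_normSq_add_nonneg_iff (hd : (k - 1 / 2) ^ 2 - ‖l‖ ^ 2 ≠ 0) (C : ℝ) :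
    (∀ μ : ℂ, 0 ≤ ‖(k - 1 / 2) * μ - l * conj μ + conj g‖ ^ 2 + (1 - C) / 2) ↔ C ≤ 1 := by
  constructor
  · intro h
    obtain ⟨μ, hμ⟩ := exists_eq_sub_conj hd (-conj g)
    have := h μ
    push_cast at hμ
    rw [← hμ] at this
    simp at this
    linarith
  · intro h μ
    have := sq_nonneg ‖(k - 1 / 2) * μ - l * conj μ + conj g‖
    linarith

/-- After rotation by `ε̄` the map `ημ - ηε²μ̄` is purely imaginary: it can only move the imaginary
part, and the real part of `ε̄γ` is a fixed cost. -/
lemma normSq_degenerate {ε : ℂ} (hε : ‖ε‖ = 1) (η : ℝ) (γ μ : ℂ) :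
    ‖η * μ - (η * ε ^ 2) * conj μ + γ‖ ^ 2 =
      (conj ε * γ).re ^ 2 + (2 * η * (conj ε * μ).im + (conj ε * γ).im) ^ 2 := by
  have hεc : conj ε * ε = 1 := by
    rw [Complex.conj_mul', hε]
    simp
  have h1 : ‖η * μ - (η * ε ^ 2) * conj μ + γ‖ =
      ‖conj ε * (η * μ - (η * ε ^ 2) * conj μ + γ)‖ := by
    rw [norm_mul, RCLike.norm_conj, hε, one_mul]
  have h2 := Complex.sub_conj (conj ε * μ)
  simp only [map_mul, Complex.conj_conj] at h2
  have h3 : conj ε * (η * μ - (η * ε ^ 2) * conj μ + γ) =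
      (((conj ε * γ).re : ℝ) : ℂ) + ((2 * η * (conj ε * μ).im + (conj ε * γ).im : ℝ) : ℂ) *
        Complex.I := by
    have h4 := Complex.re_add_im (conj ε * γ)
    push_cast at h2 ⊢
    linear_combination η * h2 - h4 - η * ε * conj μ * hεc
  rw [h1, h3, ← Complex.normSq_eq_norm_sq, Complex.normSq_add_mul_I]

lemma forall_normSq_degenerate_iff {ε : ℂ} (hε : ‖ε‖ = 1) {η : ℝ} (hη : η ≠ 0) (γ : ℂ) (C : ℝ) :
    (∀ μ : ℂ, 0 ≤ ‖η * μ - (η * ε ^ 2) * conj μ + γ‖ ^ 2 + (1 - C) / 2) ↔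
      C ≤ 1 + 2 * (conj ε * γ).re ^ 2 := by
  constructor
  · intro h
    obtain ⟨t, ht⟩ : ∃ t : ℝ, 2 * η * t + (conj ε * γ).im = 0 :=
      ⟨-((conj ε * γ).im / (2 * η)), by field_simp; ring⟩
    have h1 := h (ε * (Complex.I * t))
    have e : (conj ε * (ε * (Complex.I * t))).im = t := by
      rw [← mul_assoc, Complex.conj_mul', hε]
      simp
    rw [normSq_degenerate hε, e, ht] at h1
    linarith
  · intro h μ
    rw [normSq_degenerate hε]
    have := sq_nonneg (2 * η * (conj ε * μ).im + (conj ε * γ).im)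
    linarith

end

end OneMode

/-! ### The theorem in terms of the covariance eigenvalues -/

open OneMode

theorem lemma3 (ρ : Matrix ℕ ℕ ℂ) (hρ : IsGaussianState ρ)
    (c : ℂ) (hc : ‖c‖ = 1) (hsub : lower c ⊡ ρ ⊡ raise c ≠ 0)
    (v₁ v₂ : ℝ) (e₁ e₂ : Fin 2 → ℝ) (hv : v₁ ≤ v₂)
    (he₁ : covMat ρ *ᵥ e₁ = v₁ • e₁) (he₂ : covMat ρ *ᵥ e₂ = v₂ • e₂)
    (hn₁ : e₁ ⬝ᵥ e₁ = 1) (hn₂ : e₂ ⬝ᵥ e₂ = 1) (horth : e₁ ⬝ᵥ e₂ = 0) :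
    -- all objects below are well defined
    (HasQCS ρ ∧ IsState (photonSub c ρ) ∧ Integrable (charFn (photonSub c ρ))) ∧
    (1 < v₁ → (∃ P, HasPFunction (photonSub c ρ) P) ∧ IsClassical (photonSub c ρ) ∧
      WignerPositive (photonSub c ρ)) ∧
    (v₁ < 1 → (WignerNegative (photonSub c ρ) ↔ 1 < qcsSq ρ)) ∧
    (v₁ = 1 → (WignerNegative (photonSub c ρ) ↔ 1 + (dispVec ρ ⬝ᵥ e₁) ^ 2 < qcsSq ρ)) ∧
    (WignerNegative (photonSub c ρ) → 1 < qcsSq ρ) := by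
  obtain ⟨hρ, hχ⟩ := hρ
  set d := dispVec ρ
  obtain ⟨ε, hε⟩ : ∃ ε : ℂ, ε = ⟨e₁ 0, e₁ 1⟩ := ⟨_, rfl⟩
  obtain ⟨g, hg⟩ : ∃ g : ℂ, g = (Real.sqrt 2 / 2 : ℝ) * ⟨d 0, -d 1⟩ := ⟨_, rfl⟩
  have hχ' := (funext hχ).trans (gaussianCharFn_eq he₁ he₂ hn₁ hn₂ horth d hε hg)
  have hε1 : ‖ε‖ = 1 := by
    have : ‖ε‖ ^ 2 = 1 := by
      rw [← Complex.normSq_eq_norm_sq, hε, Complex.normSq_mk]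
      simpa [dotProduct] using hn₁
    exact (pow_eq_one_iff_of_nonneg (norm_nonneg _) two_ne_zero).1 this
  obtain ⟨l, hl⟩ : ∃ l : ℂ, l = ((v₂ - v₁) / 4 : ℝ) * ε ^ 2 := ⟨_, rfl⟩
  obtain ⟨k, hk⟩ : ∃ k : ℝ, k = (v₁ + v₂) / 4 := ⟨_, rfl⟩
  rw [← hl, ← hk] at hχ'
  have hln : ‖l‖ = (v₂ - v₁) / 4 := by
    rw [hl, norm_mul, Complex.norm_real, Real.norm_of_nonneg (by linarith), norm_pow, hε1]
    ring
  have hR := gaussRel_of_charFn hρ hχ'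
  have hle := norm_le_of_charFn hρ hχ'
  have hlk : ‖l‖ < k + 1 / 2 := by linarith
  have hD : 0 < relDet k l := sq_sub_normSq_pos hlk
  have hB := hR.relB_nonneg hD hρ
  have hG : GeomDecay ρ := hR.geomBound hlk hρ
  -- Here `relB` is `(v₁v₂ - 1)/4`.
  have hvv : 1 ≤ v₁ * v₂ := by
    rw [relB, hln, hk] at hB
    nlinarith
  have hlt : ‖l‖ < k := by
    refine lt_of_le_of_ne hle fun h => ?_
    have : v₁ = 0 := by linarith
    rw [this] at hvv
    linarith
  have hd := sq_sub_normSq_pos hlt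
  have h0 : ρ 0 0 ≠ 0 := fun h => by
    have := hR.zero_zero_pos hD.ne' hρ
    rw [h] at this
    simp at this
  rw [lower_opMul_raise hc] at hsub
  have hN := hR.photonNumber_pos hG hρ hsub
  have hS := hR.isState_photonSub hG hρ hc hsub
  have hW := hR.wignerPositive_iff hG hρ hχ' hlt hN hc
  rw [← hR.qcsSq_eq hG hρ h0 hd] at hW
  have hgen : WignerNegative (photonSub c ρ) → 1 < qcsSq ρ := by
    rw [WignerNegative, not_imp_comm, hW, not_lt]
    intro hC μ
    have := sq_nonneg ‖(k - 1 / 2) * μ - l * conj μ + conj g‖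
    linarith
  refine ⟨⟨hG.hasQCS, hS, hR.integrable_charFn_photonSub hG hρ hχ' hlt hc⟩, ?_, ?_, ?_, hgen⟩
  · intro h1
    obtain ⟨P, hP⟩ := hR.hasPFunction_photonSub hG hρ (by linarith) hN hc
    refine ⟨⟨P, hP⟩, hP.isClassical hS, ?_⟩
    -- Negativity would give `C² > 1`, whereas `C²` is the mean of `1/v₁` and `1/v₂`, both below
    -- `1`.
    by_contra hneg
    have hC := hgen hneg
    rw [hR.qcsSq_eq hG hρ h0 hd, lt_div_iff₀ (by linarith), hln, hk] at hC
    nlinarith [mul_pos (sub_pos.2 h1) (sub_pos.2 (h1.trans_le hv))]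
  · intro h1
    -- The uncertainty relation makes the determinant `(v₁ - 1)(v₂ - 1)/4` nonzero.
    have h2 : 1 < v₂ := by nlinarith
    rw [WignerNegative, hW, forall_normSq_add_nonneg_iff, not_le]
    rw [hln, hk]
    have := mul_pos (sub_pos.2 h1) (sub_pos.2 h2)
    intro h
    nlinarith
  · intro h1
    have hre : (conj ε * conj g).re = Real.sqrt 2 / 2 * (d ⬝ᵥ e₁) := by
      rw [hε, hg]
      generalize Real.sqrt 2 / 2 = s
      simp [dotProduct]
      ring
    have hs : Real.sqrt 2 * Real.sqrt 2 = 2 := Real.mul_self_sqrt zero_le_two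
    have hη : k - 1 / 2 = (v₂ - v₁) / 4 := by
      rw [hk, h1]
      ring
    -- If `v₂ = 1` as well, the linear map vanishes and `C² = 1`, so both sides are false; otherwise
    -- it has rank one.
    rcases eq_or_ne ((v₂ - v₁) / 4) 0 with h2 | h2
    · have hC : qcsSq ρ = 1 := by
        rw [hR.qcsSq_eq hG hρ h0 hd, hln, h2, sub_eq_zero.1 (hη.trans h2)]
        norm_num
      rw [hC]
      constructor
      · intro h
        have := hgen h
        linarith
      · intro h
        nlinarith [sq_nonneg (d ⬝ᵥ e₁)]
    · have hηc : (k : ℂ) - 1 / 2 = (((v₂ - v₁) / 4 : ℝ) : ℂ) := by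
        rw [← hη]
        push_cast
        rfl
      rw [WignerNegative, hW, hηc, hl, forall_normSq_degenerate_iff hε1 h2, hre, not_le]
      have e : 2 * (Real.sqrt 2 / 2 * (d ⬝ᵥ e₁)) ^ 2 = (d ⬝ᵥ e₁) ^ 2 := by
        linear_combination (d ⬝ᵥ e₁) ^ 2 / 2 * hs
      rw [e]
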